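/- Let $a\ge 0$ be an integer, $m=-a$, $n=2a+3$, and $$A_{m,n}=\begin{pmatrix}0&1&0\\0&0&1\\1&-m&-n\end{pmatrix}\in SL(3,\mathbb Z).$$ The characteristic polynomial of $A_{m,n}$ is irreducible over $\mathbb Q$ and its roots are real and distinct. The three planes spanned by pairs of linearly independent eigenvectors of $A_{m,n}$ split $\mathbb R^3$ into open orthants; the sail of an orthant is the boundary of the convex hull of all integer points except the origin in its closure, and the faces of the sail are the faces of this convex hull. Exactly one orthant has a sail that contains the point $(0,0,1)$; let $S$ be this sail, and let $G$ be the group of the operators in $SL(3,\mathbb Z)$ that commute with $A_{m,n}$ and map $S$ to itself. Let $$X=A_{m,n}^{-2},\qquad Y=(2I-A_{m,n}^{-1})^{-1},$$ $$A=(0,0,1),\quad B=(2,1,1),\quad C=(7,4,2),\quad D=(-a,1,0),\quad E=(3,2,1).$$ Then $G$ is a free abelian group with basis $X,Y$. The operator $X$ maps $A$ to $D$, $B$ to $C$, and the segment $AB$ onto $DC$; the operator $Y$ maps $A$ to $B$, $D$ to $C$, and the segment $AD$ onto $BC$. The point $E$ lies on $S$. In both cases below, the torus triangulation is the decomposition of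 the quotient $S/G$ into the images of the vertices, edges and two-dimensional faces of $S$; it is said to be homeomorphic to a decomposition of $\mathbb R^2/\mathbb Z^2$ if some homeomorphism of $S/G$ onto $\mathbb R^2/\mathbb Z^2$ carries the cells of each dimension onto the cells of the same dimension. In the plane let $A'=(0,0)$, $B'=(0,1)$, $C'=(1,1)$, $D'=(1,0)$, $E'=(2/3,2/3)$. The integer length of a segment (integer area of a triangle) with integer vertices is its Euclidean length (area) divided by the least Euclidean length (area) of a nondegenerate integer segment (triangle) in the same line (plane); the integer distance from an integer plane to an integer point is the Euclidean distance divided by the least Euclidean distance from the plane to an integer point outside the plane. **Case $a=0$.** The torus triangulation is homeomorphic to the decomposition of $\mathbb R^2/\mathbb Z^2$ into the images of the vertex $A'$, the edges $A'B'$, $A'D'$, $B'D'$ and the triangles $A'B'D'$, $B'C'D'$. The vertex $A$, the edges $AB$, $AD$, $BD$ and the triangles $ABD$, $BCD$ are faces of $S$, and they contain exactly one face from each class of faces of $S$ under $G$; so the union $ABD\cup BCD$ is the closure of a fundamental region. The vertices of $S$ on it are exactly $A,B,C,D$, and $E$ is the centroid of the face $BCD$. The integer lengths of $AB$, $BC$,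 $CD$, $DA$ are equal to $1$; the integer areas of $ABD$ and $BCD$ are $1$ and $3$; the integer distances from the origin to the planes containing $ABD$ and $BCD$ are $2$ and $1$, respectively. **Case $a>0$.** The torus triangulation is homeomorphic to the decomposition of $\mathbb R^2/\mathbb Z^2$ into the images of the vertices $A'$, $E'$, the edges $A'B'$, $A'D'$, $B'D'$, $B'E'$, $C'E'$, $D'E'$ and the triangles $A'B'D'$, $B'D'E'$, $B'C'E'$, $C'E'D'$. The vertices $A$, $E$, the edges $AB$, $AD$, $BD$, $BE$, $CE$, $DE$ and the triangles $ABD$, $BDE$, $BCE$, $CED$ are faces of $S$, and they contain exactly one face from each class of faces of $S$ under $G$; so the union of the four triangles is the closure of a fundamental region. The vertices of $S$ on it are exactly $A,B,C,D,E$. The integer lengths of all sides $AB$, $BC$, $CD$, $DA$, $BD$, $BE$, $CE$, $DE$ and the integer areas of all four triangles are equal to $1$; the integer distances from the origin to the planes containing $ABD$, $BDE$, $BCE$, $CED$ are $a+2$, $a+1$, $1$, $1$, respectively. -/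

import Mathlib

namespace TorusSail

/-- Three-dimensional Euclidean space. -/
abbrev E3 : Type := EuclideanSpace ℝ (Fin 3)

/-- The group `SL(3, ℤ)`. -/
abbrev SL3Z : Type := Matrix.SpecialLinearGroup (Fin 3) ℤ

/-- The linear operator of `ℝ³` given by an integer matrix of determinant one
(acting on column vectors). -/
noncomputable def act (g : SL3Z) : E3 →ₗ[ℝ] E3 :=
  Matrix.toEuclideanLin ((g : Matrix (Fin 3) (Fin 3) ℤ).map (Int.cast : ℤ → ℝ))

theorem act_one : act 1 = LinearMap.id := by
  simp [act, Matrix.toEuclideanLin]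

theorem act_mul (g h : SL3Z) : act (g * h) = act g ∘ₗ act h := by
  simp [act, Matrix.toEuclideanLin, Matrix.map_mul_intCast]

theorem act_inv_act (g : SL3Z) (p : E3) : act g⁻¹ (act g p) = p := by
  have h := act_mul g⁻¹ g
  rw [inv_mul_cancel, act_one] at h
  exact (LinearMap.congr_fun h p).symm

/-- The integer points of `ℝ³`. -/
def integerPoints : Set E3 := {p | ∀ i, ∃ k : ℤ, p i = k}

/-- The integer point with the given coordinates. -/
noncomputable def pt (x y z : ℤ) : E3 := !₂[(x : ℝ), (y : ℝ), (z : ℝ)]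

/-! ### Sails -/

/-- The planes spanned by pairs of linearly independent eigenvectors of `M`. -/
def eigenplanes (M : SL3Z) : Set (Submodule ℝ E3) :=
  {H | ∃ (μ ν : ℝ) (v w : E3), Module.End.HasEigenvector (act M) μ v ∧
    Module.End.HasEigenvector (act M) ν w ∧ LinearIndependent ℝ ![v, w] ∧
    H = Submodule.span ℝ {v, w}}

/-- The complement of the union of these planes. -/
def eigenplanesCompl (M : SL3Z) : Set E3 := (⋃ H ∈ eigenplanes M, (H : Set E3))ᶜ

/-- An open orthant of `M`: a connected component of the complement of the planes. -/
def IsOrthant (M : SL3Z) (O : Set E3) : Prop :=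
  ∃ p ∈ eigenplanesCompl M, O = connectedComponentIn (eigenplanesCompl M) p

/-- The convex hull of all integer points, except the origin, in the closure of the orthant. -/
def sailHull (O : Set E3) : Set E3 :=
  convexHull ℝ ((closure O ∩ integerPoints) \ {0})

/-- The sail of an orthant. -/
def sail (O : Set E3) : Set E3 := frontier (sailHull O)

/-- The faces of dimension `k` of the sail: the `k`-dimensional nonempty sets which are cut out of
the convex hull by a supporting plane. -/
def IsFace (O : Set E3) (k : ℕ) (F : Set E3) : Prop :=
  F.Nonempty ∧ F ⊆ sail O ∧ IsExposed ℝ (sailHull O) F ∧ Module.finrank ℝ (vectorSpan ℝ F) = k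

/-- The group of the integer operators of determinant one that commute with `M` and map the sail
to itself. -/
def periodGroup (M : SL3Z) (O : Set E3) : Subgroup SL3Z where
  carrier := {g | g * M = M * g ∧ act g '' sail O = sail O}
  one_mem' := by simp [act_one]
  mul_mem' := by
    rintro g h ⟨hg, hg'⟩ ⟨hh, hh'⟩
    refine ⟨by rw [mul_assoc, hh, ← mul_assoc, hg, mul_assoc], ?_⟩
    rw [act_mul, LinearMap.coe_comp, Set.image_comp, hh', hg']
  inv_mem' := by
    rintro g ⟨hg, hg'⟩
    refine ⟨?_, ?_⟩
    · rw [inv_mul_eq_iff_eq_mul, ← mul_assoc, hg, mul_assoc, mul_inv_cancel, mul_one]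
    · conv_lhs => rw [← hg']
      rw [← Set.image_comp]
      convert Set.image_id _ using 2
      funext p
      exact act_inv_act g p

/-- Equivalence of points of the sail under the period group. -/
def periodSetoid (M : SL3Z) (O : Set E3) : Setoid (sail O) where
  r p q := ∃ g ∈ periodGroup M O, act g (p : E3) = (q : E3)
  iseqv :=
    { refl := fun p => ⟨1, one_mem _, by simp [act_one]⟩
      symm := by
        rintro p q ⟨g, hg, h⟩
        exact ⟨g⁻¹, inv_mem hg, by rw [← h, act_inv_act]⟩
      trans := by
        rintro p q r ⟨g, hg, h⟩ ⟨g', hg', h'⟩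
        exact ⟨g' * g, mul_mem hg' hg, by rw [act_mul, LinearMap.comp_apply, h, h']⟩ }

/-- The quotient of the sail by the period group, with the quotient topology. -/
abbrev SailQuotient (M : SL3Z) (O : Set E3) : Type := Quotient (periodSetoid M O)

/-- The decomposition of the quotient of the sail: its (closed) `k`-cells are the images of the
`k`-dimensional faces of the sail. -/
def sailTriangulation (M : SL3Z) (O : Set E3) (k : ℕ) : Set (Set (SailQuotient M O)) :=
  {c | ∃ F, IsFace O k F ∧ c = Quotient.mk (periodSetoid M O) '' {x : sail O | (x : E3) ∈ F}}

/-- Two spaces, each with a decomposition given by its `k`-cells for all `k`, are homeomorphic by a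
homeomorphism that carries the `k`-cells of the first one onto those of the second one. -/
def HomeomorphicDecompositions {T T' : Type} [TopologicalSpace T] [TopologicalSpace T']
    (D : ℕ → Set (Set T)) (D' : ℕ → Set (Set T')) : Prop :=
  ∃ h : T ≃ₜ T', ∀ k, (fun c => h '' c) '' D k = D' k

/-- A family of faces (`R k` consisting of `k`-dimensional ones) that contains exactly one face
from each class of faces of the sail under the period group. -/
def IsFundamentalFamily (M : SL3Z) (O : Set E3) (R : ℕ → Set (Set E3)) : Prop :=
  (∀ k, ∀ F ∈ R k, IsFace O k F) ∧
    ∀ k F, IsFace O k F → ∃! F₀, F₀ ∈ R k ∧ ∃ g ∈ periodGroup M O, act g '' F₀ = F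

/-! ### Integer lengths, areas and distances -/

/-- Integer length of a segment: its Euclidean length divided by the least length of an integer
segment on the same line. -/
noncomputable def integerLength (P Q : E3) : ℝ :=
  dist P Q / sInf {d | ∃ U ∈ integerPoints, ∃ V ∈ integerPoints,
    U ∈ line[ℝ, P, Q] ∧ V ∈ line[ℝ, P, Q] ∧ U ≠ V ∧ d = dist U V}

/-- Euclidean area of a triangle. -/
noncomputable def triangleArea (P Q R : E3) : ℝ :=
  Real.sqrt (‖Q - P‖ ^ 2 * ‖R - P‖ ^ 2 - (inner ℝ (Q - P) (R - P)) ^ 2) / 2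

/-- The plane through three points. -/
noncomputable def plane (P Q R : E3) : AffineSubspace ℝ E3 := affineSpan ℝ {P, Q, R}

/-- Integer area of a triangle: its Euclidean area divided by the least area of a (nondegenerate)
integer triangle in the same plane. -/
noncomputable def integerArea (P Q R : E3) : ℝ :=
  triangleArea P Q R / sInf {s | ∃ U ∈ integerPoints, ∃ V ∈ integerPoints, ∃ W ∈ integerPoints,
    U ∈ plane P Q R ∧ V ∈ plane P Q R ∧ W ∈ plane P Q R ∧
    AffineIndependent ℝ ![U, V, W] ∧ s = triangleArea U V W}

/-- Integer distance from a plane to a point: the Euclidean distance divided by the least distance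
from the plane to an integer point in its complement. -/
noncomputable def integerDistance (H : AffineSubspace ℝ E3) (p : E3) : ℝ :=
  Metric.infDist p H / sInf {d | ∃ q ∈ integerPoints, q ∉ H ∧ d = Metric.infDist q H}

/-! ### The operators and the points of the series -/

/-- The Frobenius operator `A_{m,n}`. -/
def frobeniusOp (m n : ℤ) : SL3Z :=
  ⟨!![0, 1, 0; 0, 0, 1; 1, -m, -n], by simp [Matrix.det_fin_three]⟩

/-- The operator `A_{m,n}` with `m = -a`, `n = 2a + 3`. -/
def opA (a : ℤ) : SL3Z := frobeniusOp (-a) (2 * a + 3)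

/-- The operator `A_{m,n}⁻²`. -/
def opX (a : ℤ) : SL3Z := opA a ^ (-2 : ℤ)

theorem det_two_sub_inv (a : ℤ) :
    ((2 : Matrix (Fin 3) (Fin 3) ℤ) - ((opA a)⁻¹ : SL3Z)).det = 1 := by
  have h : (((opA a)⁻¹ : SL3Z) : Matrix (Fin 3) (Fin 3) ℤ) =
      !![-a, 2 * a + 3, 1; 1, 0, 0; 0, 1, 0] := by
    rw [Matrix.SpecialLinearGroup.coe_inv, opA, frobeniusOp, Matrix.adjugate_fin_three_of]
    ext i j
    fin_cases i <;> fin_cases j <;> simp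
  have h2 : (2 : Matrix (Fin 3) (Fin 3) ℤ) = !![2, 0, 0; 0, 2, 0; 0, 0, 2] := by decide
  rw [h, h2, Matrix.det_fin_three]
  simp
  ring

/-- The operator `2I - A_{m,n}⁻¹`. -/
def twoSubInv (a : ℤ) : SL3Z :=
  ⟨(2 : Matrix (Fin 3) (Fin 3) ℤ) - ((opA a)⁻¹ : SL3Z), det_two_sub_inv a⟩

/-- The operator `(2I - A_{m,n}⁻¹)⁻¹`. -/
def opY (a : ℤ) : SL3Z := (twoSubInv a)⁻¹

noncomputable def ptA : E3 := pt 0 0 1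
noncomputable def ptB : E3 := pt 2 1 1
noncomputable def ptC : E3 := pt 7 4 2
noncomputable def ptD (a : ℤ) : E3 := pt (-a) 1 0
noncomputable def ptE : E3 := pt 3 2 1

/-! ### The two schemes of triangulations

They are written for arbitrary points of a real vector space, since they are used both for the
faces of the sail and for the model in the plane. -/

section Schemes

variable {V : Type} [AddCommGroup V] [Module ℝ V]

/-- The triangle with the given vertices. -/
def tri (P Q R : V) : Set V := convexHull ℝ {P, Q, R}

/-- The quadrangle region `ABCD` cut by the diagonal `BD`: one vertex, three edges, and
two triangles up to the identification of `AB` with `DC` and of `AD` with `BC`. -/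
def schemeTwo (A B C D : V) : ℕ → Set (Set V)
  | 0 => {{A}}
  | 1 => {segment ℝ A B, segment ℝ A D, segment ℝ B D}
  | 2 => {tri A B D, tri B C D}
  | _ => ∅

/-- The same with the triangle `BCD` subdivided by its interior point `E`: two vertices, six edges,
and four triangles up to the identification of `AB` with `DC` and of `AD` with `BC`. -/
def schemeFour (A B C D E : V) : ℕ → Set (Set V)
  | 0 => {{A}, {E}}
  | 1 => {segment ℝ A B, segment ℝ A D, segment ℝ B D,
      segment ℝ B E, segment ℝ C E, segment ℝ D E}
  | 2 => {tri A B D, tri B D E, tri B C E, tri C E D}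
  | _ => ∅

end Schemes

/-- The standard torus `ℝ²/ℤ²`. -/
abbrev StdTorus : Type := UnitAddCircle × UnitAddCircle

/-- The projection of the plane onto the standard torus. -/
def toTorus (p : ℝ × ℝ) : StdTorus := ((p.1 : UnitAddCircle), (p.2 : UnitAddCircle))

/-- The standard torus glued from the unit square, cut by a diagonal into two triangles. -/
def modelTwo (k : ℕ) : Set (Set StdTorus) :=
  (fun c => toTorus '' c) '' schemeTwo ((0, 0) : ℝ × ℝ) (0, 1) (1, 1) (1, 0) k

/-- The standard torus glued from the unit square, cut by a diagonal into two triangles, one of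
which is further cut into three triangles by an interior point. -/
noncomputable def modelFour (k : ℕ) : Set (Set StdTorus) :=
  (fun c => toTorus '' c) ''
    schemeFour ((0, 0) : ℝ × ℝ) (0, 1) (1, 1) (1, 0) (2 / 3, 2 / 3) k

end TorusSail

open TorusSail

/-! The three eigenvalues are real and separated, `r 0 < r 1 < 0 < r 2`, so there are three
eigenforms `ell r i`, normalized to equal 1 at A. The orthant whose sail contains A is the one where
all three are positive. X and Y multiply every eigenform by a positive unit, hence preserve this
orthant, and an operator commuting with `opA a` is determined by its value at A.

The sail is found by a convexity certificate. Each base triangle comes with an integer covector that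
is positive on the closed orthant without the origin, constant on the triangle, and not smaller at
any other nonzero integer point of the closed orthant (`le_covFour`). The translates by X^i Y^j give
infinitely many triangles and half-spaces, and across every edge the plane of the adjacent triangle
bends strictly (`IsFundamentalData`). This local condition and local finiteness suffice
(`IsConvexTriangulation`): at a point of the orthant the least of the normalized forms is attained,
and strict bending puts the point into the cone over the triangle that attains it. Hence the hull is
the intersection of the half-spaces (`mem_hull_iff`), its boundary is the union of the triangles
(`mem_frontier_iff`), and its faces are the cells of the triangles (`exists_eq_cell`). That the
translates cover the sail comes out of this argument and is not checked separately. For `a = 0` the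
planes of BDE, BCE, CED coincide, strict bending fails there, and two triangles replace the four.

An element of the period group maps A to a vertex of the sail. If that vertex is a translate of A,
the element is X^i Y^j. It cannot be a translate of E, because an integer matrix that commutes with
`opA a` and maps A to E has determinant `a + 3` (`act_ptA_ne_ptE`, `exists_eq_latOp`).

For the torus, the vertices are sent to the corresponding points of the plane and the map is
extended linearly over the triangles (`develop`). It is equivariant for translations and has the
explicit left inverse `planeMap`, so it induces a continuous bijection of the compact quotient onto
the standard torus (`exists_homeomorph`).

The integer lengths, areas and distances are computed by exhibiting integer covectors that take the
value 1 on suitable integer vectors, which shows that the infimum in each definition is attained. -/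

namespace TorusSail

/-! ### Hulls supported by a locally finite convex triangulation -/

/-- From a point of the intrinsic interior of a set, every segment inside the set can be prolonged
a little. -/
theorem exists_mem_openSegment_of_mem_intrinsicInterior {F : Set E3} {p x : E3}
    (hp : p ∈ intrinsicInterior ℝ F) (hx : x ∈ F) :
    ∃ y ∈ F, p ∈ openSegment ℝ x y := by
  obtain ⟨p', hp', rfl⟩ := mem_intrinsicInterior.1 hp
  let g : ℝ → affineSpan ℝ F := fun t =>
    ⟨AffineMap.lineMap (p' : E3) x t, AffineMap.lineMap_mem t p'.2 (subset_affineSpan ℝ F hx)⟩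
  have hg : Continuous g := by
    refine Continuous.subtype_mk ?_ _
    exact AffineMap.lineMap_continuous
  have hg0 : g 0 = p' := Subtype.ext (by simp [g])
  have h1 : g ⁻¹' interior ((↑) ⁻¹' F : Set (affineSpan ℝ F)) ∈ nhds (0 : ℝ) := by
    refine hg.continuousAt.preimage_mem_nhds ?_
    rw [hg0]
    exact isOpen_interior.mem_nhds hp'
  obtain ⟨e, he, hball⟩ := Metric.mem_nhds_iff.1 h1
  have h2 : (-(e / 2)) ∈ Metric.ball (0 : ℝ) e := by
    rw [Metric.mem_ball, Real.dist_eq, sub_zero, abs_neg, abs_of_pos (by positivity)]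
    linarith
  have h3 : g (-(e / 2)) ∈ ((↑) ⁻¹' F : Set (affineSpan ℝ F)) := interior_subset (hball h2)
  -- The prolongation is y = p - (e/2)(x - p), that is, p = ((e/2) x + y) / (1 + e/2).
  refine ⟨AffineMap.lineMap (p' : E3) x (-(e / 2)), h3, ?_⟩
  refine ⟨(e / 2) / (1 + e / 2), 1 / (1 + e / 2), by positivity, by positivity, by field_simp; ring, ?_⟩
  have h4 : (1 + e / 2) ≠ 0 := by positivity
  rw [AffineMap.lineMap_apply, vsub_eq_sub, vadd_eq_add]
  ext i
  simp
  field_simp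
  ring

/-- The cell spanned by a finite set of labelled points. -/
def cell {Λ V : Type} [AddCommGroup V] [Module ℝ V] (P : Λ → V) (σ : Finset Λ) : Set V :=
  convexHull ℝ (P '' (σ : Set Λ))

/-- A family of triangles in an open cone, each lying in the plane `φ = 1`, such that
the planes support the set `L` and neighbouring triangles meet at convex angles. -/
structure IsConvexTriangulation {ι Λ : Type} [DecidableEq Λ] (P : Λ → E3) (vtx : ι → Fin 3 → Λ)
    (φ : ι → E3 →ₗ[ℝ] ℝ) (L O : Set E3) : Prop where
  isOpen : IsOpen O
  nonempty : Nonempty ι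
  indep : ∀ τ, LinearIndependent ℝ (fun k => P (vtx τ k))
  height : ∀ τ k, φ τ (P (vtx τ k)) = 1
  adjacent : ∀ τ k, ∃ τ', (∀ l, l ≠ k → φ τ' (P (vtx τ l)) = 1) ∧ 1 < φ τ' (P (vtx τ k))
  mem : ∀ τ k, P (vtx τ k) ∈ L
  le : ∀ p ∈ L, ∀ τ, 1 ≤ φ τ p
  smul_mem : ∀ p ∈ L, ∀ n : ℕ, n ≠ 0 → (n : ℝ) • p ∈ L
  subset : ∀ p, (∀ τ, 1 ≤ φ τ p) → p ∈ O
  pos : ∀ τ, ∀ p ∈ O, 0 < φ τ p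
  finite : ∀ p ∈ O, ∀ C : ℝ, ∃ U ∈ nhds p, {τ | ∃ p' ∈ U, φ τ p' ≤ C}.Finite
  inj : ∀ τ k τ' k', P (vtx τ k) = P (vtx τ' k') → vtx τ k = vtx τ' k'

namespace IsConvexTriangulation

variable {ι Λ : Type} [DecidableEq Λ] {P : Λ → E3} {vtx : ι → Fin 3 → Λ}
  {φ : ι → E3 →ₗ[ℝ] ℝ} {L O : Set E3}

/-- The basis of the space formed by the vertices of a triangle. -/
noncomputable def basis (h : IsConvexTriangulation P vtx φ L O) (τ : ι) :
    Module.Basis (Fin 3) ℝ E3 :=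
  basisOfLinearIndependentOfCardEqFinrank (h.indep τ) (by simp)

variable (h : IsConvexTriangulation P vtx φ L O)
include h

theorem basis_apply (τ : ι) (k : Fin 3) : h.basis τ k = P (vtx τ k) := by
  simp [basis]

theorem sum_coord_smul (τ : ι) (p : E3) : ∑ k, (h.basis τ).coord k p • P (vtx τ k) = p := by
  have := (h.basis τ).sum_repr p
  simpa [basis_apply] using this

theorem coord_vertex (τ : ι) (k l : Fin 3) :
    (h.basis τ).coord k (P (vtx τ l)) = if l = k then 1 else 0 := by
  rw [← h.basis_apply, Module.Basis.coord_apply, Module.Basis.repr_self, Finsupp.single_apply]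

theorem linear_eq_sum (τ : ι) {W : Type} [AddCommGroup W] [Module ℝ W] (f : E3 →ₗ[ℝ] W) (p : E3) :
    f p = ∑ k, (h.basis τ).coord k p • f (P (vtx τ k)) := by
  conv_lhs => rw [← h.sum_coord_smul τ p]
  simp

theorem sum_coord (τ : ι) (p : E3) : ∑ k, (h.basis τ).coord k p = φ τ p := by
  rw [h.linear_eq_sum τ (φ τ) p]
  simp [h.height]

theorem mem_cell_image {τ : ι} {s : Finset (Fin 3)} {p : E3} :
    p ∈ cell P (s.image (vtx τ)) ↔
      (∀ k, 0 ≤ (h.basis τ).coord k p) ∧ φ τ p = 1 ∧ ∀ k ∉ s, (h.basis τ).coord k p = 0 := by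
  constructor
  · intro hp
    have hconv : Convex ℝ {p : E3 | (∀ k, 0 ≤ (h.basis τ).coord k p) ∧ φ τ p = 1 ∧
        ∀ k ∉ s, (h.basis τ).coord k p = 0} := by
      rintro x ⟨h1, h2, h3⟩ y ⟨h1', h2', h3'⟩ a b ha hb hab
      refine ⟨fun k => ?_, ?_, fun k hk => ?_⟩
      · rw [map_add, map_smul, map_smul]
        exact add_nonneg (mul_nonneg ha (h1 k)) (mul_nonneg hb (h1' k))
      · rw [map_add, map_smul, map_smul, h2, h2']
        simpa using hab
      · rw [map_add, map_smul, map_smul, h3 k hk, h3' k hk]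
        simp
    refine convexHull_min ?_ hconv hp
    rintro _ ⟨v, hv, rfl⟩
    obtain ⟨l, hl, rfl⟩ := Finset.mem_image.1 (Finset.mem_coe.1 hv)
    refine ⟨fun k => ?_, h.height _ _, fun k hk => ?_⟩
    · rw [coord_vertex]
      split_ifs <;> norm_num
    · rw [coord_vertex, if_neg]
      rintro rfl
      exact hk hl
  · rintro ⟨h1, h2, h3⟩
    have h4 : ∑ k ∈ s, (h.basis τ).coord k p = 1 := by
      rw [← h2, ← h.sum_coord τ p]
      exact Finset.sum_subset (Finset.subset_univ s) (fun k _ hk => h3 k hk)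
    have h5 : ∑ k ∈ s, (h.basis τ).coord k p • P (vtx τ k) = p := by
      conv_rhs => rw [← h.sum_coord_smul τ p]
      exact Finset.sum_subset (Finset.subset_univ s) (fun k _ hk => by rw [h3 k hk, zero_smul])
    rw [← h5]
    refine (convex_convexHull ℝ _).sum_mem (fun k _ => h1 k) h4 (fun k hk => ?_)
    exact subset_convexHull ℝ _ ⟨vtx τ k, by simpa using ⟨k, hk, rfl⟩, rfl⟩

theorem mem_triangle {τ : ι} {p : E3} :
    p ∈ cell P (Finset.univ.image (vtx τ)) ↔
      (∀ k, 0 ≤ (h.basis τ).coord k p) ∧ φ τ p = 1 := by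
  rw [h.mem_cell_image]
  simp

/-- Both forms equal 1 at the two common vertices, so their difference is a multiple of the
coordinate vanishing there. This turns comparisons of neighbouring forms into signs of coordinates.
-/
theorem adjacent_sub {τ τ' : ι} {k : Fin 3} (h1 : ∀ l, l ≠ k → φ τ' (P (vtx τ l)) = 1) (p : E3) :
    φ τ' p - φ τ p = (φ τ' (P (vtx τ k)) - 1) * (h.basis τ).coord k p := by
  rw [← h.sum_coord τ p, h.linear_eq_sum τ (φ τ') p, ← Finset.sum_sub_distrib,
    Finset.sum_eq_single k]
  · simp only [smul_eq_mul]; ring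
  · intro l _ hl
    rw [h1 l hl]
    simp
  · simp

/-- The functional of a minimal triangle determines the cone containing a given point. -/
theorem coord_nonneg_of_min {τ : ι} {p : E3} (hmin : ∀ τ', φ τ p ≤ φ τ' p) (k : Fin 3) :
    0 ≤ (h.basis τ).coord k p := by
  -- A negative coordinate would make the form of the neighbour across the opposite edge smaller
  -- than the minimum.
  obtain ⟨τ', h1, h2⟩ := h.adjacent τ k
  have h3 := h.adjacent_sub h1 p
  have h4 := hmin τ'
  by_contra! h5
  nlinarith

/-- Local finiteness leaves only finitely many forms whose value at `p` does not exceed that of a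
fixed one. -/
theorem exists_min {p : E3} (hp : p ∈ O) : ∃ τ, ∀ τ', φ τ p ≤ φ τ' p := by
  obtain ⟨τ₀⟩ := h.nonempty
  obtain ⟨U, hU, hfin⟩ := h.finite p hp (φ τ₀ p)
  have hfin' : {τ | φ τ p ≤ φ τ₀ p}.Finite :=
    hfin.subset (fun τ hτ => ⟨p, mem_of_mem_nhds hU, hτ⟩)
  obtain ⟨τ, hτ, hmin⟩ := Set.exists_min_image _ (fun τ => φ τ p) hfin' ⟨τ₀, by simp⟩
  refine ⟨τ, fun τ' => ?_⟩
  by_cases h1 : φ τ' p ≤ φ τ₀ p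
  · exact hmin τ' h1
  · exact hτ.trans (not_le.1 h1).le

theorem one_le_of_mem_hull {p : E3} (hp : p ∈ convexHull ℝ L) (τ : ι) : 1 ≤ φ τ p := by
  have hconv : Convex ℝ {p : E3 | 1 ≤ φ τ p} := convex_halfSpace_ge (φ τ).isLinear 1
  exact convexHull_min (fun q hq => h.le q hq τ) hconv hp

/-- Positive integer multiples of a generator are generators, and `t • q` lies between the multiples
of `q` by `⌊t⌋₊` and `⌊t⌋₊ + 1`. -/
theorem smul_mem_hull {p : E3} (hp : p ∈ convexHull ℝ L) {t : ℝ} (ht : 1 ≤ t) :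
    t • p ∈ convexHull ℝ L := by
  have hsub : convexHull ℝ L ⊆ {q : E3 | t • q ∈ convexHull ℝ L} := by
    refine convexHull_min ?_ ?_
    · intro q hq
      have hn : (1 : ℕ) ≤ ⌊t⌋₊ := Nat.le_floor (by simpa using ht)
      have h0 : (⌊t⌋₊ : ℝ) ≤ t := Nat.floor_le (by linarith)
      have h1 : t < ⌊t⌋₊ + 1 := Nat.lt_floor_add_one t
      have e1 := subset_convexHull ℝ L (h.smul_mem q hq ⌊t⌋₊ (by omega))
      have e2 := subset_convexHull ℝ L (h.smul_mem q hq (⌊t⌋₊ + 1) (by omega))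
      have e3 := (convex_convexHull ℝ L) e1 e2 (a := ⌊t⌋₊ + 1 - t) (b := t - ⌊t⌋₊) (by linarith)
        (by linarith) (by ring)
      rw [smul_smul, smul_smul, ← add_smul] at e3
      have e4 : (⌊t⌋₊ + 1 - t) * ⌊t⌋₊ + (t - ⌊t⌋₊) * ((⌊t⌋₊ + 1 : ℕ) : ℝ) = t := by
        push_cast
        ring
      rwa [e4] at e3
    · exact (convex_convexHull ℝ L).linear_preimage (LinearMap.lsmul ℝ E3 t)
  exact hsub hp

theorem cell_subset_hull {τ : ι} {s : Finset (Fin 3)} :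
    cell P (s.image (vtx τ)) ⊆ convexHull ℝ L := by
  refine convexHull_mono ?_
  rintro _ ⟨v, hv, rfl⟩
  obtain ⟨l, hl, rfl⟩ := Finset.mem_image.1 (Finset.mem_coe.1 hv)
  exact h.mem τ l

theorem inv_smul_mem_triangle {p : E3} {τ : ι} (hpos : 0 < φ τ p)
    (hmin : ∀ τ', φ τ p ≤ φ τ' p) :
    (φ τ p)⁻¹ • p ∈ cell P (Finset.univ.image (vtx τ)) := by
  rw [h.mem_triangle]
  refine ⟨fun k => ?_, ?_⟩
  · rw [map_smul]
    exact mul_nonneg (inv_nonneg.2 hpos.le) (h.coord_nonneg_of_min hmin k)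
  · rw [map_smul, smul_eq_mul, inv_mul_cancel₀ hpos.ne']

/-- Such a point is the multiple, by the least value `φ τ p ≥ 1`, of a point of the triangle `τ`. -/
theorem mem_hull_iff {p : E3} : p ∈ convexHull ℝ L ↔ ∀ τ, 1 ≤ φ τ p := by
  refine ⟨fun hp => h.one_le_of_mem_hull hp, fun hp => ?_⟩
  obtain ⟨τ, hτ⟩ := h.exists_min (h.subset p hp)
  have hpos : 0 < φ τ p := zero_lt_one.trans_le (hp τ)
  have h1 := h.smul_mem_hull (h.cell_subset_hull (h.inv_smul_mem_triangle hpos hτ)) (hp τ)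
  rwa [smul_smul, mul_inv_cancel₀ hpos.ne', one_smul] at h1

theorem isClosed_hull : IsClosed (convexHull ℝ L) := by
  have : convexHull ℝ L = ⋂ τ, {p | 1 ≤ φ τ p} := by
    ext p
    simp [h.mem_hull_iff]
  rw [this]
  exact isClosed_iInter (fun τ => isClosed_le continuous_const
    (LinearMap.continuous_of_finiteDimensional (φ τ)))

theorem hull_subset : convexHull ℝ L ⊆ O := fun p hp => h.subset p (h.one_le_of_mem_hull hp)

theorem mem_triangle_of_eq_one {p : E3} {τ : ι} (hp : p ∈ convexHull ℝ L) (hτ : φ τ p = 1) :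
    p ∈ cell P (Finset.univ.image (vtx τ)) := by
  have hmin : ∀ τ', φ τ p ≤ φ τ' p := fun τ' => by rw [hτ]; exact h.one_le_of_mem_hull hp τ'
  exact h.mem_triangle.2 ⟨h.coord_nonneg_of_min hmin, hτ⟩

/-- If the least value at `p` exceeds 1, then `p` lies in q + O for a point q of a triangle; this
set is open and stays in the hull because all forms are positive on `O`. Conversely, shrinking a
point of a triangle towards the origin leaves the half-space of that triangle. -/
theorem mem_frontier_iff {p : E3} : p ∈ frontier (convexHull ℝ L) ↔
    ∃ τ, p ∈ cell P (Finset.univ.image (vtx τ)) := by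
  rw [h.isClosed_hull.frontier_eq]
  constructor
  · rintro ⟨hp, hint⟩
    obtain ⟨τ, hτ⟩ := h.exists_min (h.hull_subset hp)
    refine ⟨τ, ?_⟩
    have h1 := h.one_le_of_mem_hull hp τ
    rcases h1.eq_or_lt with h1 | h1
    · exact h.mem_triangle_of_eq_one hp h1.symm
    · refine absurd ?_ hint
      set q := (φ τ p)⁻¹ • p with hq
      have hpos : 0 < φ τ p := by linarith
      have hqc := h.cell_subset_hull (h.inv_smul_mem_triangle hpos hτ)
      have hqO : q ∈ O := h.hull_subset hqc
      have hpq : p = φ τ p • q := by rw [hq, smul_smul, mul_inv_cancel₀ hpos.ne', one_smul]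
      -- the open set `{x | (φ τ p - 1)⁻¹ • (x - q) ∈ O}` is a neighbourhood of `p` in the hull
      refine mem_interior.2 ⟨(fun x => (φ τ p - 1)⁻¹ • (x - q)) ⁻¹' O, ?_, ?_, ?_⟩
      · intro x hx
        rw [h.mem_hull_iff]
        intro τ'
        have h2 : 0 < φ τ' ((φ τ p - 1)⁻¹ • (x - q)) := h.pos τ' _ hx
        rw [map_smul, map_sub, smul_eq_mul] at h2
        have h3 := h.one_le_of_mem_hull hqc τ'
        have h4 : 0 < (φ τ p - 1)⁻¹ := inv_pos.2 (by linarith)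
        have h5 := pos_of_mul_pos_right h2 h4.le
        have h6 : 1 ≤ φ τ' q := h3
        linarith
      · exact h.isOpen.preimage (by fun_prop)
      · have h7 : (φ τ p - 1)⁻¹ • (p - q) = q := by
          have h8 : p - q = (φ τ p - 1) • q := by
            rw [sub_smul, one_smul, ← hpq]
          rw [h8, smul_smul, inv_mul_cancel₀ (by linarith), one_smul]
        simpa [h7] using hqO
  · rintro ⟨τ, hp⟩
    refine ⟨h.cell_subset_hull hp, fun hint => ?_⟩
    have hφ := (h.mem_triangle.1 hp).2
    have hc : ContinuousAt (fun t : ℝ => t • p) 1 := by fun_prop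
    have hn : (fun t : ℝ => t • p) ⁻¹' interior (convexHull ℝ L) ∈ nhds (1 : ℝ) := by
      refine hc.preimage_mem_nhds ?_
      rw [one_smul]
      exact isOpen_interior.mem_nhds hint
    obtain ⟨e, he, hball⟩ := Metric.mem_nhds_iff.1 hn
    have h2 : (1 - e / 2) ∈ Metric.ball (1 : ℝ) e := by
      rw [Metric.mem_ball, Real.dist_eq, abs_sub_comm, abs_of_pos (by linarith)]
      linarith
    have h3 := h.one_le_of_mem_hull (interior_subset (hball h2)) τ
    rw [map_smul, hφ, smul_eq_mul] at h3
    linarith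

theorem frontier_subset_hull : frontier (convexHull ℝ L) ⊆ convexHull ℝ L := by
  rw [h.isClosed_hull.frontier_eq]
  exact Set.sdiff_subset

theorem cell_subset_frontier {τ : ι} {s : Finset (Fin 3)} :
    cell P (s.image (vtx τ)) ⊆ frontier (convexHull ℝ L) := by
  intro p hp
  rw [h.mem_cell_image] at hp
  exact h.mem_frontier_iff.2 ⟨τ, h.mem_triangle.2 ⟨hp.1, hp.2.1⟩⟩

theorem isExposed_setOf_eq_one (τ : ι) :
    IsExposed ℝ (convexHull ℝ L) {p ∈ convexHull ℝ L | φ τ p = 1} := by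
  rintro ⟨q, hq, hq1⟩
  refine ⟨-LinearMap.toContinuousLinearMap (φ τ), ?_⟩
  ext p
  constructor
  · rintro ⟨hp, hp1⟩
    refine ⟨hp, fun y hy => ?_⟩
    have := h.one_le_of_mem_hull hy τ
    simpa [hp1] using this
  · rintro ⟨hp, hp1⟩
    refine ⟨hp, ?_⟩
    have h1 := hp1 q hq
    have h2 := h.one_le_of_mem_hull hp τ
    simp [hq1] at h1
    linarith

/-- The triangle is exposed by its own plane. Each omitted vertex is cut off by the plane of the
neighbour across the opposite edge, and finite intersections of exposed faces are exposed. -/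
theorem isExposed_cell {τ : ι} {s : Finset (Fin 3)} :
    IsExposed ℝ (convexHull ℝ L) (cell P (s.image (vtx τ))) := by
  choose ν hν hν' using h.adjacent τ
  let B : Finset (Set E3) := insert {p ∈ convexHull ℝ L | φ τ p = 1}
    (sᶜ.image (fun k => {p ∈ convexHull ℝ L | φ (ν k) p = 1}))
  have hB : cell P (s.image (vtx τ)) = ⋂₀ (B : Set (Set E3)) := by
    ext p
    simp only [B, Finset.coe_insert, Finset.coe_image, Set.sInter_insert, Set.sInter_image,
      Set.mem_inter_iff, Set.mem_iInter, Set.mem_ofPred_eq, Finset.coe_compl, Set.mem_compl_iff,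
      Finset.mem_coe]
    constructor
    · intro hp
      have hp' := h.mem_cell_image.1 hp
      refine ⟨⟨h.cell_subset_hull hp, hp'.2.1⟩, fun k hk => ⟨h.cell_subset_hull hp, ?_⟩⟩
      have := h.adjacent_sub (hν k) p
      rw [hp'.2.2 k hk, hp'.2.1] at this
      linarith
    · rintro ⟨⟨hp, hp1⟩, hp2⟩
      refine h.mem_cell_image.2 ⟨(h.mem_triangle.1 (h.mem_triangle_of_eq_one hp hp1)).1, hp1,
        fun k hk => ?_⟩
      have := h.adjacent_sub (hν k) p
      rw [(hp2 k hk).2, hp1, sub_self] at this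
      rcases mul_eq_zero.1 this.symm with h1 | h1
      · linarith [hν' k]
      · exact h1
  rw [hB]
  refine IsExposed.sInter (Finset.insert_nonempty _ _) (fun C hC => ?_)
  rcases Finset.mem_insert.1 hC with rfl | hC
  · exact h.isExposed_setOf_eq_one τ
  · obtain ⟨k, -, rfl⟩ := Finset.mem_image.1 hC
    exact h.isExposed_setOf_eq_one _

theorem vertex_mem_extremePoints (τ : ι) (k : Fin 3) :
    P (vtx τ k) ∈ (convexHull ℝ L).extremePoints ℝ := by
  have h1 := (h.isExposed_cell (τ := τ) (s := {k})).isExtreme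
  simpa [cell, isExtreme_singleton] using h1

/-- A vertex lying in a cell is one of the vertices of the cell. -/
theorem mem_of_vertex_mem_cell {τ τ' : ι} {k : Fin 3} {s : Finset (Fin 3)}
    (hv : P (vtx τ k) ∈ cell P (s.image (vtx τ'))) : vtx τ k ∈ s.image (vtx τ') := by
  have h1 : P (vtx τ k) ∈ (cell P (s.image (vtx τ'))).extremePoints ℝ :=
    inter_extremePoints_subset_extremePoints_of_subset h.cell_subset_hull
      ⟨hv, h.vertex_mem_extremePoints τ k⟩
  obtain ⟨v, hv1, hv2⟩ := extremePoints_convexHull_subset h1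
  obtain ⟨l, hl, rfl⟩ := Finset.mem_image.1 (Finset.mem_coe.1 hv1)
  rw [h.inj _ _ _ _ hv2.symm]
  exact Finset.mem_image_of_mem _ hl

theorem mem_extremePoints_iff {p : E3} :
    p ∈ (convexHull ℝ L).extremePoints ℝ ∧ p ∈ frontier (convexHull ℝ L) ↔
      ∃ τ k, p = P (vtx τ k) := by
  constructor
  · rintro ⟨hp, hp'⟩
    obtain ⟨τ, hτ⟩ := h.mem_frontier_iff.1 hp'
    have h1 : p ∈ (cell P (Finset.univ.image (vtx τ))).extremePoints ℝ :=
      inter_extremePoints_subset_extremePoints_of_subset h.cell_subset_hull ⟨hτ, hp⟩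
    obtain ⟨v, hv1, hv2⟩ := extremePoints_convexHull_subset h1
    obtain ⟨l, hl, rfl⟩ := Finset.mem_image.1 (Finset.mem_coe.1 hv1)
    exact ⟨τ, l, hv2.symm⟩
  · rintro ⟨τ, k, rfl⟩
    refine ⟨h.vertex_mem_extremePoints τ k, h.cell_subset_frontier (τ := τ) (s := {k}) ?_⟩
    simp [cell]

/-- Every exposed face of the hull contained in its boundary is a cell. -/
theorem exists_eq_cell {F : Set E3} (hne : F.Nonempty) (hF : IsExposed ℝ (convexHull ℝ L) F)
    (hsub : F ⊆ frontier (convexHull ℝ L)) :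
    ∃ τ, ∃ s : Finset (Fin 3), s.Nonempty ∧ F = cell P (s.image (vtx τ)) := by
  -- A face is determined by a point of its relative interior: `F` turns out to be the smallest cell
  -- containing `p`.
  obtain ⟨p, hp⟩ := hne.intrinsicInterior (hF.convex (convex_convexHull ℝ L))
  have hpF := intrinsicInterior_subset hp
  obtain ⟨τ, hτ⟩ := h.mem_frontier_iff.1 (hsub hpF)
  have hτ' := h.mem_triangle.1 hτ
  let s : Finset (Fin 3) := Finset.univ.filter (fun k => 0 < (h.basis τ).coord k p)
  have hps : p ∈ cell P (s.image (vtx τ)) := by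
    refine h.mem_cell_image.2 ⟨hτ'.1, hτ'.2, fun k hk => ?_⟩
    simp only [s, Finset.mem_filter, Finset.mem_univ, true_and, not_lt] at hk
    exact le_antisymm hk (hτ'.1 k)
  refine ⟨τ, s, ?_, ?_⟩
  · rw [← Finset.image_nonempty (f := vtx τ), Finset.nonempty_iff_ne_empty]
    intro h0
    rw [h0] at hps
    simp [cell] at hps
  · refine Set.Subset.antisymm (fun x hx => ?_) ?_
    · obtain ⟨y, hy, hpxy⟩ := exists_mem_openSegment_of_mem_intrinsicInterior hp hx
      exact (h.isExposed_cell (τ := τ) (s := s)).isExtreme.2 (hF.subset hx) (hF.subset hy) hps hpxy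
    · refine convexHull_min ?_ (hF.convex (convex_convexHull ℝ L))
      rintro _ ⟨v, hv, rfl⟩
      obtain ⟨l, hl, rfl⟩ := Finset.mem_image.1 (Finset.mem_coe.1 hv)
      obtain ⟨f, hf⟩ := hF hne
      have hmax : ∀ y ∈ convexHull ℝ L, f y ≤ f p := by
        rw [hf] at hpF
        exact hpF.2
      have hmem : ∀ k, P (vtx τ k) ∈ convexHull ℝ L := fun k => subset_convexHull ℝ _ (h.mem τ k)
      have hsum := h.linear_eq_sum τ (f : E3 →ₗ[ℝ] ℝ) p
      have hone := h.sum_coord τ p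
      rw [hτ'.2] at hone
      -- `p` maximizes `f` and is a weighted mean of the vertices, so every vertex with positive
      -- weight maximizes `f` as well.
      have hz : ∑ k, (h.basis τ).coord k p * (f p - f (P (vtx τ k))) = 0 := by
        simp only [mul_sub, Finset.sum_sub_distrib, ← Finset.sum_mul, hone]
        simp only [ContinuousLinearMap.coe_coe, smul_eq_mul] at hsum
        rw [← hsum]
        ring
      have hz' := (Finset.sum_eq_zero_iff_of_nonneg (fun k _ =>
        mul_nonneg (hτ'.1 k) (sub_nonneg.2 (hmax _ (hmem k))))).1 hz l (Finset.mem_univ _)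
      have hl' : 0 < (h.basis τ).coord l p := (Finset.mem_filter.1 hl).2
      have heq : f p = f (P (vtx τ l)) := by
        rcases mul_eq_zero.1 hz' with h1 | h1
        · linarith
        · linarith
      rw [hf]
      exact ⟨hmem l, fun y hy => heq ▸ hmax y hy⟩

theorem finrank_vectorSpan_cell {τ : ι} {s : Finset (Fin 3)} (hs : s.Nonempty) :
    Module.finrank ℝ (vectorSpan ℝ (cell P (s.image (vtx τ)))) + 1 = s.card := by
  have h1 : AffineIndependent ℝ (fun k => P (vtx τ k)) := (h.indep τ).affineIndependent
  have h2 : AffineIndependent ℝ (fun k : s => P (vtx τ k)) :=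
    h1.comp_embedding (Function.Embedding.subtype _)
  have h3 : cell P (s.image (vtx τ)) = convexHull ℝ (Set.range (fun k : s => P (vtx τ k))) := by
    unfold cell
    congr 1
    ext p
    simp
  have : Nonempty s := hs.to_subtype
  rw [h3, ← direction_affineSpan, affineSpan_convexHull, direction_affineSpan,
    h2.finrank_vectorSpan_add_one]
  simp

end IsConvexTriangulation
-- Piecewise linear maps of the boundary
theorem isCompact_cell {Λ : Type} (P : Λ → E3) (σ : Finset Λ) : IsCompact (cell P σ) :=
  (σ.finite_toSet.image P).isCompact_convexHull ℝ

namespace IsConvexTriangulation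

variable {ι Λ : Type} [DecidableEq Λ] {P : Λ → E3} {vtx : ι → Fin 3 → Λ}
  {φ : ι → E3 →ₗ[ℝ] ℝ} {L O : Set E3} (h : IsConvexTriangulation P vtx φ L O) (M : Λ → ℝ × ℝ)

/-- The linear map sending the vertices of a triangle to prescribed points. -/
noncomputable def chart (τ : ι) : E3 →ₗ[ℝ] ℝ × ℝ :=
  (h.basis τ).constr ℝ (fun k => M (vtx τ k))

theorem chart_vertex (τ : ι) (k : Fin 3) : h.chart M τ (P (vtx τ k)) = M (vtx τ k) := by
  rw [chart, ← h.basis_apply, Module.Basis.constr_basis]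

/-- The form of `τ'` is at least 1 at the vertices of `τ` and has mean 1 at `p`, so the vertices
with positive weight lie in `τ'`. Being extreme points they are vertices of `τ'`, and there the two
charts agree. -/
theorem chart_eq_of_mem {τ τ' : ι} {p : E3} (hp : p ∈ cell P (Finset.univ.image (vtx τ)))
    (hp' : p ∈ cell P (Finset.univ.image (vtx τ'))) : h.chart M τ p = h.chart M τ' p := by
  rw [h.linear_eq_sum τ (h.chart M τ) p, h.linear_eq_sum τ (h.chart M τ') p]
  refine Finset.sum_congr rfl (fun k _ => ?_)
  have h1 := h.mem_triangle.1 hp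
  have hmem : ∀ k, P (vtx τ k) ∈ convexHull ℝ L := fun k => subset_convexHull ℝ _ (h.mem τ k)
  have hone := h.sum_coord τ p
  rw [h1.2] at hone
  have hz : ∑ k, (h.basis τ).coord k p * (φ τ' (P (vtx τ k)) - 1) = 0 := by
    simp only [mul_sub, Finset.sum_sub_distrib, ← Finset.sum_mul, hone]
    have hsum := h.linear_eq_sum τ (φ τ') p
    simp only [smul_eq_mul] at hsum
    rw [← hsum, (h.mem_triangle.1 hp').2]
    ring
  have hz' := (Finset.sum_eq_zero_iff_of_nonneg (fun k _ =>
    mul_nonneg (h1.1 k) (sub_nonneg.2 (h.one_le_of_mem_hull (hmem k) τ')))).1 hz k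
      (Finset.mem_univ _)
  rcases mul_eq_zero.1 hz' with h2 | h2
  · rw [h2, zero_smul, zero_smul]
  · have h3 := h.mem_of_vertex_mem_cell
      (h.mem_triangle_of_eq_one (hmem k) (sub_eq_zero.1 h2))
    obtain ⟨l, -, hl⟩ := Finset.mem_image.1 h3
    rw [h.chart_vertex, ← hl, h.chart_vertex]

open Classical in
/-- The piecewise linear map of the boundary of the hull that extends a map of the vertices. -/
noncomputable def piecewiseLinear (p : E3) : ℝ × ℝ :=
  if hp : ∃ τ, p ∈ cell P (Finset.univ.image (vtx τ)) then h.chart M hp.choose p else 0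

theorem piecewiseLinear_eq {τ : ι} {p : E3} (hp : p ∈ cell P (Finset.univ.image (vtx τ))) :
    h.piecewiseLinear M p = h.chart M τ p := by
  have hex : ∃ τ, p ∈ cell P (Finset.univ.image (vtx τ)) := ⟨τ, hp⟩
  rw [piecewiseLinear, dif_pos hex]
  exact h.chart_eq_of_mem M hex.choose_spec hp

include h in
theorem cell_subset_triangle (τ : ι) (s : Finset (Fin 3)) :
    cell P (s.image (vtx τ)) ⊆ cell P (Finset.univ.image (vtx τ)) := by
  intro p hp
  have := h.mem_cell_image.1 hp
  exact h.mem_triangle.2 ⟨this.1, this.2.1⟩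

theorem piecewiseLinear_image_cell (τ : ι) (s : Finset (Fin 3)) :
    h.piecewiseLinear M '' cell P (s.image (vtx τ)) = cell M (s.image (vtx τ)) := by
  rw [Set.image_congr (fun p hp => h.piecewiseLinear_eq M (h.cell_subset_triangle τ s hp))]
  unfold cell
  rw [LinearMap.image_convexHull, ← Set.image_comp]
  congr 1
  refine Set.image_congr (fun v hv => ?_)
  obtain ⟨l, -, rfl⟩ := Finset.mem_image.1 (Finset.mem_coe.1 hv)
  exact h.chart_vertex M τ l

/-- The triangles form a locally finite closed cover, and the map is linear on each of them. -/
theorem continuous_piecewiseLinear :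
    Continuous (fun x : frontier (convexHull ℝ L) => h.piecewiseLinear M x) := by
  let f : ι → Set (frontier (convexHull ℝ L)) :=
    fun τ => (↑) ⁻¹' cell P (Finset.univ.image (vtx τ))
  refine LocallyFinite.continuous (f := f) ?_ ?_ (fun τ => ?_) (fun τ => ?_)
  · rintro ⟨p, hp⟩
    obtain ⟨U, hU, hfin⟩ := h.finite p (h.hull_subset (h.frontier_subset_hull hp)) 1
    refine ⟨(↑) ⁻¹' U, continuous_subtype_val.continuousAt.preimage_mem_nhds hU, hfin.subset ?_⟩
    rintro τ ⟨x, hx, hxU⟩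
    exact ⟨x, hxU, (h.mem_triangle.1 hx).2.le⟩
  · refine Set.eq_univ_of_forall (fun x => ?_)
    obtain ⟨τ, hτ⟩ := h.mem_frontier_iff.1 x.2
    exact Set.mem_iUnion.2 ⟨τ, hτ⟩
  · exact (isCompact_cell P _).isClosed.preimage continuous_subtype_val
  · refine ContinuousOn.congr (f := fun x : frontier (convexHull ℝ L) => h.chart M τ x) ?_
      (fun x hx => h.piecewiseLinear_eq M hx)
    exact ((LinearMap.continuous_of_finiteDimensional (h.chart M τ)).comp
      continuous_subtype_val).continuousOn

end IsConvexTriangulation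
-- Integer forms, integer points and the operators X, Y
/-- The linear form on `ℝ³` with the given coefficients. -/
noncomputable def form (c : Fin 3 → ℝ) : E3 →ₗ[ℝ] ℝ where
  toFun p := ∑ i, c i * p i
  map_add' p q := by simp [Fin.sum_univ_three]; ring
  map_smul' t p := by simp [Fin.sum_univ_three]; ring

theorem form_apply (c : Fin 3 → ℝ) (p : E3) : form c p = c 0 * p 0 + c 1 * p 1 + c 2 * p 2 := by
  simp [form, Fin.sum_univ_three]

/-- The linear form on `ℝ³` with the given integer coefficients. -/
noncomputable def intForm (c : Fin 3 → ℤ) : E3 →ₗ[ℝ] ℝ := form (fun i => (c i : ℝ))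

theorem intForm_apply (c : Fin 3 → ℤ) (p : E3) :
    intForm c p = c 0 * p 0 + c 1 * p 1 + c 2 * p 2 := form_apply _ p

theorem act_apply (g : SL3Z) (p : E3) (i : Fin 3) :
    act g p i = (g i 0 : ℝ) * p 0 + g i 1 * p 1 + g i 2 * p 2 := by
  simp [act, Matrix.toLpLin_apply, Matrix.mulVec, dotProduct, Fin.sum_univ_three]

theorem act_mul_apply (g g' : SL3Z) (p : E3) : act (g * g') p = act g (act g' p) := by
  rw [act_mul]; rfl

theorem act_one_apply (p : E3) : act 1 p = p := by rw [act_one]; rfl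

theorem act_act_inv (g : SL3Z) (p : E3) : act g (act g⁻¹ p) = p := by
  rw [← act_mul_apply, mul_inv_cancel, act_one_apply]

theorem intForm_act (c : Fin 3 → ℤ) (g : SL3Z) (p : E3) :
    intForm c (act g p) = intForm (Matrix.vecMul c (g : Matrix (Fin 3) (Fin 3) ℤ)) p := by
  simp only [intForm_apply, act_apply, Matrix.vecMul, dotProduct, Fin.sum_univ_three]
  push_cast
  ring

theorem pt_apply_zero (x y z : ℤ) : pt x y z 0 = x := rfl
theorem pt_apply_one (x y z : ℤ) : pt x y z 1 = y := rfl
theorem pt_apply_two (x y z : ℤ) : pt x y z 2 = z := rfl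

theorem ext_three {p q : E3} (h0 : p 0 = q 0) (h1 : p 1 = q 1) (h2 : p 2 = q 2) : p = q := by
  ext i
  fin_cases i
  · exact h0
  · exact h1
  · exact h2

theorem pt_mem (x y z : ℤ) : pt x y z ∈ integerPoints := by
  intro i
  fin_cases i
  · exact ⟨x, rfl⟩
  · exact ⟨y, rfl⟩
  · exact ⟨z, rfl⟩

theorem exists_eq_pt {p : E3} (hp : p ∈ integerPoints) : ∃ x y z : ℤ, p = pt x y z := by
  obtain ⟨x, hx⟩ := hp 0
  obtain ⟨y, hy⟩ := hp 1
  obtain ⟨z, hz⟩ := hp 2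
  exact ⟨x, y, z, ext_three hx hy hz⟩

theorem intForm_pt (c : Fin 3 → ℤ) (x y z : ℤ) :
    intForm c (pt x y z) = ((c 0 * x + c 1 * y + c 2 * z : ℤ) : ℝ) := by
  rw [intForm_apply, pt_apply_zero, pt_apply_one, pt_apply_two]
  push_cast
  ring

theorem act_mem_integerPoints (g : SL3Z) {p : E3} (hp : p ∈ integerPoints) :
    act g p ∈ integerPoints := by
  obtain ⟨x, y, z, rfl⟩ := exists_eq_pt hp
  intro i
  refine ⟨g i 0 * x + g i 1 * y + g i 2 * z, ?_⟩
  rw [act_apply, pt_apply_zero, pt_apply_one, pt_apply_two]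
  push_cast
  ring

theorem opA_inv_coe (a : ℤ) : (((opA a)⁻¹ : SL3Z) : Matrix (Fin 3) (Fin 3) ℤ) =
    !![-a, 2 * a + 3, 1; 1, 0, 0; 0, 1, 0] := by
  rw [Matrix.SpecialLinearGroup.coe_inv, opA, frobeniusOp, Matrix.adjugate_fin_three_of]
  ext i j
  fin_cases i <;> fin_cases j <;> simp

theorem opA_coe (a : ℤ) : (opA a : Matrix (Fin 3) (Fin 3) ℤ) =
    !![0, 1, 0; 0, 0, 1; 1, a, -(2 * a + 3)] := by
  simp [opA, frobeniusOp]

theorem twoSubInv_coe (a : ℤ) : (twoSubInv a : Matrix (Fin 3) (Fin 3) ℤ) =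
    !![2 + a, -(2 * a + 3), -1; -1, 2, 0; 0, -1, 2] := by
  have h2 : (2 : Matrix (Fin 3) (Fin 3) ℤ) = !![2, 0, 0; 0, 2, 0; 0, 0, 2] := by decide
  have h1 : (twoSubInv a : Matrix (Fin 3) (Fin 3) ℤ) =
    2 - (((opA a)⁻¹ : SL3Z) : Matrix (Fin 3) (Fin 3) ℤ) := rfl
  rw [h1, opA_inv_coe, h2]
  ext i j
  fin_cases i <;> fin_cases j <;> simp

theorem act_opA_pt (a x y z : ℤ) :
    act (opA a) (pt x y z) = pt y z (x + a * y - (2 * a + 3) * z) := by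
  refine ext_three ?_ ?_ ?_ <;> rw [act_apply, opA_coe] <;>
    simp [pt_apply_zero, pt_apply_one, pt_apply_two]
  ring

theorem act_opA_inv (a : ℤ) (p : E3) :
    act (opA a)⁻¹ p 0 = -a * p 0 + (2 * a + 3) * p 1 + p 2 ∧ act (opA a)⁻¹ p 1 = p 0 ∧
      act (opA a)⁻¹ p 2 = p 1 := by
  refine ⟨?_, ?_, ?_⟩ <;> rw [act_apply, opA_inv_coe] <;> simp

theorem act_opA_inv_pt (a x y z : ℤ) :
    act (opA a)⁻¹ (pt x y z) = pt (-a * x + (2 * a + 3) * y + z) x y := by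
  obtain ⟨h0, h1, h2⟩ := act_opA_inv a (pt x y z)
  refine ext_three ?_ h1 h2
  rw [h0, pt_apply_zero, pt_apply_zero, pt_apply_one, pt_apply_two]
  push_cast
  ring

theorem opX_eq (a : ℤ) : opX a = (opA a)⁻¹ * (opA a)⁻¹ := by
  rw [opX, zpow_neg, ← inv_zpow]
  exact pow_two (opA a)⁻¹

theorem opX_inv_eq (a : ℤ) : (opX a)⁻¹ = opA a * opA a := by
  rw [opX_eq, mul_inv_rev, inv_inv]

theorem act_twoSubInv (a : ℤ) (p : E3) :
    act (twoSubInv a) p = (2 : ℝ) • p - act (opA a)⁻¹ p := by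
  obtain ⟨h0, h1, h2⟩ := act_opA_inv a p
  refine ext_three ?_ ?_ ?_ <;> rw [act_apply, twoSubInv_coe] <;>
    simp only [PiLp.sub_apply, PiLp.smul_apply, h0, h1, h2] <;> simp <;> ring

theorem opY_inv_eq (a : ℤ) : (opY a)⁻¹ = twoSubInv a := by rw [opY, inv_inv]

theorem act_opY_eq_iff (a : ℤ) (p q : E3) : act (opY a) p = q ↔ p = act (twoSubInv a) q := by
  rw [opY]
  constructor
  · rintro rfl; rw [act_act_inv]
  · rintro rfl; rw [act_inv_act]

theorem commute_opA_twoSubInv (a : ℤ) : Commute (opA a) (twoSubInv a) := by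
  have h : Commute (opA a : Matrix (Fin 3) (Fin 3) ℤ) (((opA a)⁻¹ : SL3Z) :) := by
    show _ * _ = _ * _
    rw [← Matrix.SpecialLinearGroup.coe_mul, ← Matrix.SpecialLinearGroup.coe_mul,
      mul_inv_cancel, inv_mul_cancel]
  apply Subtype.ext
  show (opA a : Matrix (Fin 3) (Fin 3) ℤ) * (2 - _) = (2 - _) * (opA a : Matrix (Fin 3) (Fin 3) ℤ)
  exact ((Commute.ofNat_right _ 2).sub_right h).eq

theorem commute_opA_opX (a : ℤ) : Commute (opA a) (opX a) := (Commute.refl _).zpow_right _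

theorem commute_opA_opY (a : ℤ) : Commute (opA a) (opY a) := (commute_opA_twoSubInv a).inv_right

theorem commute_opX_opY (a : ℤ) : Commute (opX a) (opY a) := (commute_opA_opY a).zpow_left _

/-- The operator `X ^ i * Y ^ j`. -/
def latOp (a : ℤ) (q : ℤ × ℤ) : SL3Z := opX a ^ q.1 * opY a ^ q.2

theorem latOp_zero (a : ℤ) : latOp a 0 = 1 := by simp [latOp]

theorem latOp_add (a : ℤ) (q q' : ℤ × ℤ) : latOp a (q + q') = latOp a q * latOp a q' := by
  have h := ((commute_opX_opY a).zpow_zpow q'.1 q.2).eq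
  simp only [latOp, Prod.fst_add, Prod.snd_add, zpow_add]
  rw [mul_assoc, mul_assoc, ← mul_assoc (opX a ^ q'.1), h]
  simp only [mul_assoc]

theorem commute_opA_latOp (a : ℤ) (q : ℤ × ℤ) : Commute (opA a) (latOp a q) :=
  ((commute_opA_opX a).zpow_right _).mul_right ((commute_opA_opY a).zpow_right _)

theorem latOp_mem_closure (a : ℤ) (q : ℤ × ℤ) :
    latOp a q ∈ Subgroup.closure {opX a, opY a} :=
  mul_mem (zpow_mem (Subgroup.subset_closure (by simp)) _)
    (zpow_mem (Subgroup.subset_closure (by simp)) _)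

/-! ### Eigenvalues, eigenforms and units -/

/-- Three reals in the right intervals which are the eigenvalues of the operator. -/
structure IsSpectrum (a : ℤ) (r : Fin 3 → ℝ) : Prop where
  sum_eq : r 0 + r 1 + r 2 = -(2 * a + 3)
  sum_mul_eq : r 0 * r 1 + r 1 * r 2 + r 2 * r 0 = -a
  mul_eq : r 0 * r 1 * r 2 = 1
  lt_zero : r 0 < -5 / 2
  lt_one : -1 < (a + 1) * r 1
  one_lt : (a + 2) * r 1 < -1
  lt_two : 1 / 2 < r 2
  two_lt : r 2 < 10 / 17

/-- Cancelling differences of distinct roots (divided differences of the cubic) gives the relations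
one after another. -/
theorem vieta_of_roots {m n r s t : ℝ} (hrs : r ≠ s) (hst : s ≠ t) (hrt : r ≠ t)
    (hr : r ^ 3 + n * r ^ 2 + m * r - 1 = 0) (hs : s ^ 3 + n * s ^ 2 + m * s - 1 = 0)
    (ht : t ^ 3 + n * t ^ 2 + m * t - 1 = 0) :
    r + s + t = -n ∧ r * s + s * t + t * r = m ∧ r * s * t = 1 := by
  have h1 : r ^ 2 + r * s + s ^ 2 + n * (r + s) + m = 0 := by
    apply mul_left_cancel₀ (sub_ne_zero.2 hrs)
    linear_combination hr - hs
  have h2 : s ^ 2 + s * t + t ^ 2 + n * (s + t) + m = 0 := by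
    apply mul_left_cancel₀ (sub_ne_zero.2 hst)
    linear_combination hs - ht
  have h3 : r + s + t = -n := by
    apply mul_left_cancel₀ (sub_ne_zero.2 hrt)
    linear_combination h1 - h2
  have hn : n = -(r + s + t) := by linarith
  subst hn
  have h4 : r * s + s * t + t * r = m := by linear_combination -h1
  refine ⟨h3, h4, ?_⟩
  rw [← h4] at hr
  linear_combination hr

/-- The intervals are chosen for later use. The covector of CED changes sign at the eigenvector of r
= -1/(a+1), and the eigenform changes sign at E for r = -1/(a+2). The bound 10/17 keeps 1/`r 2`
above the golden ratio, so that X Y⁻¹ contracts the eigenform of `r 2`. -/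
theorem exists_isSpectrum {a : ℤ} (ha : 0 ≤ a) : ∃ r : Fin 3 → ℝ, IsSpectrum a r := by
  have hA : (0 : ℝ) ≤ a := by exact_mod_cast ha
  let f : ℝ → ℝ := fun x => x ^ 3 + (2 * a + 3) * x ^ 2 + (-a) * x - 1
  have hf : Continuous f := by fun_prop
  have hpos : (0 : ℝ) < a + 1 := by linarith
  obtain ⟨x, ⟨hx1, hx2⟩, hx⟩ := intermediate_value_Ioo (a := -(2 * a + 4 : ℝ)) (b := -5 / 2)
    (by linarith) hf.continuousOn (show (0 : ℝ) ∈ Set.Ioo _ _ by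
      constructor <;> simp only [f] <;> nlinarith)
  have hpos' : (0 : ℝ) < a + 2 := by linarith
  obtain ⟨y, ⟨hy1, hy2⟩, hy⟩ := intermediate_value_Ioo' (a := (-(1 / (a + 1)) : ℝ))
    (b := -(1 / (a + 2)))
    (by rw [neg_le_neg_iff]; exact one_div_le_one_div_of_le hpos (by linarith))
    hf.continuousOn (show (0 : ℝ) ∈ Set.Ioo _ _ by
      constructor
      · have h1 : f (-(1 / (a + 2) : ℝ)) = -(1 / (a + 2)) ^ 2 * (1 + 1 / (a + 2)) := by
          simp only [f]
          field_simp
          ring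
        rw [h1, neg_mul, neg_lt_zero]
        positivity
      · have h1 : f (-(1 / (a + 1) : ℝ)) = (1 / (a + 1)) * (1 + 1 / (a + 1) - (1 / (a + 1)) ^ 2) := by
          simp only [f]
          field_simp
          ring
        rw [h1]
        have h2 : (1 / (a + 1) : ℝ) ≤ 1 := by
          rw [div_le_one hpos]; linarith
        have h3 : (0 : ℝ) < 1 / (a + 1) := by positivity
        apply mul_pos h3
        nlinarith)
  obtain ⟨z, ⟨hz1, hz2⟩, hz⟩ := intermediate_value_Ioo (a := (1 / 2 : ℝ)) (b := 10 / 17)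
    (by norm_num) hf.continuousOn (show (0 : ℝ) ∈ Set.Ioo _ _ by
      constructor <;> simp only [f] <;> nlinarith)
  have hy1' : -1 < (a + 1 : ℝ) * y := by
    have := mul_lt_mul_of_pos_left hy1 hpos
    have h2 : (a + 1 : ℝ) * (-(1 / (a + 1))) = -1 := by field_simp
    linarith
  have hy2' : (a + 2 : ℝ) * y < -1 := by
    have := mul_lt_mul_of_pos_left hy2 hpos'
    have h2 : (a + 2 : ℝ) * (-(1 / (a + 2))) = -1 := by field_simp
    linarith
  have hy0 : y < 0 := by nlinarith
  have hy1'' : -1 < y := by nlinarith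
  obtain ⟨h1, h2, h3⟩ := vieta_of_roots (by linarith) (by linarith) (by linarith) hx hy hz
  exact ⟨![x, y, z], h1, h2, h3, hx2, hy1', hy2', hz1, hz2⟩

/-- The eigenvalue of the inverse operator, as a product of two eigenvalues of the operator. -/
def mu (r : Fin 3 → ℝ) (i : Fin 3) : ℝ := r (i + 1) * r (i + 2)

/-- The eigenform of the operator, normalized at the point `(0, 0, 1)`. -/
noncomputable def ell (r : Fin 3 → ℝ) (i : Fin 3) : E3 →ₗ[ℝ] ℝ :=
  form ![mu r i, -(r (i + 1) + r (i + 2)), 1]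

theorem ell_apply (r : Fin 3 → ℝ) (i : Fin 3) (p : E3) :
    ell r i p = mu r i * p 0 - (r (i + 1) + r (i + 2)) * p 1 + p 2 := by
  rw [ell, form_apply]
  simp
  ring

/-- The eigenvalue of `X ^ i * Y ^ j`. -/
noncomputable def latUnit (r : Fin 3 → ℝ) (q : ℤ × ℤ) (i : Fin 3) : ℝ :=
  (mu r i ^ 2) ^ q.1 * ((2 - mu r i)⁻¹) ^ q.2

/-- The form `f` is an eigenform of the operator `g` with the eigenvalue `c`. -/
def IsEigenform (f : E3 →ₗ[ℝ] ℝ) (g : SL3Z) (c : ℝ) : Prop := ∀ p, f (act g p) = c * f p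

namespace IsEigenform
variable {f : E3 →ₗ[ℝ] ℝ} {g g' : SL3Z} {c c' : ℝ}

theorem one : IsEigenform f 1 1 := fun p => by rw [act_one_apply, one_mul]

theorem mul (h : IsEigenform f g c) (h' : IsEigenform f g' c') : IsEigenform f (g * g') (c * c') :=
  fun p => by rw [act_mul_apply, h, h', mul_assoc]

theorem inv (h : IsEigenform f g c) (hc : c ≠ 0) : IsEigenform f g⁻¹ c⁻¹ := fun p => by
  have := h (act g⁻¹ p)
  rw [act_act_inv] at this
  rw [this, inv_mul_cancel_left₀ hc]

theorem pow (h : IsEigenform f g c) (n : ℕ) : IsEigenform f (g ^ n) (c ^ n) := by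
  induction n with
  | zero => simpa using IsEigenform.one
  | succ n ih => rw [pow_succ, pow_succ]; exact ih.mul h

theorem zpow (h : IsEigenform f g c) (hc : c ≠ 0) (n : ℤ) : IsEigenform f (g ^ n) (c ^ n) := by
  cases n with
  | ofNat n => simpa using h.pow n
  | negSucc n =>
    rw [zpow_negSucc, zpow_negSucc]
    exact (h.pow _).inv (pow_ne_zero _ hc)

end IsEigenform

namespace IsSpectrum

variable {a : ℤ} {r : Fin 3 → ℝ} (h : IsSpectrum a r)
include h

theorem sum_cyc (i : Fin 3) : r i + r (i + 1) + r (i + 2) = -(2 * a + 3) := by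
  have := h.sum_eq
  fin_cases i <;> simp <;> linarith

theorem sum_mul_cyc (i : Fin 3) : r i * (r (i + 1) + r (i + 2)) + mu r i = -a := by
  have := h.sum_mul_eq
  fin_cases i <;> simp [mu] <;> linarith

theorem mul_mu (i : Fin 3) : r i * mu r i = 1 := by
  have := h.mul_eq
  fin_cases i <;> simp [mu] <;> linarith

theorem mu_ne_zero (i : Fin 3) : mu r i ≠ 0 := fun h0 => by simpa [h0] using h.mul_mu i

/-- At (1, x, x²) the form `ell r i` takes the value (x - r (i+1)) (x - r (i+2)), so it is the form
that vanishes on the other two eigenvectors. The relations of Vieta give its eigenvalue. -/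
theorem eigenform_opA_inv (i : Fin 3) : IsEigenform (ell r i) (opA a)⁻¹ (mu r i) := fun p => by
  obtain ⟨h0, h1, h2⟩ := act_opA_inv a p
  rw [ell_apply, ell_apply, h0, h1, h2]
  linear_combination (mu r i * p 1) * h.sum_cyc i - (mu r i * p 0) * h.sum_mul_cyc i +
    ((r (i + 1) + r (i + 2)) * p 0 - p 1) * h.mul_mu i

theorem eigenform_opA (i : Fin 3) : IsEigenform (ell r i) (opA a) (r i) := by
  have := (h.eigenform_opA_inv i).inv (h.mu_ne_zero i)
  rwa [inv_inv, ← eq_inv_of_mul_eq_one_left (h.mul_mu i)] at this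

theorem eigenform_twoSubInv (i : Fin 3) : IsEigenform (ell r i) (twoSubInv a) (2 - mu r i) :=
  fun p => by
    rw [act_twoSubInv, map_sub, map_smul, h.eigenform_opA_inv i p, smul_eq_mul, sub_mul]

theorem mu_zero_lt : mu r 0 < 0 := by
  have := h.mul_mu 0
  have := h.lt_zero
  by_contra! h1
  nlinarith

theorem neg_lt_mu_zero : -(2 / 5) < mu r 0 := by
  have := h.mul_mu 0
  have := h.lt_zero
  by_contra! h1
  nlinarith

theorem mu_two_lt : mu r 2 < 2 := by
  have := h.mul_mu 2
  have := h.lt_two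
  by_contra! h1
  nlinarith

theorem lt_mu_two : 17 / 10 < mu r 2 := by
  have := h.mul_mu 2
  have := h.two_lt
  have := h.lt_two
  by_contra! h1
  nlinarith

theorem one_neg (ha : 0 ≤ a) : r 1 < 0 := by
  have hA : (0 : ℝ) ≤ a := by exact_mod_cast ha
  have := h.one_lt
  nlinarith

theorem neg_one_lt_one (ha : 0 ≤ a) : -1 < r 1 := by
  have hA : (0 : ℝ) ≤ a := by exact_mod_cast ha
  have h1 := h.lt_one
  have h2 := h.one_neg ha
  nlinarith

theorem mu_one_lt (ha : 0 ≤ a) : mu r 1 < -1 := by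
  have h3 := h.neg_one_lt_one ha
  have h2 := h.one_neg ha
  have := h.mul_mu 1
  by_contra! h1
  nlinarith

theorem two_sub_mu_pos (ha : 0 ≤ a) (i : Fin 3) : 0 < 2 - mu r i := by
  have h1 := h.mu_zero_lt
  have h2 := h.mu_one_lt ha
  have h3 := h.mu_two_lt
  fin_cases i <;> simp <;> linarith

theorem latUnit_pos (ha : 0 ≤ a) (q : ℤ × ℤ) (i : Fin 3) : 0 < latUnit r q i := by
  have := h.two_sub_mu_pos ha i
  have := h.mu_ne_zero i
  unfold latUnit
  positivity

theorem eigenform_latOp (ha : 0 ≤ a) (q : ℤ × ℤ) (i : Fin 3) :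
    IsEigenform (ell r i) (latOp a q) (latUnit r q i) := by
  have h1 := (h.two_sub_mu_pos ha i).ne'
  have h2 := h.mu_ne_zero i
  refine IsEigenform.mul (IsEigenform.zpow ?_ (pow_ne_zero _ h2) _)
    (IsEigenform.zpow ?_ (inv_ne_zero h1) _)
  · rw [opX_eq, pow_two]
    exact (h.eigenform_opA_inv i).mul (h.eigenform_opA_inv i)
  · exact (h.eigenform_twoSubInv i).inv h1

theorem strictMono (ha : 0 ≤ a) : StrictMono r := by
  have h1 := h.lt_zero
  have h2 := h.neg_one_lt_one ha
  have h3 := h.one_neg ha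
  have h4 := h.lt_two
  rw [Fin.strictMono_iff_lt_succ]
  intro i
  fin_cases i <;> simp <;> linarith

theorem ext_ell (ha : 0 ≤ a) {p q : E3} (hpq : ∀ i, ell r i p = ell r i q) : p = q := by
  have hm := h.strictMono ha
  have d1 : r 0 ≠ r 1 := (hm (by decide : (0 : Fin 3) < 1)).ne
  have d2 : r 1 ≠ r 2 := (hm (by decide : (1 : Fin 3) < 2)).ne
  have d3 : r 0 ≠ r 2 := (hm (by decide : (0 : Fin 3) < 2)).ne
  have e0 := hpq 0
  have e1 := hpq 1
  have e2 := hpq 2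
  simp only [ell_apply, mu, Fin.isValue, Fin.reduceAdd, zero_add] at e0 e1 e2
  have f1 : r 2 * (p 0 - q 0) - (p 1 - q 1) = 0 := by
    apply mul_left_cancel₀ (sub_ne_zero.2 d1)
    linear_combination e1 - e0
  have f2 : r 0 * (p 0 - q 0) - (p 1 - q 1) = 0 := by
    apply mul_left_cancel₀ (sub_ne_zero.2 d2)
    linear_combination e2 - e1
  have g0 : p 0 - q 0 = 0 := by
    apply mul_left_cancel₀ (sub_ne_zero.2 d3)
    linear_combination f2 - f1
  have g1 : p 1 - q 1 = 0 := by linear_combination -f1 + r 2 * g0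
  refine ext_three (by linarith) (by linarith) ?_
  linear_combination e0 - r 1 * r 2 * g0 + (r 1 + r 2) * g1

/-- Both 2 - `mu r 0` and 2 - `mu r 1` exceed 1, whereas `mu r 0 ^ 2 < 1 < mu r 1 ^ 2`. A nonzero
first exponent would thus force opposite signs of the second one. -/
theorem latUnit_injective (ha : 0 ≤ a) {q : ℤ × ℤ} (hq : ∀ i, latUnit r q i = 1) : q = 0 := by
  have a0 := h.mu_zero_lt
  have a0' := h.neg_lt_mu_zero
  have a1 := h.mu_one_lt ha
  have e0 := hq 0
  have e1 := hq 1
  rw [latUnit, inv_zpow, mul_inv_eq_one₀ (zpow_ne_zero _ (h.two_sub_mu_pos ha _).ne')] at e0 e1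
  have b0 : mu r 0 ^ 2 < 1 := by nlinarith
  have b0' : 0 < mu r 0 ^ 2 := by nlinarith
  have b1 : 1 < mu r 1 ^ 2 := by nlinarith
  have c0 : 1 < 2 - mu r 0 := by linarith
  have c1 : 1 < 2 - mu r 1 := by linarith
  have key : q.1 = 0 := by
    rcases lt_trichotomy q.1 0 with h1 | h1 | h1
    · have h2 : 1 < (mu r 0 ^ 2) ^ q.1 := one_lt_zpow_of_neg₀ b0' b0 h1
      have h3 : (mu r 1 ^ 2) ^ q.1 < 1 := zpow_lt_one_of_neg₀ b1 h1
      rw [e0, one_lt_zpow_iff_right₀ c0] at h2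
      rw [e1, zpow_lt_one_iff_right₀ c1] at h3
      omega
    · exact h1
    · have h2 : (mu r 0 ^ 2) ^ q.1 < 1 := zpow_lt_one₀ b0' b0 h1
      have h3 : 1 < (mu r 1 ^ 2) ^ q.1 := one_lt_zpow₀ b1 h1
      rw [e0, zpow_lt_one_iff_right₀ c0] at h2
      rw [e1, one_lt_zpow_iff_right₀ c1] at h3
      omega
  refine Prod.ext key ?_
  rw [key, zpow_zero] at e0
  exact (zpow_eq_one_iff_right₀ (by linarith) c0.ne').1 e0.symm

end IsSpectrum

/-! ### The positive orthant and translates of positive forms -/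

/-- The eigenvector of the operator. -/
noncomputable def eigv (r : Fin 3 → ℝ) (i : Fin 3) : E3 := !₂[1, r i, r i ^ 2]

theorem ell_eigv (r : Fin 3 → ℝ) (i j : Fin 3) :
    ell r i (eigv r j) = (r j - r (i + 1)) * (r j - r (i + 2)) := by
  rw [ell_apply, mu, eigv]
  simp
  ring

theorem ell_ptA (r : Fin 3 → ℝ) (i : Fin 3) : ell r i ptA = 1 := by
  rw [ell_apply, ptA, pt_apply_zero, pt_apply_one, pt_apply_two]
  simp

/-- The open orthant on which all eigenforms are positive. -/
def orthant (r : Fin 3 → ℝ) : Set E3 := {p | ∀ i, 0 < ell r i p}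

/-- The integer points generating the hull of an orthant. -/
def generators (O : Set E3) : Set E3 := (closure O ∩ integerPoints) \ {0}

theorem isOpen_orthant (r : Fin 3 → ℝ) : IsOpen (orthant r) := by
  have : orthant r = ⋂ i, {p | 0 < ell r i p} := by
    ext p
    simp [orthant]
  rw [this]
  exact isOpen_iInter_of_finite (fun i => isOpen_lt continuous_const
    (LinearMap.continuous_of_finiteDimensional (ell r i)))

theorem ell_nonneg_of_mem_closure {r : Fin 3 → ℝ} {p : E3} (hp : p ∈ closure (orthant r))
    (i : Fin 3) : 0 ≤ ell r i p := by
  have hc : IsClosed {p | 0 ≤ ell r i p} :=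
    isClosed_le continuous_const (LinearMap.continuous_of_finiteDimensional (ell r i))
  exact closure_minimal (fun q hq => (hq i).le) hc hp

theorem ptA_mem_orthant (r : Fin 3 → ℝ) : ptA ∈ orthant r := fun i => by
  rw [ell_ptA]; exact zero_lt_one

theorem ell_eigv_of_ne {r : Fin 3 → ℝ} {i j : Fin 3} (hij : j ≠ i) : ell r i (eigv r j) = 0 := by
  rw [ell_eigv]
  fin_cases i <;> fin_cases j <;> simp at hij ⊢

theorem mem_orthant_of_eigenform {r : Fin 3 → ℝ} {g : SL3Z} {u : Fin 3 → ℝ}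
    (hg : ∀ i, IsEigenform (ell r i) g (u i)) (hu : ∀ i, 0 < u i) {p : E3} (hp : p ∈ orthant r) :
    act g p ∈ orthant r := fun i => by
  rw [hg i p]
  exact mul_pos (hu i) (hp i)

theorem latUnit_add {a : ℤ} {r : Fin 3 → ℝ} (h : IsSpectrum a r) (ha : 0 ≤ a) (q q' : ℤ × ℤ)
    (i : Fin 3) : latUnit r (q + q') i = latUnit r q i * latUnit r q' i := by
  have h1 := (h.two_sub_mu_pos ha i).ne'
  have h2 := h.mu_ne_zero i
  rw [latUnit, latUnit, latUnit, Prod.fst_add, Prod.snd_add, zpow_add₀ (pow_ne_zero _ h2),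
    zpow_add₀ (inv_ne_zero h1)]
  ring

namespace IsSpectrum

variable {a : ℤ} {r : Fin 3 → ℝ} (h : IsSpectrum a r)
include h

theorem injective (ha : 0 ≤ a) : Function.Injective r := (h.strictMono ha).injective

theorem ell_eigv_self_ne_zero (ha : 0 ≤ a) (i : Fin 3) : ell r i (eigv r i) ≠ 0 := by
  rw [ell_eigv]
  refine mul_ne_zero (sub_ne_zero.2 ?_) (sub_ne_zero.2 ?_)
  · exact fun h1 => (by decide : ∀ i : Fin 3, i ≠ i + 1) i (h.injective ha h1)
  · exact fun h1 => (by decide : ∀ i : Fin 3, i ≠ i + 2) i (h.injective ha h1)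

theorem act_latOp_mem_orthant (ha : 0 ≤ a) (q : ℤ × ℤ) {p : E3} (hp : p ∈ orthant r) :
    act (latOp a q) p ∈ orthant r :=
  mem_orthant_of_eigenform (h.eigenform_latOp ha q) (h.latUnit_pos ha q) hp

/-- The eigenform at E equals μ²(2 + a + μ) with μ = `mu r i`. Only `i = 1` is delicate, and there
positivity of the last factor is the bound `one_lt`. -/
theorem ptE_mem_orthant (ha : 0 ≤ a) : ptE ∈ orthant r := by
  have hA : (0 : ℝ) ≤ a := by exact_mod_cast ha
  intro i
  have h1 : ell r i ptE = mu r i ^ 2 * (2 + a + mu r i) := by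
    rw [ell_apply, ptE, pt_apply_zero, pt_apply_one, pt_apply_two]
    push_cast
    have e1 := h.sum_cyc i
    have e2 := h.sum_mul_cyc i
    have e3 := h.mul_mu i
    have e4 : r (i + 1) + r (i + 2) = -(2 * a + 3) - r i := by linarith
    rw [e4] at e2 ⊢
    have e5 : (r i ^ 2 + (2 * a + 3) * r i) = a + mu r i := by linarith
    have e6 : mu r i ^ 2 * (a + mu r i) = 1 + (2 * a + 3) * mu r i := by
      rw [← e5]
      linear_combination (mu r i * r i + 1 + (2 * a + 3) * mu r i) * e3
    have e7 : r i + (2 * a + 3) = (a + mu r i) * mu r i := by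
      rw [← e5]
      linear_combination (- r i - (2 * a + 3)) * e3
    linear_combination 2 * e7 - e6
  rw [h1]
  have h2 : 0 < 2 + (a : ℝ) + mu r i := by
    have a0 := h.neg_lt_mu_zero
    have a2 := h.lt_mu_two
    have a1 := h.mul_mu 1
    have a1' := h.one_lt
    have a1'' := h.one_neg ha
    fin_cases i
    · simp; linarith
    · by_contra! h3
      simp only [Fin.mk_one] at h3
      nlinarith
    · simp; linarith
  have := h.mu_ne_zero i
  positivity

/-- A form with suitable signs on the eigenvectors is a positive combination of the eigenforms. -/
theorem exists_weights (ha : 0 ≤ a) (c : Fin 3 → ℝ)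
    (h0 : 0 < c 0 + c 1 * r 0 + c 2 * r 0 ^ 2) (h1 : c 0 + c 1 * r 1 + c 2 * r 1 ^ 2 < 0)
    (h2 : 0 < c 0 + c 1 * r 2 + c 2 * r 2 ^ 2) :
    ∃ w : Fin 3 → ℝ, (∀ i, 0 < w i) ∧ ∀ p, form c p = ∑ i, w i * ell r i p := by
  have hm := h.strictMono ha
  have d1 : r 0 < r 1 := hm (by decide : (0 : Fin 3) < 1)
  have d2 : r 1 < r 2 := hm (by decide : (1 : Fin 3) < 2)
  have d3 : r 0 < r 2 := hm (by decide : (0 : Fin 3) < 2)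
  have n1 : r 0 - r 1 ≠ 0 := by linarith
  have n2 : r 1 - r 2 ≠ 0 := by linarith
  have n3 : r 0 - r 2 ≠ 0 := by linarith
  -- Each weight is the value of the form at an eigenvector divided by the value of the matching
  -- eigenform there; these denominators have the signs +, -, +, as the hypotheses require.
  refine ⟨![(c 0 + c 1 * r 0 + c 2 * r 0 ^ 2) / ((r 0 - r 1) * (r 0 - r 2)),
    -(c 0 + c 1 * r 1 + c 2 * r 1 ^ 2) / ((r 0 - r 1) * (r 1 - r 2)),
    (c 0 + c 1 * r 2 + c 2 * r 2 ^ 2) / ((r 1 - r 2) * (r 0 - r 2))], ?_, fun p => ?_⟩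
  · intro i
    fin_cases i
    · exact div_pos h0 (mul_pos_of_neg_of_neg (by linarith) (by linarith))
    · exact div_pos (neg_pos.2 h1) (mul_pos_of_neg_of_neg (by linarith) (by linarith))
    · exact div_pos h2 (mul_pos_of_neg_of_neg (by linarith) (by linarith))
  · rw [form_apply]
    simp only [Fin.sum_univ_three, ell_apply, mu]
    simp
    field_simp
    ring

/-- The operators are X⁻¹, X Y⁻¹ and Y. For X Y⁻¹ the unit is μ²(2 - μ), which is less than 1 for
17/10 < μ < 2 because (μ - 1)(μ² - μ - 1) > 0 there. -/
theorem exists_contracting (ha : 0 ≤ a) (i : Fin 3) :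
    ∃ e : ℤ × ℤ, ∀ j, j ≠ i → latUnit r e j < 1 := by
  have a0 := h.mu_zero_lt
  have a0' := h.neg_lt_mu_zero
  have a1 := h.mu_one_lt ha
  have a2 := h.mu_two_lt
  have a2' := h.lt_mu_two
  fin_cases i
  · refine ⟨(-1, 0), fun j hj => ?_⟩
    simp only [latUnit, zpow_zero, mul_one, zpow_neg_one]
    apply inv_lt_one_of_one_lt₀
    fin_cases j
    · exact absurd rfl hj
    · show 1 < mu r 1 ^ 2
      nlinarith
    · show 1 < mu r 2 ^ 2
      nlinarith
  · refine ⟨(1, -1), fun j hj => ?_⟩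
    simp only [latUnit, zpow_one, zpow_neg_one, inv_inv]
    fin_cases j
    · simp; nlinarith
    · exact absurd rfl hj
    · simp
      nlinarith [mul_pos (sub_pos.2 a2) (sub_pos.2 a2')]
  · refine ⟨(0, 1), fun j hj => ?_⟩
    simp only [latUnit, zpow_zero, one_mul, zpow_one]
    apply inv_lt_one_of_one_lt₀
    fin_cases j
    · simp; linarith
    · simp; linarith
    · exact absurd rfl hj

theorem latUnit_nsmul (ha : 0 ≤ a) (n : ℕ) (q : ℤ × ℤ) (i : Fin 3) :
    latUnit r (n • q) i = latUnit r q i ^ n := by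
  induction n with
  | zero => simp [latUnit]
  | succ n ih => rw [succ_nsmul, latUnit_add h ha, ih, pow_succ]

/-- A point on which all translates of a positive form are bounded away from zero lies in the
orthant. -/
theorem mem_orthant_of_forall_le (ha : 0 ≤ a) {f : E3 →ₗ[ℝ] ℝ} {w : Fin 3 → ℝ}
    (hw : ∀ i, 0 < w i) (hf : ∀ p, f p = ∑ i, w i * ell r i p) {d : ℝ} (hd : 0 < d) {p : E3}
    (hp : ∀ q, d ≤ f (act (latOp a q) p)) : p ∈ orthant r := by
  intro i
  by_contra! hi
  -- Powers of `e` make all terms except the `i`-th tend to zero while the `i`-th one stays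
  -- nonpositive, so some translate drops below `d`.
  obtain ⟨e, he⟩ := h.exists_contracting ha i
  have hlim : Filter.Tendsto (fun n : ℕ => ∑ j ∈ Finset.univ.erase i,
      w j * (latUnit r e j ^ n * ell r j p)) Filter.atTop (nhds 0) := by
    rw [show (0 : ℝ) = ∑ j ∈ Finset.univ.erase i, w j * (0 * ell r j p) by simp]
    refine tendsto_finsetSum _ (fun j hj => ?_)
    refine Filter.Tendsto.const_mul _ (Filter.Tendsto.mul_const _ ?_)
    exact tendsto_pow_atTop_nhds_zero_of_lt_one (h.latUnit_pos ha e j).le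
      (he j (Finset.ne_of_mem_erase hj))
  obtain ⟨n, hn⟩ := (hlim.eventually (gt_mem_nhds hd)).exists
  have h1 := hp (n • e)
  rw [hf, ← Finset.add_sum_erase _ _ (Finset.mem_univ i)] at h1
  simp only [h.eigenform_latOp ha _ _ p, h.latUnit_nsmul ha] at h1
  have h2 : w i * (latUnit r e i ^ n * ell r i p) ≤ 0 :=
    mul_nonpos_of_nonneg_of_nonpos (hw i).le
      (mul_nonpos_of_nonneg_of_nonpos (pow_pos (h.latUnit_pos ha e i) n).le hi)
  linarith

/-- The translates of a positive form are pairwise distinct. -/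
theorem translate_injective (ha : 0 ≤ a) {f : E3 →ₗ[ℝ] ℝ} {w : Fin 3 → ℝ}
    (hw : ∀ i, 0 < w i) (hf : ∀ p, f p = ∑ i, w i * ell r i p) {q q' : ℤ × ℤ}
    (hq : ∀ p, f (act (latOp a q) p) = f (act (latOp a q') p)) : q = q' := by
  have h1 : ∀ i, latUnit r q i = latUnit r q' i := by
    intro i
    -- Only the `i`-th eigenform is nonzero at this eigenvector, so the equation compares the `i`-th
    -- units alone.
    have h2 := hq (eigv r i)
    rw [hf, hf, Finset.sum_eq_single i, Finset.sum_eq_single i, h.eigenform_latOp ha,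
      h.eigenform_latOp ha] at h2
    · exact mul_right_cancel₀ (h.ell_eigv_self_ne_zero ha i) (mul_left_cancel₀ (hw i).ne' h2)
    all_goals
      first
      | (intro j _ hj; rw [h.eigenform_latOp ha, ell_eigv_of_ne hj.symm]; simp)
      | simp
  refine (sub_eq_zero.1 (h.latUnit_injective ha (q := q - q') (fun i => ?_)))
  have h3 : latUnit r (q - q') i * latUnit r q' i = latUnit r q' i := by
    rw [← latUnit_add h ha, sub_add_cancel, h1]
  exact (mul_eq_right₀ (h.latUnit_pos ha q' i).ne').1 h3

/-- Only finitely many translates of a positive integer form are small somewhere near a given point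
of the orthant. -/
theorem finite_translates (ha : 0 ≤ a) {c : Fin 3 → ℤ} {w : Fin 3 → ℝ}
    (hw : ∀ i, 0 < w i) (hf : ∀ p, intForm c p = ∑ i, w i * ell r i p) {p : E3}
    (hp : p ∈ orthant r) (C : ℝ) :
    ∃ U ∈ nhds p, {q | ∃ p' ∈ U, intForm c (act (latOp a q) p') ≤ C}.Finite := by
  obtain ⟨e, he, hball⟩ := Metric.isOpen_iff.1 (isOpen_orthant r) p hp
  refine ⟨Metric.ball p (e / 2), Metric.ball_mem_nhds _ (by positivity), ?_⟩
  -- The translates have integer coefficients and are pairwise distinct, so a bound on the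
  -- coefficients gives finiteness.
  let m : ℤ × ℤ → (Fin 3 → ℤ) :=
    fun q => Matrix.vecMul c (latOp a q : Matrix (Fin 3) (Fin 3) ℤ)
  have hm : Function.Injective m := fun q q' hq => by
    refine h.translate_injective ha hw hf (fun x => ?_)
    rw [intForm_act, intForm_act]
    exact congrArg (fun c => intForm c x) hq
  let N : ℤ := ⌈C / (e / 2)⌉
  refine Set.Finite.subset (Set.Finite.preimage (hm.injOn)
    (Set.finite_Icc (fun _ => -N) (fun _ => N))) ?_
  rintro q ⟨p', hp', hC⟩
  have hpos : ∀ x ∈ orthant r, 0 < intForm (m q) x := fun x hx => by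
    rw [← intForm_act, hf]
    exact Finset.sum_pos (fun i _ => mul_pos (hw i) (h.act_latOp_mem_orthant ha q hx i))
      Finset.univ_nonempty
  rw [intForm_act] at hC
  -- A shift of `p'` by ±e/2 along a coordinate axis stays in the orthant, where the form is
  -- positive; this bounds the coefficient on that axis.
  have hbound : ∀ k : Fin 3, ∀ s : ℝ, |s| = e / 2 → 0 ≤ C + s * (m q k : ℝ) := by
    intro k s hs
    have hx : p' + s • EuclideanSpace.single k (1 : ℝ) ∈ orthant r := by
      apply hball
      rw [Metric.mem_ball, dist_eq_norm]
      calc ‖p' + s • EuclideanSpace.single k (1 : ℝ) - p‖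
          = ‖(p' - p) + s • EuclideanSpace.single k (1 : ℝ)‖ := by congr 1; abel
        _ ≤ ‖p' - p‖ + ‖s • EuclideanSpace.single k (1 : ℝ)‖ := norm_add_le _ _
        _ < e / 2 + e / 2 := by
            have h3 : ‖p' - p‖ < e / 2 := by rwa [← dist_eq_norm]
            have h4 : ‖s • EuclideanSpace.single k (1 : ℝ)‖ = e / 2 := by
              simp [norm_smul, hs]
            rw [h4]
            linarith
        _ = e := by ring
    have h1 := hpos _ hx
    rw [map_add, map_smul] at h1
    have h2 : intForm (m q) (EuclideanSpace.single k (1 : ℝ)) = m q k := by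
      rw [intForm_apply]
      fin_cases k <;> simp
    rw [h2, smul_eq_mul] at h1
    linarith
  have he2 : 0 < e / 2 := by positivity
  rw [Set.mem_preimage, Set.mem_Icc, Pi.le_def, Pi.le_def]
  refine ⟨fun k => ?_, fun k => ?_⟩
  · have h1 := hbound k (e / 2) (abs_of_pos he2)
    have h2 : (-(m q k : ℤ) : ℝ) ≤ C / (e / 2) := by
      rw [le_div_iff₀ he2]
      linarith
    have h3 : ((-(m q k) : ℤ) : ℝ) ≤ N := by
      push_cast
      exact h2.trans (Int.le_ceil _)
    have h4 : -(m q k) ≤ N := by exact_mod_cast h3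
    omega
  · have h1 := hbound k (-(e / 2)) (by rw [abs_neg, abs_of_pos he2])
    have h2 : (m q k : ℝ) ≤ C / (e / 2) := by
      rw [le_div_iff₀ he2]
      linarith
    exact_mod_cast h2.trans (Int.le_ceil _)

/-- A positive form with integer coefficients is at least one on the integer points of the closed
orthant. -/
theorem one_le_intForm (ha : 0 ≤ a) {c : Fin 3 → ℤ}
    (h0 : 0 < c 0 + c 1 * r 0 + c 2 * r 0 ^ 2) (h1 : c 0 + c 1 * r 1 + c 2 * r 1 ^ 2 < 0)
    (h2 : 0 < c 0 + c 1 * r 2 + c 2 * r 2 ^ 2) {x y z : ℤ}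
    (hp : ∀ i, 0 ≤ ell r i (pt x y z)) (hne : pt x y z ≠ 0) :
    1 ≤ c 0 * x + c 1 * y + c 2 * z := by
  obtain ⟨w, hw, hf⟩ := h.exists_weights ha (fun i => (c i : ℝ)) h0 h1 h2
  have hpos : 0 < intForm c (pt x y z) := by
    rw [intForm, hf]
    have hex : ∃ i, ell r i (pt x y z) ≠ 0 := by
      by_contra! hz
      exact hne (h.ext_ell ha (fun i => by rw [hz i, map_zero]))
    obtain ⟨i, hi⟩ := hex
    exact Finset.sum_pos' (fun j _ => mul_nonneg (hw j).le (hp j))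
      ⟨i, Finset.mem_univ _, mul_pos (hw i) (lt_of_le_of_ne (hp i) (Ne.symm hi))⟩
  rw [intForm_pt] at hpos
  have : 0 < c 0 * x + c 1 * y + c 2 * z := by exact_mod_cast hpos
  omega

end IsSpectrum

/-! ### Labelled vertices -/

/-- Labels of the vertices: the class of a vertex (`false` for the class of `A`, `true` for the
class of `E`) together with the exponents of the operator that maps `A` or `E` to it. -/
abbrev Label : Type := Bool × ℤ × ℤ

/-- The representative of a class of vertices. -/
noncomputable def baseVertex (c : Bool) : E3 := bif c then ptE else ptA

/-- The vertex with the given label. -/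
noncomputable def vert (a : ℤ) (v : Label) : E3 := act (latOp a v.2) (baseVertex v.1)

/-- Translation of labels. -/
def shift (q : ℤ × ℤ) (v : Label) : Label := (v.1, v.2 + q)

theorem act_latOp_vert (a : ℤ) (q : ℤ × ℤ) (v : Label) :
    act (latOp a q) (vert a v) = vert a (shift q v) := by
  rw [vert, vert, shift, ← act_mul_apply, ← latOp_add, add_comm]

theorem shift_zero (v : Label) : shift 0 v = v := by simp [shift]

theorem shift_shift (q q' : ℤ × ℤ) (v : Label) : shift q (shift q' v) = shift (q' + q) v := by
  simp [shift, add_assoc]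

theorem baseVertex_mem_integerPoints (c : Bool) : baseVertex c ∈ integerPoints := by
  cases c
  · exact pt_mem _ _ _
  · exact pt_mem _ _ _

theorem vert_mem_integerPoints (a : ℤ) (v : Label) : vert a v ∈ integerPoints :=
  act_mem_integerPoints _ (baseVertex_mem_integerPoints _)

theorem ne_zero_of_mem_orthant {r : Fin 3 → ℝ} {p : E3} (hp : p ∈ orthant r) : p ≠ 0 := by
  rintro rfl
  have := hp 0
  simp at this

theorem mem_generators {r : Fin 3 → ℝ} {p : E3} (hp : p ∈ orthant r) (hp' : p ∈ integerPoints) :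
    p ∈ generators (orthant r) :=
  ⟨⟨subset_closure hp, hp'⟩, ne_zero_of_mem_orthant hp⟩

/-- No operator commuting with `A_{m,n}` maps `A` to `E`. -/
theorem act_ptA_ne_ptE {a : ℤ} (ha : 0 ≤ a) {g : SL3Z} (hg : Commute g (opA a)) :
    act g ptA ≠ ptE := by
  intro hE
  have e (i : Fin 3) : (g i 2 : ℝ) = ptE i := by
    rw [← hE, act_apply, ptA, pt_apply_zero, pt_apply_one, pt_apply_two]
    simp
  have e0 : g 0 2 = 3 := Int.cast_injective ((e 0).trans (pt_apply_zero 3 2 1))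
  have e1 : g 1 2 = 2 := Int.cast_injective ((e 1).trans (pt_apply_one 3 2 1))
  have e2 : g 2 2 = 1 := Int.cast_injective ((e 2).trans (pt_apply_two 3 2 1))
  -- The third column of `g` is E, commutation determines the other two columns, and the resulting
  -- determinant is `a + 3`.
  have hM : (g : Matrix (Fin 3) (Fin 3) ℤ) * (opA a : Matrix (Fin 3) (Fin 3) ℤ) =
      (opA a : Matrix (Fin 3) (Fin 3) ℤ) * (g : Matrix (Fin 3) (Fin 3) ℤ) := by
    rw [← Matrix.SpecialLinearGroup.coe_mul, hg.eq, Matrix.SpecialLinearGroup.coe_mul]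
  have m (i j : Fin 3) := congrFun (congrFun hM i) j
  have m01 := m 0 1
  have m02 := m 0 2
  have m11 := m 1 1
  have m12 := m 1 2
  have m21 := m 2 1
  have m22 := m 2 2
  rw [opA_coe] at m01 m02 m11 m12 m21 m22
  simp [Matrix.mul_apply, Fin.sum_univ_three, e0, e1, e2] at m01 m02 m11 m12 m21 m22
  have hdet := g.det_coe
  rw [Matrix.det_fin_three, e0, e1, e2] at hdet
  have f01 : g 0 1 = 3 * (2 * a + 3) + 2 := by linarith
  have f11 : g 1 1 = 2 * (2 * a + 3) + 1 := by linarith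
  have f21 : g 2 1 = 2 * a + 3 := by linarith
  rw [f01, f11, f21] at m21
  rw [f11] at m01
  rw [f21] at m11
  have f00 : g 0 0 = 2 * (2 * a + 3) + 1 - 3 * a := by linarith
  have f10 : g 1 0 = 2 * a + 3 - 2 * a := by linarith
  have f20 : g 2 0 = 3 * (2 * a + 3) + 2 + a * (2 * (2 * a + 3) + 1) +
    (-3 + -(2 * a)) * (2 * a + 3) - a := by linarith
  rw [f00, f10, f20, f01, f11, f21] at hdet
  ring_nf at hdet
  omega

namespace IsSpectrum

variable {a : ℤ} {r : Fin 3 → ℝ} (h : IsSpectrum a r)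
include h

theorem baseVertex_mem_orthant (ha : 0 ≤ a) (c : Bool) : baseVertex c ∈ orthant r := by
  cases c
  · exact ptA_mem_orthant r
  · exact h.ptE_mem_orthant ha

theorem vert_mem_orthant (ha : 0 ≤ a) (v : Label) : vert a v ∈ orthant r :=
  h.act_latOp_mem_orthant ha _ (h.baseVertex_mem_orthant ha _)

theorem eq_zero_of_act_latOp_eq (ha : 0 ≤ a) {q : ℤ × ℤ} {p : E3} (hp : p ∈ orthant r)
    (hq : act (latOp a q) p = p) : q = 0 := by
  refine h.latUnit_injective ha (fun i => ?_)
  have h1 := h.eigenform_latOp ha q i p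
  rw [hq] at h1
  exact (mul_eq_right₀ (hp i).ne').1 h1.symm

/-- A coincidence inside one class gives a translation fixing a point of the orthant; a coincidence
between the classes gives an operator mapping A to E. -/
theorem vert_injective (ha : 0 ≤ a) : Function.Injective (vert a) := by
  have hAE : ∀ q q', vert a (false, q) ≠ vert a (true, q') := by
    intro q q' hv
    have h1 : act (latOp a (q - q')) ptA = ptE := by
      have h2 := congrArg (act (latOp a (-q'))) hv
      rw [act_latOp_vert, act_latOp_vert] at h2
      simp only [shift, add_neg_cancel, ← sub_eq_add_neg] at h2
      simpa [vert, baseVertex, latOp_zero, act_one_apply] using h2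
    exact act_ptA_ne_ptE ha (commute_opA_latOp a _).symm h1
  rintro ⟨c, q⟩ ⟨c', q'⟩ hv
  by_cases hc : c = c'
  · subst hc
    have h1 : act (latOp a (q - q')) (vert a (c, q')) = vert a (c, q') := by
      rw [act_latOp_vert, ← hv]
      simp [shift]
    have h2 := h.eq_zero_of_act_latOp_eq ha (h.vert_mem_orthant ha _) h1
    rw [sub_eq_zero.1 h2]
  · cases c <;> cases c' <;> simp at hc
    · exact absurd hv (hAE _ _)
    · exact absurd hv.symm (hAE _ _)

end IsSpectrum

/-! ### From finitely many triangles to a periodic triangulation -/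

/-- Triangles with labelled vertices, in the planes `f = d`, which together with their translates
support the hull and meet at convex angles. -/
structure IsFundamentalData {T : Type} (a : ℤ) (r : Fin 3 → ℝ) (lab : T → Fin 3 → Label)
    (f : T → Fin 3 → ℤ) (d : T → ℤ) : Prop where
  pos : ∀ t, 0 < d t
  sign_zero : ∀ t, 0 < f t 0 + f t 1 * r 0 + f t 2 * r 0 ^ 2
  sign_one : ∀ t, f t 0 + f t 1 * r 1 + f t 2 * r 1 ^ 2 < 0
  sign_two : ∀ t, 0 < f t 0 + f t 1 * r 2 + f t 2 * r 2 ^ 2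
  le : ∀ t (x y z : ℤ), (∀ i, 0 ≤ ell r i (pt x y z)) → pt x y z ≠ 0 →
    d t ≤ f t 0 * x + f t 1 * y + f t 2 * z
  height : ∀ t k, intForm (f t) (vert a (lab t k)) = d t
  adjacent : ∀ t k, ∃ t' q, (∀ l, l ≠ k → intForm (f t') (vert a (shift q (lab t l))) = d t') ∧
    d t' < intForm (f t') (vert a (shift q (lab t k)))
  indep : ∀ t, LinearIndependent ℝ (fun k => vert a (lab t k))

/-- The vertices of the translates of the triangles. -/
def shiftVtx {T : Type} (lab : T → Fin 3 → Label) (τ : T × ℤ × ℤ) (k : Fin 3) : Label :=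
  shift τ.2 (lab τ.1 k)

/-- The form that is equal to one on a translate of a triangle. -/
noncomputable def heightForm {T : Type} (a : ℤ) (f : T → Fin 3 → ℤ) (d : T → ℤ) (τ : T × ℤ × ℤ) :
    E3 →ₗ[ℝ] ℝ :=
  ((d τ.1 : ℝ)⁻¹) • (intForm (f τ.1) ∘ₗ act (latOp a (-τ.2)))

theorem heightForm_apply {T : Type} (a : ℤ) (f : T → Fin 3 → ℤ) (d : T → ℤ) (τ : T × ℤ × ℤ)
    (p : E3) : heightForm a f d τ p = (d τ.1 : ℝ)⁻¹ * intForm (f τ.1) (act (latOp a (-τ.2)) p) :=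
  rfl

theorem heightForm_vert {T : Type} (a : ℤ) (f : T → Fin 3 → ℤ) (d : T → ℤ) (τ : T × ℤ × ℤ)
    (v : Label) : heightForm a f d τ (vert a v) =
      (d τ.1 : ℝ)⁻¹ * intForm (f τ.1) (vert a (shift (-τ.2) v)) := by
  rw [heightForm_apply, act_latOp_vert]

theorem IsFundamentalData.isConvexTriangulation {T : Type} [Finite T] [Nonempty T] {a : ℤ}
    (ha : 0 ≤ a) {r : Fin 3 → ℝ} (h : IsSpectrum a r) {lab : T → Fin 3 → Label}
    {f : T → Fin 3 → ℤ} {d : T → ℤ} (hF : IsFundamentalData a r lab f d) :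
    IsConvexTriangulation (vert a) (shiftVtx lab) (heightForm a f d) (generators (orthant r))
      (orthant r) := by
  have hd : ∀ t, (0 : ℝ) < d t := fun t => by exact_mod_cast hF.pos t
  have hwt := fun t => h.exists_weights ha (fun i => (f t i : ℝ)) (hF.sign_zero t) (hF.sign_one t)
    (hF.sign_two t)
  choose w hw hwf using hwt
  have hform : ∀ t p, intForm (f t) p = ∑ i, w t i * ell r i p := hwf
  refine
    { isOpen := isOpen_orthant r
      nonempty := inferInstance
      indep := fun τ => ?_
      height := fun τ k => ?_
      adjacent := fun τ k => ?_
      mem := fun τ k => mem_generators (h.vert_mem_orthant ha _) (vert_mem_integerPoints a _)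
      le := ?_
      smul_mem := ?_
      subset := ?_
      pos := ?_
      finite := ?_
      inj := fun _ _ _ _ hv => h.vert_injective ha hv }
  · have h1 := (hF.indep τ.1).map' (act (latOp a τ.2)) (LinearMap.ker_eq_bot.2
      (Function.LeftInverse.injective (act_inv_act (latOp a τ.2))))
    have h2 : (fun k => vert a (shiftVtx lab τ k)) =
        (act (latOp a τ.2)) ∘ (fun k => vert a (lab τ.1 k)) := by
      funext k
      exact (act_latOp_vert a τ.2 _).symm
    rw [h2]
    exact h1
  · rw [heightForm_vert, shiftVtx, shift_shift, add_neg_cancel, shift_zero, hF.height,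
      inv_mul_cancel₀ (hd _).ne']
  · obtain ⟨t', q, h1, h2⟩ := hF.adjacent τ.1 k
    -- The translation `q` brings the base triangle next to `t'`, so the neighbour of the base
    -- triangle itself is `t'` moved by `-q`.
    refine ⟨(t', τ.2 - q), fun l hl => ?_, ?_⟩
    · rw [heightForm_vert, shiftVtx, shift_shift]
      simp only [neg_sub, add_sub_cancel]
      rw [h1 l hl, inv_mul_cancel₀ (hd _).ne']
    · rw [heightForm_vert, shiftVtx, shift_shift]
      simp only [neg_sub, add_sub_cancel]
      rw [← div_eq_inv_mul, one_lt_div (hd _)]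
      exact h2
  · rintro p ⟨⟨hp, hpi⟩, hp0⟩ τ
    rw [heightForm_apply, ← div_eq_inv_mul, one_le_div (hd _)]
    obtain ⟨x, y, z, hxyz⟩ := exists_eq_pt (act_mem_integerPoints (latOp a (-τ.2)) hpi)
    rw [hxyz, intForm_pt]
    have h1 := hF.le τ.1 x y z (fun i => ?_) ?_
    · exact_mod_cast h1
    · rw [← hxyz, h.eigenform_latOp ha]
      exact mul_nonneg (h.latUnit_pos ha _ i).le (ell_nonneg_of_mem_closure hp i)
    · rw [← hxyz]
      intro h0
      apply hp0
      rw [Set.mem_singleton_iff, ← act_inv_act (latOp a (-τ.2)) p, h0, map_zero]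
  · rintro p ⟨⟨hp, hpi⟩, hp0⟩ n hn
    refine ⟨⟨?_, ?_⟩, ?_⟩
    · refine map_mem_closure (continuous_const_smul (n : ℝ)) hp (fun x hx i => ?_)
      rw [map_smul, smul_eq_mul]
      exact mul_pos (by exact_mod_cast Nat.pos_of_ne_zero hn) (hx i)
    · intro i
      obtain ⟨k, hk⟩ := hpi i
      exact ⟨n * k, by simp [hk]⟩
    · intro h0
      rcases smul_eq_zero.1 h0 with h1 | h1
      · exact hn (by exact_mod_cast h1)
      · exact hp0 h1
  · intro p hp
    -- The half-spaces of the translates of a single triangle already force `p` into the orthant.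
    obtain ⟨t⟩ := ‹Nonempty T›
    refine h.mem_orthant_of_forall_le ha (hw t) (hform t) (hd t) (fun q => ?_)
    have h1 := hp (t, -q)
    rwa [heightForm_apply, neg_neg, ← div_eq_inv_mul, one_le_div (hd _)] at h1
  · intro τ p hp
    rw [heightForm_apply, hform]
    refine mul_pos (inv_pos.2 (hd _)) (Finset.sum_pos (fun i _ => mul_pos (hw _ i) ?_)
      Finset.univ_nonempty)
    exact h.act_latOp_mem_orthant ha _ hp i
  · intro p hp C
    choose U hU hfin using fun t => h.finite_translates ha (hw t) (hform t) hp (C * d t)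
    refine ⟨⋂ t, U t, Filter.iInter_mem.2 hU, ?_⟩
    refine (Set.finite_iUnion (fun t => (hfin t).image (fun q => ((t, -q) : T × ℤ × ℤ)))).subset ?_
    rintro ⟨t, q⟩ ⟨p', hp', hC⟩
    rw [heightForm_apply, ← div_eq_inv_mul, div_le_iff₀ (hd _)] at hC
    exact Set.mem_iUnion.2 ⟨t, -q, ⟨p', Set.mem_iInter.1 hp' t, hC⟩, by simp⟩

/-! ### Coordinates of the vertices and verification of the triangles -/

theorem act_twoSubInv_pt (a x y z : ℤ) :
    act (twoSubInv a) (pt x y z) =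
      pt ((2 + a) * x - (2 * a + 3) * y - z) (2 * y - x) (2 * z - y) := by
  rw [act_twoSubInv, act_opA_inv_pt]
  refine ext_three ?_ ?_ ?_ <;>
    simp only [PiLp.sub_apply, PiLp.smul_apply, pt_apply_zero, pt_apply_one, pt_apply_two,
      smul_eq_mul] <;> push_cast <;> ring

theorem act_opX_pt (a x y z : ℤ) :
    act (opX a) (pt x y z) =
      pt (-a * (-a * x + (2 * a + 3) * y + z) + (2 * a + 3) * x + y)
        (-a * x + (2 * a + 3) * y + z) x := by
  rw [opX_eq, act_mul_apply, act_opA_inv_pt, act_opA_inv_pt]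

theorem act_opX_inv_pt (a x y z : ℤ) :
    act (opX a)⁻¹ (pt x y z) =
      pt z (x + a * y - (2 * a + 3) * z)
        (y + a * z - (2 * a + 3) * (x + a * y - (2 * a + 3) * z)) := by
  rw [opX_inv_eq, act_mul_apply, act_opA_pt, act_opA_pt]

theorem act_opY_pt (a x y z : ℤ) :
    act (opY a) (pt x y z) =
      pt (4 * x + (4 * a + 7) * y + 2 * z) (2 * x + (2 * a + 4) * y + z)
        (x + (a + 2) * y + z) := by
  rw [act_opY_eq_iff, act_twoSubInv_pt]
  congr 1 <;> ring

theorem act_opX_ptA (a : ℤ) : act (opX a) ptA = ptD a := by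
  rw [ptA, act_opX_pt, ptD]; congr 1 <;> ring

theorem act_opX_ptB (a : ℤ) : act (opX a) ptB = ptC := by
  rw [ptB, act_opX_pt, ptC]; congr 1 <;> ring

theorem act_opY_ptA (a : ℤ) : act (opY a) ptA = ptB := by
  rw [ptA, act_opY_pt, ptB]; norm_num

theorem act_opY_ptD (a : ℤ) : act (opY a) (ptD a) = ptC := by
  rw [ptD, act_opY_pt, ptC]; congr 1 <;> ring

theorem vert_A (a : ℤ) : vert a (false, 0, 0) = ptA := by
  simp [vert, baseVertex, latOp, act_one_apply]

theorem vert_E (a : ℤ) : vert a (true, 0, 0) = ptE := by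
  simp [vert, baseVertex, latOp, act_one_apply]

theorem vert_add_right (a : ℤ) (c : Bool) (i j : ℤ) :
    vert a (c, i, j + 1) = act (opY a) (vert a (c, i, j)) := by
  have h1 : latOp a (0, 1) = opY a := by simp [latOp]
  rw [← h1, act_latOp_vert]
  simp [shift]

theorem vert_add_left (a : ℤ) (c : Bool) (i j : ℤ) :
    vert a (c, i + 1, j) = act (opX a) (vert a (c, i, j)) := by
  have h1 : latOp a (1, 0) = opX a := by simp [latOp]
  rw [← h1, act_latOp_vert]
  simp [shift]

theorem vert_sub_left (a : ℤ) (c : Bool) (i j : ℤ) :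
    vert a (c, i - 1, j) = act (opX a)⁻¹ (vert a (c, i, j)) := by
  rw [← sub_add_cancel i 1, vert_add_left, act_inv_act, sub_add_cancel]

theorem vert_sub_right (a : ℤ) (c : Bool) (i j : ℤ) :
    vert a (c, i, j - 1) = act (twoSubInv a) (vert a (c, i, j)) := by
  rw [← sub_add_cancel j 1, vert_add_right, ← opY_inv_eq, act_inv_act, sub_add_cancel]

theorem vert_B (a : ℤ) : vert a (false, 0, 1) = ptB := by
  rw [← zero_add (1 : ℤ), vert_add_right, vert_A, act_opY_ptA]

theorem vert_D (a : ℤ) : vert a (false, 1, 0) = ptD a := by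
  rw [← zero_add (1 : ℤ), vert_add_left, vert_A, act_opX_ptA]

theorem vert_C (a : ℤ) : vert a (false, 1, 1) = ptC := by
  have := vert_add_right a false 1 0
  rw [vert_D, act_opY_ptD] at this
  simpa using this

theorem vert_XD (a : ℤ) : vert a (false, 2, 0) =
    pt (-a * (a * a + 2 * a + 3) - (2 * a + 3) * a + 1) (a * a + 2 * a + 3) (-a) := by
  have := vert_add_left a false 1 0
  rw [vert_D, ptD, act_opX_pt] at this
  refine this.trans ?_
  congr 1 <;> ring

theorem vert_YB (a : ℤ) : vert a (false, 0, 2) = pt (4 * a + 17) (2 * a + 9) (a + 5) := by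
  have := vert_add_right a false 0 1
  rw [vert_B, ptB, act_opY_pt] at this
  refine this.trans ?_
  congr 1 <;> ring

theorem vert_E_left (a : ℤ) : vert a (true, -1, 0) = pt 1 0 (a + 2) := by
  have := vert_sub_left a true 0 0
  rw [vert_E, ptE, act_opX_inv_pt] at this
  refine this.trans ?_
  congr 1 <;> ring

theorem vert_E_right (a : ℤ) : vert a (true, 0, -1) = pt (-a - 1) 1 0 := by
  have := vert_sub_right a true 0 0
  rw [vert_E, ptE, act_twoSubInv_pt] at this
  refine this.trans ?_
  congr 1
  ring

theorem vert_B_left (a : ℤ) : vert a (false, -1, 1) =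
    pt 1 (-a - 1) (1 + a + (2 * a + 3) * (a + 1)) := by
  have := vert_sub_left a false 0 1
  rw [vert_B, ptB, act_opX_inv_pt] at this
  refine this.trans ?_
  congr 1 <;> ring

theorem vert_D_right (a : ℤ) : vert a (false, 1, -1) =
    pt (-(2 + a) * a - (2 * a + 3)) (a + 2) (-1) := by
  have := vert_sub_right a false 1 0
  rw [vert_D, ptD, act_twoSubInv_pt] at this
  refine this.trans ?_
  congr 1 <;> ring

theorem linearIndependent_of_det_ne_zero {P : Fin 3 → E3}
    (hP : (Matrix.of (fun i j => P i j)).det ≠ 0) : LinearIndependent ℝ P := by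
  have h1 : LinearIndependent ℝ (Matrix.of (fun i j => P i j)).row :=
    Matrix.linearIndependent_rows_iff_isUnit.2
      ((Matrix.isUnit_iff_isUnit_det _).2 (isUnit_iff_ne_zero.2 hP))
  exact LinearIndependent.of_comp (WithLp.linearEquiv 2 ℝ (Fin 3 → ℝ)).toLinearMap h1

/-- The triangles `ABD`, `BCD`. -/
def labTwo : Fin 2 → Fin 3 → Label :=
  ![![(false, 0, 0), (false, 0, 1), (false, 1, 0)], ![(false, 0, 1), (false, 1, 1), (false, 1, 0)]]

/-- The triangles `ABD`, `BDE`, `BCE`, `CED`. -/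
def labFour : Fin 4 → Fin 3 → Label :=
  ![![(false, 0, 0), (false, 0, 1), (false, 1, 0)], ![(false, 0, 1), (false, 1, 0), (true, 0, 0)],
    ![(false, 0, 1), (false, 1, 1), (true, 0, 0)], ![(false, 1, 1), (true, 0, 0), (false, 1, 0)]]

/-- The integer covectors of the planes of `ABD`, `BCD`. -/
def covTwo : Fin 2 → Fin 3 → ℤ := ![![-1, 2, 2], ![-1, 1, 2]]

/-- The integer distances of the planes of `ABD`, `BCD` from the origin. -/
def heightTwo : Fin 2 → ℤ := ![2, 1]

/-- The integer covectors of the planes of `ABD`, `BDE`, `BCE`, `CED`. -/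
def covFour (a : ℤ) : Fin 4 → Fin 3 → ℤ :=
  ![![-1, 2, a + 2], ![-1, 1, a + 2], ![-1, 1, 2], ![-1, 1 - a, 2 * a + 2]]

/-- The integer distances of the planes of `ABD`, `BDE`, `BCE`, `CED` from the origin. -/
def heightFour (a : ℤ) : Fin 4 → ℤ := ![a + 2, a + 1, 1, 1]

/-- The triangle opposite to a vertex, and the translation bringing it to one of the four. -/
def nbrFour : Fin 4 → Fin 3 → Fin 4 × ℤ × ℤ :=
  ![![(1, 0, 0), (2, 0, 1), (3, 1, 0)], ![(3, 0, 0), (2, 0, 0), (0, 0, 0)],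
    ![(3, 0, 0), (1, 0, 0), (0, 0, -1)], ![(1, 0, 0), (0, -1, 0), (2, 0, 0)]]

/-- The triangle opposite to a vertex, and the translation bringing it to one of the two. -/
def nbrTwo : Fin 2 → Fin 3 → Fin 2 × ℤ × ℤ :=
  ![![(1, 0, 0), (1, 0, 1), (1, 1, 0)], ![(0, -1, 0), (0, 0, 0), (0, 0, -1)]]

namespace IsSpectrum

variable {a : ℤ} {r : Fin 3 → ℝ} (h : IsSpectrum a r)
include h

theorem sign_covFour (ha : 0 ≤ a) (t : Fin 4) :
    0 < covFour a t 0 + covFour a t 1 * r 0 + covFour a t 2 * r 0 ^ 2 ∧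
    covFour a t 0 + covFour a t 1 * r 1 + covFour a t 2 * r 1 ^ 2 < 0 ∧
    0 < covFour a t 0 + covFour a t 1 * r 2 + covFour a t 2 * r 2 ^ 2 := by
  have b0 := h.lt_zero
  have b1 := h.one_neg ha
  have b1' := h.neg_one_lt_one ha
  have b1'' := h.lt_one
  have b2 := h.lt_two
  have hA : (0 : ℝ) ≤ a := by exact_mod_cast ha
  have s0 : 0 ≤ (a : ℝ) * r 0 ^ 2 := by positivity
  have s2 : 0 ≤ (a : ℝ) * r 2 ^ 2 := by positivity
  have s1 : (a + 1 : ℝ) * r 1 ^ 2 < - r 1 := by nlinarith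
  fin_cases t <;> simp [covFour]
  · refine ⟨by nlinarith, by nlinarith, by nlinarith⟩
  · refine ⟨by nlinarith, by nlinarith, by nlinarith⟩
  · refine ⟨by nlinarith, by nlinarith, by nlinarith⟩
  · refine ⟨?_, ?_, ?_⟩
    · have e : -1 + (1 - a) * r 0 + (2 * a + 2) * r 0 ^ 2 =
          (1 - 2 * r 0) * (-(a + 1) * r 0 - 1) := by ring
      rw [e]
      exact mul_pos (by linarith) (by nlinarith)
    · have e : -1 + (1 - a) * r 1 + (2 * a + 2) * r 1 ^ 2 =
          -((1 - 2 * r 1) * ((a + 1) * r 1 + 1)) := by ring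
      rw [e, neg_lt_zero]
      exact mul_pos (by linarith) (by linarith)
    · have e : -1 + (1 - a) * r 2 + (2 * a + 2) * r 2 ^ 2 =
          (2 * r 2 - 1) * ((a + 1) * r 2 + 1) := by ring
      rw [e]
      exact mul_pos (by linarith) (by nlinarith)

/-- Positivity and integrality give only the bound 1, which suffices for BCE and CED. The form of
BDE is that of BCE plus `a * z`, used for `z ≥ 1`, or that of CED plus `a * (y - z)`, used for `z ≤
0`, where `y + z ≥ 1` yields `y - z ≥ 1`. The form of ABD is `-x + 2 * y + z` plus `(a + 1) * z`, or
the form of BDE plus `y`. -/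
theorem le_covFour (ha : 0 ≤ a) (x y z : ℤ) (hp : ∀ i, 0 ≤ ell r i (pt x y z))
    (hne : pt x y z ≠ 0) : a + 2 ≤ -x + 2 * y + (a + 2) * z ∧ a + 1 ≤ -x + y + (a + 2) * z ∧
      1 ≤ -x + y + 2 * z ∧ 1 ≤ -x + (1 - a) * y + (2 * a + 2) * z := by
  have b0 := h.lt_zero
  have b1 := h.one_neg ha
  have b1' := h.neg_one_lt_one ha
  have b2 := h.lt_two
  have c1 : 1 ≤ (-1) * x + 1 * y + 2 * z :=
    h.one_le_intForm ha (c := covFour a 2) (h.sign_covFour ha 2).1 (h.sign_covFour ha 2).2.1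
      (h.sign_covFour ha 2).2.2 hp hne
  have c2 : 1 ≤ (-1) * x + (1 - a) * y + (2 * a + 2) * z :=
    h.one_le_intForm ha (c := covFour a 3) (h.sign_covFour ha 3).1 (h.sign_covFour ha 3).2.1
      (h.sign_covFour ha 3).2.2 hp hne
  have c3 : 1 ≤ 0 * x + 1 * y + 1 * z :=
    h.one_le_intForm ha (c := ![0, 1, 1]) (by simp; nlinarith) (by simp; nlinarith)
      (by simp; nlinarith) hp hne
  have c4 : 1 ≤ (-1) * x + 2 * y + 1 * z :=
    h.one_le_intForm ha (c := ![-1, 2, 1]) (by simp; nlinarith) (by simp; nlinarith)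
      (by simp; nlinarith) hp hne
  have d2 : a + 1 ≤ -x + y + (a + 2) * z := by
    rcases le_or_gt 1 z with hz | hz
    · nlinarith
    · have : z + 1 ≤ y := by omega
      nlinarith
  refine ⟨?_, d2, by linarith, by linarith⟩
  rcases le_or_gt 1 z with hz | hz
  · nlinarith
  · have : 1 ≤ y := by omega
    linarith

/-- Strict positivity of `a` is what makes the edges BE, CE, DE bend: for `a = 0` the last three
covectors coincide. -/
theorem isFundamentalData_four (ha : 0 < a) :
    IsFundamentalData a r labFour (covFour a) (heightFour a) where
  pos t := by fin_cases t <;> simp [heightFour] <;> omega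
  sign_zero t := (h.sign_covFour ha.le t).1
  sign_one t := (h.sign_covFour ha.le t).2.1
  sign_two t := (h.sign_covFour ha.le t).2.2
  le t x y z hp hne := by
    obtain ⟨h0, h1, h2, h3⟩ := h.le_covFour ha.le x y z hp hne
    fin_cases t <;> simp [heightFour, covFour] <;> linarith
  height t k := by
    fin_cases t <;> fin_cases k <;>
      simp [labFour, covFour, heightFour, vert_A, vert_B, vert_C, vert_D, vert_E, intForm_pt,
        ptA, ptB, ptC, ptD, ptE] <;> ring
  adjacent t k := by
    have hA : (0 : ℝ) < a := by exact_mod_cast ha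
    refine ⟨(nbrFour t k).1, (nbrFour t k).2, fun l hl => ?_, ?_⟩
    · fin_cases t <;> fin_cases k <;> fin_cases l <;> simp at hl <;>
        simp [nbrFour, shift, labFour, covFour, heightFour, vert_A, vert_B, vert_C, vert_D, vert_E,
          intForm_pt, ptA, ptB, ptC, ptD, ptE] <;> ring
    · fin_cases t <;> fin_cases k <;>
        simp [nbrFour, shift, labFour, covFour, heightFour, vert_A, vert_B, vert_C, vert_D, vert_E,
          vert_XD, vert_YB, vert_E_left, vert_E_right, intForm_pt, ptA, ptB, ptC, ptD, ptE] <;>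
        nlinarith
  indep t := by
    have hA : (0 : ℝ) < a := by exact_mod_cast ha
    apply linearIndependent_of_det_ne_zero
    rw [Matrix.det_fin_three]
    fin_cases t <;> simp [labFour, vert_A, vert_B, vert_C, vert_D, vert_E,
        ptA, ptB, ptC, ptD, ptE, pt_apply_zero, pt_apply_one, pt_apply_two] <;> ring_nf
    all_goals first | (apply ne_of_lt; linarith) | (apply ne_of_gt; linarith)

theorem isFundamentalData_two (ha : a = 0) :
    IsFundamentalData a r labTwo covTwo heightTwo where
  pos t := by fin_cases t <;> simp [heightTwo]
  sign_zero t := by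
    subst ha
    fin_cases t
    · simpa [covTwo, covFour] using (h.sign_covFour le_rfl 0).1
    · simpa [covTwo, covFour] using (h.sign_covFour le_rfl 2).1
  sign_one t := by
    subst ha
    fin_cases t
    · simpa [covTwo, covFour] using (h.sign_covFour le_rfl 0).2.1
    · simpa [covTwo, covFour] using (h.sign_covFour le_rfl 2).2.1
  sign_two t := by
    subst ha
    fin_cases t
    · simpa [covTwo, covFour] using (h.sign_covFour le_rfl 0).2.2
    · simpa [covTwo, covFour] using (h.sign_covFour le_rfl 2).2.2
  le t x y z hp hne := by
    subst ha
    obtain ⟨h0, h1, h2, h3⟩ := h.le_covFour le_rfl x y z hp hne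
    fin_cases t <;> simp [heightTwo, covTwo] <;> linarith
  height t k := by
    subst ha
    fin_cases t <;> fin_cases k <;>
      simp [labTwo, covTwo, heightTwo, vert_A, vert_B, vert_C, vert_D, intForm_pt,
        ptA, ptB, ptC, ptD]
  adjacent t k := by
    subst ha
    refine ⟨(nbrTwo t k).1, (nbrTwo t k).2, fun l hl => ?_, ?_⟩
    · fin_cases t <;> fin_cases k <;> fin_cases l <;> simp at hl <;>
        simp [nbrTwo, shift, labTwo, covTwo, heightTwo, vert_A, vert_B, vert_C, vert_D,
          intForm_pt, ptA, ptB, ptC, ptD]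
    · fin_cases t <;> fin_cases k <;>
        simp [nbrTwo, shift, labTwo, covTwo, heightTwo, vert_A, vert_C,
          vert_XD, vert_YB, vert_B_left, vert_D_right, intForm_pt, ptA, ptC] <;>
        norm_num
  indep t := by
    subst ha
    apply linearIndependent_of_det_ne_zero
    rw [Matrix.det_fin_three]
    fin_cases t <;> simp [labTwo, vert_A, vert_B, vert_C, vert_D,
        ptA, ptB, ptC, ptD, pt_apply_zero, pt_apply_one, pt_apply_two]
    norm_num

end IsSpectrum
-- Operators commuting with `opA a` and the sail
/-- The operator as a linear automorphism. -/
noncomputable def actEquiv (g : SL3Z) : E3 ≃ₗ[ℝ] E3 :=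
  LinearEquiv.ofLinearMap (act g) (act g⁻¹) (LinearMap.ext fun p => act_act_inv g p)
    (LinearMap.ext fun p => act_inv_act g p)

/-- The operator as a homeomorphism. -/
noncomputable def actHomeo (g : SL3Z) : E3 ≃ₜ E3 :=
  (actEquiv g).toContinuousLinearEquiv.toHomeomorph

theorem coe_actHomeo (g : SL3Z) : (actHomeo g : E3 → E3) = act g := rfl

theorem act_injective {g g' : SL3Z} (hg : ∀ p, act g p = act g' p) : g = g' := by
  apply Subtype.ext
  ext i j
  have h1 := congrArg (fun p : E3 => p i) (hg (EuclideanSpace.single j 1))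
  simp only [act_apply] at h1
  have h2 : (g i j : ℝ) = g' i j := by
    fin_cases j <;> simpa using h1
  exact_mod_cast h2

theorem image_generators {g : SL3Z} {O : Set E3} (hg : act g '' O = O) :
    act g '' generators O = generators O := by
  have hcl : act g '' closure O = closure O := by
    rw [← coe_actHomeo, Homeomorph.image_closure, coe_actHomeo, hg]
  have hsub : ∀ g : SL3Z, act g '' closure O = closure O → act g '' generators O ⊆ generators O := by
    rintro g hcl _ ⟨p, ⟨⟨hp, hpi⟩, hp0⟩, rfl⟩
    refine ⟨⟨hcl ▸ Set.mem_image_of_mem _ hp, act_mem_integerPoints g hpi⟩, fun h0 => hp0 ?_⟩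
    rw [Set.mem_singleton_iff] at h0 ⊢
    rw [← act_inv_act g p, h0, map_zero]
  have hcl' : act g⁻¹ '' closure O = closure O := by
    conv_lhs => rw [← hcl]
    rw [← Set.image_comp]
    convert Set.image_id _ using 2
    funext p
    exact act_inv_act g p
  refine Set.Subset.antisymm (hsub g hcl) (fun p hp => ⟨act g⁻¹ p, ?_, act_act_inv g p⟩)
  exact hsub g⁻¹ hcl' ⟨p, hp, rfl⟩

theorem image_sailHull {g : SL3Z} {O : Set E3} (hg : act g '' O = O) :
    act g '' sailHull O = sailHull O := by
  show act g '' convexHull ℝ (generators O) = convexHull ℝ (generators O)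
  rw [LinearMap.image_convexHull, image_generators hg]

theorem image_sail {g : SL3Z} {O : Set E3} (hg : act g '' O = O) : act g '' sail O = sail O := by
  rw [sail, ← coe_actHomeo, Homeomorph.image_frontier, coe_actHomeo, image_sailHull hg]

/-- An operator commuting with `A_{m,n}` multiplies every eigenform by its value at the image
of `(0, 0, 1)`. -/
theorem IsSpectrum.isEigenform_of_commute {a : ℤ} {r : Fin 3 → ℝ} (h : IsSpectrum a r) {g : SL3Z}
    (hg : Commute g (opA a)) (i : Fin 3) : IsEigenform (ell r i) g (ell r i (act g ptA)) := by
  -- This difference is multiplied by `r i` under `opA a` and vanishes at A. Hence it vanishes on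
  -- the images of A under powers of `opA a`, which span the space.
  let f : E3 →ₗ[ℝ] ℝ := ell r i ∘ₗ act g - ell r i (act g ptA) • ell r i
  have hf : ∀ p, f p = ell r i (act g p) - ell r i (act g ptA) * ell r i p := fun p => rfl
  have hM : ∀ p, f (act (opA a) p) = r i * f p := fun p => by
    rw [hf, hf, ← act_mul_apply, hg.eq, act_mul_apply, h.eigenform_opA i, h.eigenform_opA i]
    ring
  have h2 : f (pt 0 0 1) = 0 := by
    rw [hf, ← ptA, ell_ptA]; ring
  have h1 : f (pt 0 1 (-(2 * a + 3))) = 0 := by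
    have h3 := hM (pt 0 0 1)
    rwa [act_opA_pt, h2, show 0 + a * 0 - (2 * a + 3) * 1 = -(2 * a + 3) by ring, mul_zero] at h3
  have h0 := hM (pt 0 1 (-(2 * a + 3)))
  rw [act_opA_pt, h1, mul_zero] at h0
  have key : ∀ p : E3, f p = p 0 * f (pt 1 0 0) + p 1 * f (pt 0 1 0) + p 2 * f (pt 0 0 1) := by
    intro p
    rw [← smul_eq_mul, ← smul_eq_mul, ← smul_eq_mul, ← map_smul, ← map_smul, ← map_smul,
      ← map_add, ← map_add]
    congr 1
    refine ext_three ?_ ?_ ?_ <;> simp [pt_apply_zero, pt_apply_one, pt_apply_two]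
  rw [key] at h1 h0
  simp only [h2, pt_apply_zero, pt_apply_one, Int.cast_zero, Int.cast_one, one_mul, mul_zero,
    zero_mul, zero_add, add_zero] at h1 h0
  rw [h1, mul_zero, add_zero] at h0
  intro p
  have h3 := key p
  rw [h0, h1, h2, hf] at h3
  linarith

theorem IsSpectrum.image_orthant {a : ℤ} {r : Fin 3 → ℝ} (h : IsSpectrum a r) {g : SL3Z}
    (hg : Commute g (opA a)) (hA : act g ptA ∈ orthant r) : act g '' orthant r = orthant r := by
  refine Set.Subset.antisymm ?_ (fun p hp => ⟨act g⁻¹ p, ?_, act_act_inv g p⟩)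
  · rintro _ ⟨p, hp, rfl⟩
    exact mem_orthant_of_eigenform (h.isEigenform_of_commute hg) hA hp
  · exact mem_orthant_of_eigenform (fun i => (h.isEigenform_of_commute hg i).inv (hA i).ne')
      (fun i => inv_pos.2 (hA i)) hp

theorem cell_singleton {Λ V : Type} [AddCommGroup V] [Module ℝ V] (P : Λ → V) (v : Λ) :
    cell P {v} = {P v} := by
  simp [cell]

theorem cell_pair {Λ V : Type} [DecidableEq Λ] [AddCommGroup V] [Module ℝ V] (P : Λ → V)
    (v w : Λ) : cell P {v, w} = segment ℝ (P v) (P w) := by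
  simp [cell, Set.image_pair]

theorem cell_triple {Λ V : Type} [DecidableEq Λ] [AddCommGroup V] [Module ℝ V] (P : Λ → V)
    (u v w : Λ) : cell P {u, v, w} = tri (P u) (P v) (P w) := by
  simp [cell, tri, Set.image_insert_eq]

theorem image_cell_vert (a : ℤ) (q : ℤ × ℤ) (σ : Finset Label) :
    act (latOp a q) '' cell (vert a) σ = cell (vert a) (σ.image (shift q)) := by
  unfold cell
  rw [LinearMap.image_convexHull, ← Set.image_comp, Finset.coe_image, ← Set.image_comp]
  congr 1
  exact Set.image_congr (fun v _ => act_latOp_vert a q v)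

/-! ### The period group and the classes of faces -/

/-- Representatives `Sch k` of the `k`-dimensional simplices of a periodic triangulation. -/
structure IsScheme {T : Type} (lab : T → Fin 3 → Label) (Sch : ℕ → Finset (Finset Label)) :
    Prop where
  base : ∃ t k, lab t k = (false, 0, 0)
  simplex : ∀ k, ∀ σ ∈ Sch k, ∃ t, ∃ s : Finset (Fin 3), s.card = k + 1 ∧ σ = s.image (lab t)
  exists_mem : ∀ t (s : Finset (Fin 3)), s.Nonempty →
    ∃ σ ∈ Sch (s.card - 1), ∃ q, s.image (lab t) = σ.image (shift q)
  unique : ∀ k, ∀ σ ∈ Sch k, ∀ σ' ∈ Sch k, ∀ v ∈ σ, ∀ w ∈ σ',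
    σ' = σ.image (shift (w.2 - v.2)) → σ = σ'

/-- The cells of a scheme. -/
def schemeCells {V : Type} [AddCommGroup V] [Module ℝ V] (P : Label → V)
    (Sch : ℕ → Finset (Finset Label)) (k : ℕ) : Set (Set V) :=
  (fun σ => cell P σ) '' (Sch k : Set (Finset Label))

theorem image_shiftVtx {T : Type} (lab : T → Fin 3 → Label) (t : T) (q : ℤ × ℤ)
    (s : Finset (Fin 3)) : s.image (shiftVtx lab (t, q)) = (s.image (lab t)).image (shift q) := by
  rw [Finset.image_image]
  rfl

section Group

variable {T : Type} [Finite T] [Nonempty T] {a : ℤ} (ha : 0 ≤ a) {r : Fin 3 → ℝ}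
  (h : IsSpectrum a r) {lab : T → Fin 3 → Label} {f : T → Fin 3 → ℤ} {d : T → ℤ}
  (hF : IsFundamentalData a r lab f d)
  {Sch : ℕ → Finset (Finset Label)} (hS : IsScheme lab Sch)
include ha h

theorem image_latOp_orthant (q : ℤ × ℤ) : act (latOp a q) '' orthant r = orthant r :=
  h.image_orthant (commute_opA_latOp a q).symm
    (h.act_latOp_mem_orthant ha q (ptA_mem_orthant r))

theorem latOp_mem_periodGroup (q : ℤ × ℤ) : latOp a q ∈ periodGroup (opA a) (orthant r) :=
  ⟨(commute_opA_latOp a q).symm.eq, image_sail (image_latOp_orthant ha h q)⟩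

include hF hS

/-- The point A is extreme in the hull and lies on the sail, so the same holds for its image, which
is therefore some vertex. Undoing the translation leaves a commuting operator that maps A to A or to
E. -/
theorem exists_eq_latOp {g : SL3Z} (hg : g ∈ periodGroup (opA a) (orthant r)) :
    ∃ q, g = latOp a q := by
  obtain ⟨hcom, hsail⟩ := hg
  have hC := hF.isConvexTriangulation ha h
  obtain ⟨t, k, htk⟩ := hS.base
  have hA : ptA = vert a (shiftVtx lab (t, 0) k) := by
    rw [shiftVtx, shift_zero, htk]
    exact (vert_A a).symm
  obtain ⟨hAe, hAs⟩ := hC.mem_extremePoints_iff.2 ⟨(t, 0), k, hA⟩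
  have hgs : act g ptA ∈ sail (orthant r) := hsail ▸ Set.mem_image_of_mem _ hAs
  have hgO : act g ptA ∈ orthant r := hC.hull_subset (hC.frontier_subset_hull hgs)
  have hhull := image_sailHull (h.image_orthant hcom hgO)
  have hge : act g ptA ∈ (sailHull (orthant r)).extremePoints ℝ := by
    have h1 : actEquiv g '' (sailHull (orthant r)).extremePoints ℝ =
        (actEquiv g '' sailHull (orthant r)).extremePoints ℝ := image_extremePoints _ _
    have h2 : (actEquiv g '' sailHull (orthant r)) = sailHull (orthant r) := hhull
    rw [h2] at h1
    exact h1 ▸ Set.mem_image_of_mem _ hAe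
  obtain ⟨τ, l, hl⟩ := hC.mem_extremePoints_iff.1 ⟨hge, hgs⟩
  obtain ⟨⟨c, q⟩, hv⟩ : ∃ v, act g ptA = vert a v := ⟨_, hl⟩
  have hcom' : Commute ((latOp a q)⁻¹ * g) (opA a) :=
    Commute.mul_left (commute_opA_latOp a q).symm.inv_left hcom
  have h3 : act ((latOp a q)⁻¹ * g) ptA = baseVertex c := by
    rw [act_mul_apply, hv, vert, act_inv_act]
  cases c
  · refine ⟨q, ?_⟩
    -- A commuting operator multiplies `ell r i` by the value of `ell r i` at the image of A, which
    -- is 1 here.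
    have h4 : (latOp a q)⁻¹ * g = 1 := by
      refine act_injective (fun p => h.ext_ell ha (fun i => ?_))
      rw [h.isEigenform_of_commute hcom', h3, act_one_apply]
      show ell r i ptA * _ = _
      rw [ell_ptA, one_mul]
    exact (inv_mul_eq_one.1 h4).symm
  · exact absurd h3 (act_ptA_ne_ptE ha hcom')

theorem periodGroup_eq_closure :
    periodGroup (opA a) (orthant r) = Subgroup.closure {opX a, opY a} := by
  refine le_antisymm (fun g hg => ?_) ((Subgroup.closure_le _).2 ?_)
  · obtain ⟨q, rfl⟩ := exists_eq_latOp ha h hF hS hg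
    exact latOp_mem_closure a q
  · rintro g (rfl | rfl)
    · have h1 := latOp_mem_periodGroup ha h (1, 0)
      simpa [latOp] using h1
    · have h1 := latOp_mem_periodGroup ha h (0, 1)
      simpa [latOp] using h1

omit hS in
theorem isFace_cell {t : T} {q : ℤ × ℤ} {s : Finset (Fin 3)} {k : ℕ} (hs : s.card = k + 1) :
    IsFace (orthant r) k (cell (vert a) ((s.image (lab t)).image (shift q))) := by
  have hC := hF.isConvexTriangulation ha h
  have hne : s.Nonempty := Finset.card_pos.1 (by omega)
  rw [← image_shiftVtx]
  refine ⟨?_, hC.cell_subset_frontier, hC.isExposed_cell, ?_⟩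
  · unfold cell
    rw [convexHull_nonempty_iff]
    exact Set.Nonempty.image _ (Finset.coe_nonempty.2 (hne.image _))
  · have := hC.finrank_vectorSpan_cell (τ := (t, q)) hne
    omega

theorem isFace_iff {k : ℕ} {F : Set E3} : IsFace (orthant r) k F ↔
    ∃ σ ∈ Sch k, ∃ q, F = cell (vert a) (σ.image (shift q)) := by
  have hC := hF.isConvexTriangulation ha h
  constructor
  · rintro ⟨hne, hsub, hexp, hdim⟩
    obtain ⟨⟨t, q⟩, s, hs, rfl⟩ := hC.exists_eq_cell hne hexp hsub
    have hcard := hC.finrank_vectorSpan_cell (τ := (t, q)) hs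
    rw [hdim] at hcard
    obtain ⟨σ, hσ, q', hq'⟩ := hS.exists_mem t s hs
    rw [← hcard, Nat.add_sub_cancel] at hσ
    refine ⟨σ, hσ, q' + q, ?_⟩
    rw [image_shiftVtx, hq', Finset.image_image]
    congr 2
    funext v
    exact shift_shift q q' v
  · rintro ⟨σ, hσ, q, rfl⟩
    obtain ⟨t, s, hs, rfl⟩ := hS.simplex k σ hσ
    exact isFace_cell ha h hF hs

omit hS in
-- A cell remembers its labels, since its vertices are extreme in the hull and distinct labels give
-- distinct vertices.
theorem subset_of_cell_subset {t t' : T} {q q' : ℤ × ℤ} {s s' : Finset (Fin 3)}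
    (hsub : cell (vert a) ((s.image (lab t)).image (shift q)) ⊆
      cell (vert a) ((s'.image (lab t')).image (shift q'))) :
    (s.image (lab t)).image (shift q) ⊆ (s'.image (lab t')).image (shift q') := by
  have hC := hF.isConvexTriangulation ha h
  rw [← image_shiftVtx, ← image_shiftVtx] at hsub ⊢
  intro v hv
  obtain ⟨k, hk, rfl⟩ := Finset.mem_image.1 hv
  refine hC.mem_of_vertex_mem_cell (hsub ?_)
  exact subset_convexHull ℝ _ ⟨_, hv, rfl⟩

theorem isFundamentalFamily :
    IsFundamentalFamily (opA a) (orthant r) (schemeCells (vert a) Sch) := by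
  have hz : ∀ σ : Finset Label, σ.image (shift 0) = σ := fun σ => by
    have : shift 0 = id := funext shift_zero
    rw [this, Finset.image_id]
  refine ⟨?_, ?_⟩
  · rintro k _ ⟨σ, hσ, rfl⟩
    refine (isFace_iff ha h hF hS).2 ⟨σ, hσ, 0, ?_⟩
    rw [hz]
  · intro k F hFace
    obtain ⟨σ, hσ, q, rfl⟩ := (isFace_iff ha h hF hS).1 hFace
    refine ⟨cell (vert a) σ, ⟨⟨σ, hσ, rfl⟩, latOp a q, latOp_mem_periodGroup ha h q,
      image_cell_vert a q σ⟩, ?_⟩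
    rintro _ ⟨⟨σ', hσ', rfl⟩, g, hg, hgF⟩
    obtain ⟨q', rfl⟩ := exists_eq_latOp ha h hF hS hg
    simp only [image_cell_vert] at hgF
    congr 1
    obtain ⟨t, s, hs, rfl⟩ := hS.simplex k σ hσ
    obtain ⟨t', s', hs', rfl⟩ := hS.simplex k σ' hσ'
    have heq : (s'.image (lab t')).image (shift q') = (s.image (lab t)).image (shift q) :=
      Finset.Subset.antisymm (subset_of_cell_subset ha h hF hgF.subset)
        (subset_of_cell_subset ha h hF hgF.symm.subset)
    obtain ⟨k', hk'⟩ : s'.Nonempty := Finset.card_pos.1 (by omega)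
    have hv : lab t' k' ∈ s'.image (lab t') := Finset.mem_image_of_mem _ hk'
    have heq' : s.image (lab t) = (s'.image (lab t')).image (shift (q' - q)) := by
      have h1 := congrArg (fun σ => σ.image (shift (-q))) heq
      simp only [Finset.image_image] at h1
      have e1 : shift (-q) ∘ shift q = id := by
        funext v
        simp [shift_shift, shift_zero]
      have e2 : shift (-q) ∘ shift q' = shift (q' - q) := by
        funext v
        simp [shift_shift, sub_eq_add_neg]
      rw [← Function.comp_assoc, ← Function.comp_assoc, e1, e2] at h1
      rw [Finset.image_image, h1]
      rfl
    have hw : shift (q' - q) (lab t' k') ∈ s.image (lab t) := by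
      rw [heq']
      exact Finset.mem_image_of_mem _ hv
    -- The translation is the difference of the labels of one vertex and its image, which is the
    -- form needed by `unique`.
    refine hS.unique k _ hσ' _ hσ _ hv _ hw ?_
    simpa [shift] using heq'

end Group

/-! ### The quotient of the sail as the standard torus -/

/-- An integer vector of the plane. -/
def planeVec (q : ℤ × ℤ) : ℝ × ℝ := ((q.1 : ℝ), (q.2 : ℝ))

/-- The point of the model plane with the given label. -/
noncomputable def modelVert (v : Label) : ℝ × ℝ :=
  (bif v.1 then (2 / 3, 2 / 3) else (0, 0)) + planeVec v.2

theorem modelVert_shift (q : ℤ × ℤ) (v : Label) :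
    modelVert (shift q v) = modelVert v + planeVec q := by
  ext <;> simp [modelVert, shift, planeVec] <;> ring

theorem toTorus_add (z : ℝ × ℝ) (q : ℤ × ℤ) : toTorus (z + planeVec q) = toTorus z := by
  have h1 (x : ℝ) (n : ℤ) : ((x + n : ℝ) : UnitAddCircle) = x := by
    have : ((n : ℝ) : UnitAddCircle) = 0 := (AddCircle.coe_eq_zero_iff 1).2 ⟨n, by simp⟩
    rw [AddCircle.coe_add, this, add_zero]
  exact Prod.ext (h1 _ _) (h1 _ _)

theorem exists_eq_add_of_toTorus_eq {z z' : ℝ × ℝ} (hz : toTorus z = toTorus z') :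
    ∃ q, z = z' + planeVec q := by
  have h1 (x y : ℝ) (hxy : (x : UnitAddCircle) = y) : ∃ n : ℤ, x = y + n := by
    have : ((x - y : ℝ) : UnitAddCircle) = 0 := by rw [AddCircle.coe_sub, hxy, sub_self]
    obtain ⟨n, hn⟩ := (AddCircle.coe_eq_zero_iff 1).1 this
    refine ⟨n, ?_⟩
    simp at hn
    linarith
  obtain ⟨m, hm⟩ := h1 _ _ (congrArg Prod.fst hz)
  obtain ⟨n, hn⟩ := h1 _ _ (congrArg Prod.snd hz)
  exact ⟨(m, n), Prod.ext hm hn⟩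

theorem continuous_toTorus : Continuous toTorus :=
  ((AddCircle.continuous_mk' 1).comp continuous_fst).prodMk
    ((AddCircle.continuous_mk' 1).comp continuous_snd)

/-- The piecewise linear map of the unit square onto the fundamental region of the sail. -/
noncomputable def squareMap (a : ℤ) (z : ℝ × ℝ) : E3 :=
  ptA + z.1 • (ptD a - ptA) + z.2 • (ptB - ptA) +
    max 0 (z.1 + z.2 - 1) • (ptC - ptB - ptD a + ptA) +
    (3 * max 0 (min (1 - z.1) (min (1 - z.2) (z.1 + z.2 - 1)))) •
      (ptE - (1 / 3 : ℝ) • (ptB + ptC + ptD a))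

/-- The periodic extension of the previous map. -/
noncomputable def planeMap (a : ℤ) (z : ℝ × ℝ) : E3 :=
  act (latOp a (⌊z.1⌋, ⌊z.2⌋)) (squareMap a (Int.fract z.1, Int.fract z.2))

theorem planeMap_add (a : ℤ) (z : ℝ × ℝ) (q : ℤ × ℤ) :
    planeMap a (z + planeVec q) = act (latOp a q) (planeMap a z) := by
  rw [planeMap, planeMap, ← act_mul_apply, ← latOp_add]
  have h1 : q + (⌊z.1⌋, ⌊z.2⌋) = (⌊(z + planeVec q).1⌋, ⌊(z + planeVec q).2⌋) := by
    ext <;> simp [planeVec, add_comm]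
  rw [h1]
  simp [planeVec]

theorem squareMap_of_mem_lower (a : ℤ) {z : ℝ × ℝ} (hz : z.1 + z.2 ≤ 1) :
    squareMap a z = ptA + z.1 • (ptD a - ptA) + z.2 • (ptB - ptA) := by
  have h1 : max 0 (z.1 + z.2 - 1) = 0 := max_eq_left (by linarith)
  have h2 : max 0 (min (1 - z.1) (min (1 - z.2) (z.1 + z.2 - 1))) = 0 :=
    max_eq_left ((min_le_right _ _).trans ((min_le_right _ _).trans (by linarith)))
  rw [squareMap, h1, h2]
  simp

/-- The numbers 1 - z.1, 1 - z.2, z.1 + z.2 - 1 are the barycentric coordinates on B'C'D' at B', D',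
C'. Three times their minimum is the tent that is 0 on the sides and 1 at E'; it lifts the centroid
of BCD to E. -/
theorem squareMap_of_mem_upper (a : ℤ) {z : ℝ × ℝ} (hz : 1 ≤ z.1 + z.2) {m : ℝ} (h0 : 0 ≤ m)
    (hm : min (1 - z.1) (min (1 - z.2) (z.1 + z.2 - 1)) = m) :
    squareMap a z = ptC + (1 - z.1) • (ptB - ptC) + (1 - z.2) • (ptD a - ptC) +
      (3 * m) • (ptE - (1 / 3 : ℝ) • (ptB + ptC + ptD a)) := by
  have h1 : max 0 (z.1 + z.2 - 1) = z.1 + z.2 - 1 := max_eq_right (by linarith)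
  rw [squareMap, h1, hm, max_eq_right h0]
  module

theorem squareMap_glue_left (a : ℤ) {y : ℝ} (hy : y ∈ Set.Icc (0 : ℝ) 1) :
    act (opX a) (squareMap a (0, y)) = squareMap a (1, y) := by
  rw [squareMap_of_mem_lower a (by simpa using hy.2), squareMap_of_mem_upper a (m := 0)
    (by simpa using hy.1) le_rfl]
  · simp only [map_add, map_smul, map_sub, act_opX_ptA, act_opX_ptB, zero_smul, add_zero]
    module
  · simp only [sub_self]
    exact min_eq_left (le_min (by linarith [hy.2]) (by linarith [hy.1]))

theorem squareMap_glue_right (a : ℤ) {x : ℝ} (hx : x ∈ Set.Icc (0 : ℝ) 1) :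
    act (opY a) (squareMap a (x, 0)) = squareMap a (x, 1) := by
  rw [squareMap_of_mem_lower a (by simpa using hx.2), squareMap_of_mem_upper a (m := 0)
    (by simpa using hx.1) le_rfl]
  · simp only [map_add, map_smul, map_sub, act_opY_ptA, act_opY_ptD, zero_smul, add_zero]
    module
  · simp only [sub_self]
    rw [min_eq_left (a := (0 : ℝ)) (by linarith [hx.1]), min_eq_right (by linarith [hx.2])]

/-- Only the sides with a coordinate equal to 1 need an argument: there the floor is 1, and the
gluing of opposite sides by X and Y applies. -/
theorem planeMap_eq_squareMap (a : ℤ) {z : ℝ × ℝ} (h1 : z.1 ∈ Set.Icc (0 : ℝ) 1)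
    (h2 : z.2 ∈ Set.Icc (0 : ℝ) 1) : planeMap a z = squareMap a z := by
  obtain ⟨x, y⟩ := z
  simp only at h1 h2
  have hfl (t : ℝ) (ht : t ∈ Set.Icc (0 : ℝ) 1) :
      (⌊t⌋ = 0 ∧ Int.fract t = t) ∨ (t = 1 ∧ ⌊t⌋ = 1 ∧ Int.fract t = 0) := by
    rcases ht.2.lt_or_eq with h | h
    · exact Or.inl ⟨Int.floor_eq_zero_iff.2 ⟨ht.1, h⟩, Int.fract_eq_self.2 ⟨ht.1, h⟩⟩
    · subst h
      exact Or.inr ⟨rfl, Int.floor_one, Int.fract_one⟩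
  have hX : latOp a (1, 0) = opX a := by simp [latOp]
  have hY : latOp a (0, 1) = opY a := by simp [latOp]
  have hXY : latOp a (1, 1) = opX a * opY a := by simp [latOp]
  have h0 : (0 : ℝ) ∈ Set.Icc (0 : ℝ) 1 := ⟨le_rfl, zero_le_one⟩
  have h01 : (1 : ℝ) ∈ Set.Icc (0 : ℝ) 1 := ⟨zero_le_one, le_rfl⟩
  rw [planeMap]
  simp only
  rcases hfl x h1 with ⟨e1, e2⟩ | ⟨rfl, e1, e2⟩ <;> rcases hfl y h2 with ⟨e3, e4⟩ | ⟨rfl, e3, e4⟩ <;>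
    simp only [e1, e2, e3, e4]
  · rw [show ((0, 0) : ℤ × ℤ) = 0 from rfl, latOp_zero, act_one_apply]
  · rw [hY, squareMap_glue_right a h1]
  · rw [hX, squareMap_glue_left a h2]
  · rw [hXY, act_mul_apply, squareMap_glue_right a h0, squareMap_glue_left a h01]

/-- The model triangles tile the unit square, and `squareMap` maps them affinely onto the
triangles of the sail. -/
structure IsSquareTiling {T : Type} (a : ℤ) (lab : T → Fin 3 → Label) : Prop where
  map_eq : ∀ t (b : Fin 3 → ℝ), (∀ k, 0 ≤ b k) → ∑ k, b k = 1 →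
    squareMap a (∑ k, b k • modelVert (lab t k)) = ∑ k, b k • vert a (lab t k)
  mem : ∀ t k, (modelVert (lab t k)).1 ∈ Set.Icc (0 : ℝ) 1 ∧
    (modelVert (lab t k)).2 ∈ Set.Icc (0 : ℝ) 1
  exists_eq : ∀ z : ℝ × ℝ, z.1 ∈ Set.Icc (0 : ℝ) 1 → z.2 ∈ Set.Icc (0 : ℝ) 1 →
    ∃ t, ∃ b : Fin 3 → ℝ, (∀ k, 0 ≤ b k) ∧ ∑ k, b k = 1 ∧ z = ∑ k, b k • modelVert (lab t k)

section Torus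

variable {T : Type} [Finite T] [Nonempty T] {a : ℤ} (ha : 0 ≤ a) {r : Fin 3 → ℝ}
  (h : IsSpectrum a r) {lab : T → Fin 3 → Label} {f : T → Fin 3 → ℤ} {d : T → ℤ}
  (hF : IsFundamentalData a r lab f d)

/-- The developing map of the sail to the model plane. -/
noncomputable def develop : E3 → ℝ × ℝ :=
  (hF.isConvexTriangulation ha h).piecewiseLinear modelVert

include ha h hF

theorem develop_apply (t : T) (q : ℤ × ℤ) {b : Fin 3 → ℝ} (hb : ∀ k, 0 ≤ b k)
    (hb1 : ∑ k, b k = 1) :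
    act (latOp a q) (∑ k, b k • vert a (lab t k)) ∈ sail (orthant r) ∧
    develop ha h hF (act (latOp a q) (∑ k, b k • vert a (lab t k))) =
      ∑ k, b k • modelVert (lab t k) + planeVec q := by
  have hC := hF.isConvexTriangulation ha h
  have hp : act (latOp a q) (∑ k, b k • vert a (lab t k)) =
      ∑ k, b k • vert a (shiftVtx lab (t, q) k) := by
    rw [map_sum]
    refine Finset.sum_congr rfl (fun k _ => ?_)
    rw [map_smul, act_latOp_vert]
    rfl
  have hmem : ∑ k, b k • vert a (shiftVtx lab (t, q) k) ∈
      cell (vert a) (Finset.univ.image (shiftVtx lab (t, q))) := by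
    refine (convex_convexHull ℝ _).sum_mem (fun k _ => hb k) hb1 (fun k _ => ?_)
    exact subset_convexHull ℝ _ ⟨shiftVtx lab (t, q) k, by simp, rfl⟩
  rw [hp]
  refine ⟨hC.mem_frontier_iff.2 ⟨_, hmem⟩, ?_⟩
  rw [develop, hC.piecewiseLinear_eq _ hmem, map_sum]
  simp only [map_smul, hC.chart_vertex]
  have h1 : ∀ k, modelVert (shiftVtx lab (t, q) k) = modelVert (lab t k) + planeVec q :=
    fun k => modelVert_shift q _
  simp only [h1, smul_add, Finset.sum_add_distrib, ← Finset.sum_smul, hb1, one_smul]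

theorem exists_barycentric {p : E3} (hp : p ∈ sail (orthant r)) :
    ∃ t q, ∃ b : Fin 3 → ℝ, (∀ k, 0 ≤ b k) ∧ ∑ k, b k = 1 ∧
      p = act (latOp a q) (∑ k, b k • vert a (lab t k)) := by
  have hC := hF.isConvexTriangulation ha h
  obtain ⟨⟨t, q⟩, hτ⟩ := hC.mem_frontier_iff.1 hp
  have hτ' := hC.mem_triangle.1 hτ
  refine ⟨t, q, fun k => (hC.basis (t, q)).coord k p, hτ'.1, ?_, ?_⟩
  · rw [hC.sum_coord, hτ'.2]
  · conv_lhs => rw [← hC.sum_coord_smul (t, q) p]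
    rw [map_sum]
    refine Finset.sum_congr rfl (fun k _ => ?_)
    rw [map_smul, act_latOp_vert]
    rfl

theorem develop_act (q : ℤ × ℤ) {p : E3} (hp : p ∈ sail (orthant r)) :
    develop ha h hF (act (latOp a q) p) = develop ha h hF p + planeVec q := by
  obtain ⟨t, q', b, hb, hb1, rfl⟩ := exists_barycentric ha h hF hp
  rw [← act_mul_apply, ← latOp_add, (develop_apply ha h hF t _ hb hb1).2,
    (develop_apply ha h hF t _ hb hb1).2, add_assoc]
  congr 1
  ext <;> simp [planeVec, add_comm]

/-- This left inverse supplies injectivity modulo translations; continuity of `planeMap` is not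
needed. -/
theorem planeMap_develop (hQ : IsSquareTiling a lab) {p : E3} (hp : p ∈ sail (orthant r)) :
    planeMap a (develop ha h hF p) = p := by
  obtain ⟨t, q, b, hb, hb1, rfl⟩ := exists_barycentric ha h hF hp
  rw [(develop_apply ha h hF t _ hb hb1).2, planeMap_add]
  congr 1
  have hconv : ∑ k, b k • modelVert (lab t k) ∈
      Set.Icc (0 : ℝ) 1 ×ˢ Set.Icc (0 : ℝ) 1 :=
    ((convex_Icc 0 1).prod (convex_Icc 0 1)).sum_mem (fun k _ => hb k) hb1
      (fun k _ => hQ.mem t k)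
  rw [planeMap_eq_squareMap a hconv.1 hconv.2, hQ.map_eq t b hb hb1]

theorem continuous_develop :
    Continuous (fun x : sail (orthant r) => develop ha h hF x) :=
  (hF.isConvexTriangulation ha h).continuous_piecewiseLinear modelVert

/-- The untranslated triangles form a compact set that meets every orbit. -/
theorem compactSpace_sailQuotient : CompactSpace (SailQuotient (opA a) (orthant r)) := by
  have hC := hF.isConvexTriangulation ha h
  let K : Set E3 := ⋃ t, cell (vert a) (Finset.univ.image (shiftVtx lab (t, 0)))
  have hK : IsCompact K := isCompact_iUnion (fun t => isCompact_cell _ _)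
  have hKs : K ⊆ sail (orthant r) := Set.iUnion_subset (fun t => hC.cell_subset_frontier)
  have hK' : IsCompact {x : sail (orthant r) | (x : E3) ∈ K} := by
    rw [Subtype.isCompact_iff]
    convert hK
    ext p
    constructor
    · rintro ⟨x, hx, rfl⟩
      exact hx
    · exact fun hp => ⟨⟨p, hKs hp⟩, hp, rfl⟩
  refine ⟨?_⟩
  have hcont : Continuous (Quotient.mk (periodSetoid (opA a) (orthant r))) := continuous_quotient_mk'
  convert hK'.image hcont
  refine (Set.eq_univ_of_forall (fun y => ?_)).symm
  obtain ⟨⟨p, hp⟩, rfl⟩ := Quotient.exists_rep y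
  obtain ⟨t, q, b, hb, hb1, rfl⟩ := exists_barycentric ha h hF hp
  have hz := (develop_apply ha h hF t 0 hb hb1).1
  rw [latOp_zero, act_one_apply] at hz
  refine ⟨⟨_, hz⟩, ?_, ?_⟩
  · refine Set.mem_iUnion.2 ⟨t, ?_⟩
    show ∑ k, b k • vert a (lab t k) ∈ cell (vert a) (Finset.univ.image (shiftVtx lab (t, 0)))
    refine (convex_convexHull ℝ _).sum_mem (fun k _ => hb k) hb1 (fun k _ => ?_)
    refine subset_convexHull ℝ _ ⟨shiftVtx lab (t, 0) k, by simp, ?_⟩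
    rw [shiftVtx, shift_zero]
  · exact Quotient.sound ⟨latOp a q, latOp_mem_periodGroup ha h q, rfl⟩

variable {Sch : ℕ → Finset (Finset Label)} (hS : IsScheme lab Sch)

include hS in
theorem toTorus_develop_eq_iff (hQ : IsSquareTiling a lab) (x y : sail (orthant r)) :
    toTorus (develop ha h hF x) = toTorus (develop ha h hF y) ↔
      periodSetoid (opA a) (orthant r) x y := by
  constructor
  · intro hxy
    obtain ⟨q, hq⟩ := exists_eq_add_of_toTorus_eq hxy.symm
    refine ⟨latOp a q, latOp_mem_periodGroup ha h q, ?_⟩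
    rw [← planeMap_develop ha h hF hQ x.2, ← planeMap_add, ← hq, planeMap_develop ha h hF hQ y.2]
  · rintro ⟨g, hg, hgx⟩
    obtain ⟨q, rfl⟩ := exists_eq_latOp ha h hF hS hg
    rw [← hgx, develop_act ha h hF q x.2, toTorus_add]

include hS in
-- The developing map descends to a continuous bijection from a compact space to a Hausdorff one.
-- Surjectivity holds because the model triangles cover the unit square.
theorem exists_homeomorph (hQ : IsSquareTiling a lab) :
    ∃ e : SailQuotient (opA a) (orthant r) ≃ₜ StdTorus,
      ∀ x : sail (orthant r), e (Quotient.mk _ x) = toTorus (develop ha h hF x) := by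
  let F : SailQuotient (opA a) (orthant r) → StdTorus :=
    Quotient.lift (fun x : sail (orthant r) => toTorus (develop ha h hF x))
      (fun x y hxy => (toTorus_develop_eq_iff ha h hF hS hQ x y).2 hxy)
  have hcont : Continuous F :=
    (continuous_toTorus.comp (continuous_develop ha h hF)).quotient_lift _
  have hinj : Function.Injective F := by
    intro u v huv
    obtain ⟨x, rfl⟩ := Quotient.exists_rep u
    obtain ⟨y, rfl⟩ := Quotient.exists_rep v
    exact Quotient.sound ((toTorus_develop_eq_iff ha h hF hS hQ x y).1 huv)
  have hsurj : Function.Surjective F := by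
    rintro ⟨u, v⟩
    obtain ⟨x, rfl⟩ := QuotientAddGroup.mk_surjective u
    obtain ⟨y, rfl⟩ := QuotientAddGroup.mk_surjective v
    have h1 (x : ℝ) : Int.fract x ∈ Set.Icc (0 : ℝ) 1 :=
      ⟨Int.fract_nonneg x, (Int.fract_lt_one x).le⟩
    obtain ⟨t, b, hb, hb1, hz⟩ := hQ.exists_eq (Int.fract x, Int.fract y) (h1 x) (h1 y)
    obtain ⟨hp, hp'⟩ := develop_apply ha h hF t 0 hb hb1
    refine ⟨Quotient.mk _ ⟨_, hp⟩, ?_⟩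
    show toTorus (develop ha h hF _) = toTorus (x, y)
    rw [hp', toTorus_add, ← hz, ← toTorus_add _ (⌊x⌋, ⌊y⌋)]
    congr 1
    ext <;> simp [planeVec]
  have := compactSpace_sailQuotient ha h hF
  exact ⟨hcont.homeoOfEquivCompactToT2 (f := Equiv.ofBijective F ⟨hinj, hsurj⟩), fun x => rfl⟩

include hS in
-- The developing map carries each cell onto the model cell with the same labels, and translates
-- become equal in both quotients.
theorem homeomorphicDecompositions (hQ : IsSquareTiling a lab) :
    HomeomorphicDecompositions (sailTriangulation (opA a) (orthant r))
      (fun k => (fun c => toTorus '' c) '' schemeCells modelVert Sch k) := by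
  obtain ⟨e, he⟩ := exists_homeomorph ha h hF hS hQ
  have hC := hF.isConvexTriangulation ha h
  have key : ∀ k, ∀ σ ∈ Sch k, ∀ q, e '' (Quotient.mk (periodSetoid (opA a) (orthant r)) ''
      {x : sail (orthant r) | (x : E3) ∈ cell (vert a) (σ.image (shift q))}) =
        toTorus '' cell modelVert σ := by
    intro k σ hσ q
    obtain ⟨t, s, hs, rfl⟩ := hS.simplex k σ hσ
    have h1 := hC.piecewiseLinear_image_cell modelVert (t, 0) s
    rw [image_shiftVtx, show shift 0 = id from funext shift_zero, Finset.image_id] at h1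
    have hsub : cell (vert a) (s.image (lab t)) ⊆ sail (orthant r) := by
      have h2 := hC.cell_subset_frontier (τ := (t, 0)) (s := s)
      rwa [image_shiftVtx, show shift 0 = id from funext shift_zero, Finset.image_id] at h2
    rw [← h1]
    ext u
    constructor
    · rintro ⟨_, ⟨x, hx, rfl⟩, rfl⟩
      rw [Set.mem_ofPred_eq, ← image_cell_vert] at hx
      obtain ⟨p, hp, hpx⟩ := hx
      refine ⟨_, ⟨p, hp, rfl⟩, ?_⟩
      rw [he, ← hpx, develop_act ha h hF q (hsub hp), toTorus_add]
      rfl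
    · rintro ⟨_, ⟨p, hp, rfl⟩, rfl⟩
      have h3 : act (latOp a q) p ∈ sail (orthant r) := by
        rw [← image_sail (image_latOp_orthant ha h q)]
        exact Set.mem_image_of_mem _ (hsub hp)
      refine ⟨_, ⟨⟨act (latOp a q) p, h3⟩, ?_, rfl⟩, ?_⟩
      · rw [Set.mem_ofPred_eq, ← image_cell_vert]
        exact Set.mem_image_of_mem _ hp
      · rw [he, develop_act ha h hF q (hsub hp), toTorus_add]
        rfl
  refine ⟨e, fun k => ?_⟩
  ext c
  constructor
  · rintro ⟨_, ⟨F, hFace, rfl⟩, rfl⟩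
    obtain ⟨σ, hσ, q, rfl⟩ := (isFace_iff ha h hF hS).1 hFace
    exact ⟨_, ⟨σ, hσ, rfl⟩, (key k σ hσ q).symm⟩
  · rintro ⟨_, ⟨σ, hσ, rfl⟩, rfl⟩
    exact ⟨_, ⟨_, (isFace_iff ha h hF hS).2 ⟨σ, hσ, 0, rfl⟩, rfl⟩, key k σ hσ 0⟩

end Torus

/-! ### The two schemes and their tilings of the square -/

/-- The simplices `A`; `AB`, `AD`, `BD`; `ABD`, `BCD`. -/
def schTwo : ℕ → Finset (Finset Label)
  | 0 => {{(false, 0, 0)}}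
  | 1 => {{(false, 0, 0), (false, 0, 1)}, {(false, 0, 0), (false, 1, 0)},
      {(false, 0, 1), (false, 1, 0)}}
  | 2 => {{(false, 0, 0), (false, 0, 1), (false, 1, 0)},
      {(false, 0, 1), (false, 1, 1), (false, 1, 0)}}
  | _ => ∅

/-- The simplices `A`, `E`; `AB`, `AD`, `BD`, `BE`, `CE`, `DE`; `ABD`, `BDE`, `BCE`, `CED`. -/
def schFour : ℕ → Finset (Finset Label)
  | 0 => {{(false, 0, 0)}, {(true, 0, 0)}}
  | 1 => {{(false, 0, 0), (false, 0, 1)}, {(false, 0, 0), (false, 1, 0)},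
      {(false, 0, 1), (false, 1, 0)}, {(false, 0, 1), (true, 0, 0)},
      {(false, 1, 1), (true, 0, 0)}, {(false, 1, 0), (true, 0, 0)}}
  | 2 => {{(false, 0, 0), (false, 0, 1), (false, 1, 0)},
      {(false, 0, 1), (false, 1, 0), (true, 0, 0)}, {(false, 0, 1), (false, 1, 1), (true, 0, 0)},
      {(false, 1, 1), (true, 0, 0), (false, 1, 0)}}
  | _ => ∅

theorem schemeCells_schTwo {V : Type} [AddCommGroup V] [Module ℝ V] (P : Label → V) (k : ℕ) :
    schemeCells P schTwo k =
      schemeTwo (P (false, 0, 0)) (P (false, 0, 1)) (P (false, 1, 1)) (P (false, 1, 0)) k := by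
  unfold schemeCells
  match k with
  | 0 => simp [schTwo, schemeTwo, cell_singleton]
  | 1 => simp [schTwo, schemeTwo, cell_pair, Set.image_insert_eq]
  | 2 => simp [schTwo, schemeTwo, cell_triple, Set.image_insert_eq]
  | k + 3 => simp [schTwo, schemeTwo]

theorem schemeCells_schFour {V : Type} [AddCommGroup V] [Module ℝ V] (P : Label → V) (k : ℕ) :
    schemeCells P schFour k =
      schemeFour (P (false, 0, 0)) (P (false, 0, 1)) (P (false, 1, 1)) (P (false, 1, 0))
        (P (true, 0, 0)) k := by
  unfold schemeCells
  match k with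
  | 0 => simp [schFour, schemeFour, cell_singleton, Set.image_insert_eq]
  | 1 => simp [schFour, schemeFour, cell_pair, Set.image_insert_eq]
  | 2 => simp [schFour, schemeFour, cell_triple, Set.image_insert_eq]
  | k + 3 => simp [schFour, schemeFour]

-- All conditions reduce to finite checks: in `exists_mem` the translation can be taken with
-- coordinates 0 or 1, and in `unique` it is a difference of labels.
set_option maxRecDepth 100000 in
theorem isScheme_two : IsScheme labTwo schTwo where
  base := ⟨0, 0, rfl⟩
  simplex k := by
    match k with
    | 0 => decide
    | 1 => decide
    | 2 => decide
    | k + 3 => simp [schTwo]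
  exists_mem := by
    have h1 : ∀ t (s : Finset (Fin 3)), s.Nonempty → ∃ σ ∈ schTwo (s.card - 1),
        ∃ q ∈ ({(0, 0), (1, 0), (0, 1), (1, 1)} : Finset (ℤ × ℤ)),
          s.image (labTwo t) = σ.image (shift q) := by decide
    intro t s hs
    obtain ⟨σ, hσ, q, -, hq⟩ := h1 t s hs
    exact ⟨σ, hσ, q, hq⟩
  unique k := by
    match k with
    | 0 => decide
    | 1 => decide
    | 2 => decide
    | k + 3 => simp [schTwo]

set_option maxRecDepth 100000 in
theorem isScheme_four : IsScheme labFour schFour where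
  base := ⟨0, 0, rfl⟩
  simplex k := by
    match k with
    | 0 => decide
    | 1 => decide
    | 2 => decide
    | k + 3 => simp [schFour]
  exists_mem := by
    have h1 : ∀ t (s : Finset (Fin 3)), s.Nonempty → ∃ σ ∈ schFour (s.card - 1),
        ∃ q ∈ ({(0, 0), (1, 0), (0, 1), (1, 1)} : Finset (ℤ × ℤ)),
          s.image (labFour t) = σ.image (shift q) := by decide
    intro t s hs
    obtain ⟨σ, hσ, q, -, hq⟩ := h1 t s hs
    exact ⟨σ, hσ, q, hq⟩
  unique k := by
    match k with
    | 0 => decide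
    | 1 => decide
    | 2 => decide
    | k + 3 => simp [schFour]

theorem modelVert_A : modelVert (false, 0, 0) = (0, 0) := by simp [modelVert, planeVec]
theorem modelVert_B : modelVert (false, 0, 1) = (0, 1) := by simp [modelVert, planeVec]
theorem modelVert_C : modelVert (false, 1, 1) = (1, 1) := by simp [modelVert, planeVec]
theorem modelVert_D : modelVert (false, 1, 0) = (1, 0) := by simp [modelVert, planeVec]
theorem modelVert_E : modelVert (true, 0, 0) = (2 / 3, 2 / 3) := by simp [modelVert, planeVec]

theorem squareMap_ABD (a : ℤ) {b : Fin 3 → ℝ} (hb : ∀ k, 0 ≤ b k) (hb1 : b 0 + b 1 + b 2 = 1) :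
    squareMap a (b 0 • (0, 0) + b 1 • (0, 1) + b 2 • (1, 0)) =
      b 0 • ptA + b 1 • ptB + b 2 • ptD a := by
  have h0 := hb 0
  have hb0 : b 0 = 1 - b 1 - b 2 := by linarith
  rw [squareMap_of_mem_lower]
  · simp
    rw [hb0]
    module
  · simp
    linarith

theorem min_min_eq {x y z m : ℝ} (hx : m ≤ x) (hy : m ≤ y) (hz : m ≤ z)
    (h : x = m ∨ y = m ∨ z = m) : min x (min y z) = m := by
  refine le_antisymm ?_ (le_min hx (le_min hy hz))
  rcases h with h | h | h
  · exact (min_le_left _ _).trans h.le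
  · exact (min_le_right _ _).trans ((min_le_left _ _).trans h.le)
  · exact (min_le_right _ _).trans ((min_le_right _ _).trans h.le)

theorem isSquareTiling_two : IsSquareTiling 0 labTwo where
  map_eq t b hb hb1 := by
    rw [Fin.sum_univ_three] at hb1 ⊢
    rw [Fin.sum_univ_three]
    have h1 := hb 1
    fin_cases t
    · simp only [labTwo, Fin.zero_eta, Matrix.cons_val, modelVert_A, modelVert_B, modelVert_D,
        vert_A, vert_B, vert_D]
      exact squareMap_ABD 0 hb hb1
    · simp only [labTwo, Fin.mk_one, Matrix.cons_val, modelVert_C, modelVert_B, modelVert_D,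
        vert_C, vert_B, vert_D]
      have hb0 : b 0 = 1 - b 1 - b 2 := by linarith
      -- For `a = 0` the point E is the centroid of BCD, so the tent term disappears and the map is
      -- affine on B'C'D'.
      have hE : ptE - (1 / 3 : ℝ) • (ptB + ptC + ptD 0) = 0 := by
        refine ext_three ?_ ?_ ?_ <;>
          simp [ptB, ptC, ptD, ptE, pt_apply_zero, pt_apply_one, pt_apply_two] <;> norm_num
      rw [squareMap_of_mem_upper 0 _ _ rfl, hE]
      · simp
        rw [hb0]
        module
      · simp
        linarith
      · refine le_min ?_ (le_min ?_ ?_)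
        · simp; linarith [hb 0]
        · simp; linarith [hb 2]
        · simp; linarith
  mem t k := by
    fin_cases t <;> fin_cases k <;>
      simp [labTwo, modelVert_A, modelVert_B, modelVert_C, modelVert_D]
  exists_eq := by
    rintro ⟨x, y⟩ hx hy
    simp only at hx hy
    rcases le_or_gt (x + y) 1 with h | h
    · refine ⟨0, ![1 - x - y, y, x], ?_, ?_, ?_⟩
      · simp [Fin.forall_fin_succ]
        exact ⟨by linarith, hy.1, hx.1⟩
      · simp [Fin.sum_univ_three]
      · simp [Fin.sum_univ_three, labTwo, modelVert_A, modelVert_B, modelVert_D]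
    · refine ⟨1, ![1 - x, x + y - 1, 1 - y], ?_, ?_, ?_⟩
      · simp [Fin.forall_fin_succ]
        exact ⟨hx.2, by linarith, hy.2⟩
      · simp [Fin.sum_univ_three]
      · simp [Fin.sum_univ_three, labTwo, modelVert_C, modelVert_B, modelVert_D]

/-- The three triangles at E' are distinguished by which barycentric coordinate of B'C'D' is least,
and this least coordinate is one third of the weight of E'. -/
theorem isSquareTiling_four (a : ℤ) : IsSquareTiling a labFour where
  map_eq t b hb hb1 := by
    rw [Fin.sum_univ_three] at hb1 ⊢
    rw [Fin.sum_univ_three]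
    have h0 := hb 0
    have h1 := hb 1
    have h2 := hb 2
    have hb0 : b 0 = 1 - b 1 - b 2 := by linarith
    fin_cases t
    · simp only [labFour, Fin.zero_eta, Matrix.cons_val, modelVert_A, modelVert_B, modelVert_D,
        vert_A, vert_B, vert_D]
      exact squareMap_ABD a hb hb1
    · simp only [labFour, Fin.mk_one, Matrix.cons_val, modelVert_E, modelVert_B, modelVert_D,
        vert_E, vert_B, vert_D]
      rw [squareMap_of_mem_upper a (m := b 2 / 3) (by simp; linarith) (by linarith)
        (min_min_eq (by simp; linarith) (by simp; linarith) (by simp; linarith)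
          (Or.inr (Or.inr (by simp; linarith))))]
      simp
      rw [hb0]
      module
    · simp only [labFour, Fin.reduceFinMk, Matrix.cons_val, modelVert_E, modelVert_B, modelVert_C,
        vert_E, vert_B, vert_C]
      rw [squareMap_of_mem_upper a (m := b 2 / 3) (by simp; linarith) (by linarith)
        (min_min_eq (by simp; linarith) (by simp; linarith) (by simp; linarith)
          (Or.inr (Or.inl (by simp; linarith))))]
      simp
      rw [hb0]
      module
    · simp only [labFour, Fin.reduceFinMk, Matrix.cons_val, modelVert_E, modelVert_D, modelVert_C,
        vert_E, vert_D, vert_C]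
      rw [squareMap_of_mem_upper a (m := b 1 / 3) (by simp; linarith) (by linarith)
        (min_min_eq (by simp; linarith) (by simp; linarith) (by simp; linarith)
          (Or.inl (by simp; linarith)))]
      simp
      rw [hb0]
      module
  mem t k := by
    fin_cases t <;> fin_cases k <;>
      simp [labFour, modelVert_A, modelVert_B, modelVert_C, modelVert_D, modelVert_E] <;> norm_num
  exists_eq := by
    rintro ⟨x, y⟩ hx hy
    simp only at hx hy
    rcases le_or_gt (x + y) 1 with h | h
    · refine ⟨0, ![1 - x - y, y, x], ?_, ?_, ?_⟩
      · simp [Fin.forall_fin_succ]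
        exact ⟨by linarith, hy.1, hx.1⟩
      · simp [Fin.sum_univ_three]
      · simp [Fin.sum_univ_three, labFour, modelVert_A, modelVert_B, modelVert_D]
    · have hx' := hx.2
      have hy' := hy.2
      rcases le_total (x + y - 1) (1 - x) with h1 | h1
      · rcases le_total (x + y - 1) (1 - y) with h2 | h2
        · refine ⟨1, ![1 - x - (x + y - 1), 1 - y - (x + y - 1), 3 * (x + y - 1)], ?_, ?_, ?_⟩
          · simp [Fin.forall_fin_succ]
            refine ⟨?_, ?_, ?_⟩ <;> linarith
          · simp [Fin.sum_univ_three]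
            ring
          · simp [Fin.sum_univ_three, labFour, modelVert_B, modelVert_D, modelVert_E]
            constructor <;> ring
        · refine ⟨2, ![1 - x - (1 - y), x + y - 1 - (1 - y), 3 * (1 - y)], ?_, ?_, ?_⟩
          · simp [Fin.forall_fin_succ]
            refine ⟨?_, ?_, ?_⟩ <;> linarith
          · simp [Fin.sum_univ_three]
            ring
          · simp [Fin.sum_univ_three, labFour, modelVert_B, modelVert_C, modelVert_E]
            constructor <;> ring
      · rcases le_total (1 - x) (1 - y) with h2 | h2
        · refine ⟨3, ![x + y - 1 - (1 - x), 3 * (1 - x), 1 - y - (1 - x)], ?_, ?_, ?_⟩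
          · simp [Fin.forall_fin_succ]
            refine ⟨?_, ?_, ?_⟩ <;> linarith
          · simp [Fin.sum_univ_three]
            ring
          · simp [Fin.sum_univ_three, labFour, modelVert_C, modelVert_D, modelVert_E]
            constructor <;> ring
        · refine ⟨2, ![1 - x - (1 - y), x + y - 1 - (1 - y), 3 * (1 - y)], ?_, ?_, ?_⟩
          · simp [Fin.forall_fin_succ]
            refine ⟨?_, ?_, ?_⟩ <;> linarith
          · simp [Fin.sum_univ_three]
            ring
          · simp [Fin.sum_univ_three, labFour, modelVert_B, modelVert_C, modelVert_E]
            constructor <;> ring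

/-! ### Integer lengths, areas and distances -/

theorem sub_mem_integerPoints {p q : E3} (hp : p ∈ integerPoints) (hq : q ∈ integerPoints) :
    p - q ∈ integerPoints := fun i => by
  obtain ⟨m, hm⟩ := hp i
  obtain ⟨n, hn⟩ := hq i
  exact ⟨m - n, by simp [hm, hn]⟩

theorem add_mem_integerPoints {p q : E3} (hp : p ∈ integerPoints) (hq : q ∈ integerPoints) :
    p + q ∈ integerPoints := fun i => by
  obtain ⟨m, hm⟩ := hp i
  obtain ⟨n, hn⟩ := hq i
  exact ⟨m + n, by simp [hm, hn]⟩

theorem exists_intForm_eq (c : Fin 3 → ℤ) {p : E3} (hp : p ∈ integerPoints) :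
    ∃ k : ℤ, intForm c p = k := by
  obtain ⟨x, y, z, rfl⟩ := exists_eq_pt hp
  exact ⟨_, intForm_pt c x y z⟩

theorem one_le_abs_of_ne_zero {x : ℝ} (hx : ∃ k : ℤ, x = k) (h0 : x ≠ 0) : 1 ≤ |x| := by
  obtain ⟨k, rfl⟩ := hx
  have : k ≠ 0 := fun h => h0 (by simp [h])
  exact_mod_cast Int.one_le_abs this

/-- The covector measures positions along the line in units of `Q - P`, so distinct integer points
on it are at least one such unit apart. -/
theorem integerLength_eq_one {P Q : E3} (hP : P ∈ integerPoints) (hQ : Q ∈ integerPoints)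
    (c : Fin 3 → ℤ) (hc : intForm c (Q - P) = 1) : integerLength P Q = 1 := by
  have hne : P ≠ Q := by
    rintro rfl
    simp at hc
  have hleast : IsLeast {d | ∃ U ∈ integerPoints, ∃ V ∈ integerPoints,
      U ∈ line[ℝ, P, Q] ∧ V ∈ line[ℝ, P, Q] ∧ U ≠ V ∧ d = dist U V} (dist P Q) := by
    refine ⟨⟨P, hP, Q, hQ, left_mem_affineSpan_pair ℝ P Q, right_mem_affineSpan_pair ℝ P Q, hne,
      rfl⟩, ?_⟩
    rintro _ ⟨U, hU, V, hV, hUl, hVl, hUV, rfl⟩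
    obtain ⟨s, rfl⟩ := mem_affineSpan_pair_iff_exists_lineMap_eq.1 hUl
    obtain ⟨t, rfl⟩ := mem_affineSpan_pair_iff_exists_lineMap_eq.1 hVl
    have hdiff : AffineMap.lineMap P Q s - AffineMap.lineMap P Q t = (s - t) • (Q - P) := by
      simp only [AffineMap.lineMap_apply, vsub_eq_sub, vadd_eq_add]
      module
    have h1 : intForm c (AffineMap.lineMap P Q s - AffineMap.lineMap P Q t) = s - t := by
      rw [hdiff, map_smul, hc, smul_eq_mul, mul_one]
    have h2 : 1 ≤ |s - t| := by
      apply one_le_abs_of_ne_zero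
      · rw [← h1]
        exact exists_intForm_eq c (sub_mem_integerPoints hU hV)
      · intro h0
        apply hUV
        rw [sub_eq_zero.1 h0]
    rw [dist_eq_norm (AffineMap.lineMap P Q s), hdiff, norm_smul, Real.norm_eq_abs, dist_comm,
      dist_eq_norm]
    exact le_mul_of_one_le_left (norm_nonneg _) h2
  rw [integerLength, hleast.csInf_eq]
  exact div_self (dist_pos.2 hne).ne'

theorem mem_plane_iff {P Q R X : E3} :
    X ∈ plane P Q R ↔ ∃ s t : ℝ, X = P + s • (Q - P) + t • (R - P) := by
  constructor
  · intro hX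
    have hle : plane P Q R ≤ AffineSubspace.mk' P (Submodule.span ℝ {Q - P, R - P}) := by
      refine affineSpan_le.2 ?_
      rintro Y (rfl | rfl | rfl)
      · exact AffineSubspace.self_mem_mk' _ _
      · exact AffineSubspace.mem_mk'.2 (Submodule.subset_span (by simp))
      · exact AffineSubspace.mem_mk'.2 (Submodule.subset_span (by simp))
    obtain ⟨s, t, hst⟩ := Submodule.mem_span_pair.1 (AffineSubspace.mem_mk'.1 (hle hX))
    refine ⟨s, t, ?_⟩
    rw [vsub_eq_sub] at hst
    rw [add_assoc, hst]
    abel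
  · rintro ⟨s, t, rfl⟩
    have hP : P ∈ plane P Q R := subset_affineSpan ℝ _ (by simp)
    have hQ : Q ∈ plane P Q R := subset_affineSpan ℝ _ (by simp)
    have hR : R ∈ plane P Q R := subset_affineSpan ℝ _ (by simp)
    have h1 := add_mem (Submodule.smul_mem _ s (AffineSubspace.vsub_mem_direction hQ hP))
      (Submodule.smul_mem _ t (AffineSubspace.vsub_mem_direction hR hP))
    have h2 := AffineSubspace.vadd_mem_of_mem_direction h1 hP
    simp only [vsub_eq_sub, vadd_eq_add] at h2
    convert h2 using 1
    abel

/-- The Gram determinant is multiplied by the square of the determinant of the coefficients. -/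
theorem triangleArea_eq {U V W e₁ e₂ : E3} {s₁ s₂ t₁ t₂ : ℝ} (hV : V - U = s₁ • e₁ + s₂ • e₂)
    (hW : W - U = t₁ • e₁ + t₂ • e₂) :
    triangleArea U V W = |s₁ * t₂ - s₂ * t₁| * triangleArea 0 e₁ e₂ := by
  have h1 : ‖V - U‖ ^ 2 * ‖W - U‖ ^ 2 - (inner ℝ (V - U) (W - U)) ^ 2 =
      (s₁ * t₂ - s₂ * t₁) ^ 2 * (‖e₁ - 0‖ ^ 2 * ‖e₂ - 0‖ ^ 2 - (inner ℝ (e₁ - 0) (e₂ - 0)) ^ 2) := by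
    rw [hV, hW]
    simp only [sub_zero, ← real_inner_self_eq_norm_sq, inner_add_left, inner_add_right,
      real_inner_smul_left, real_inner_smul_right, real_inner_comm e₁ e₂]
    ring
  rw [triangleArea, h1, Real.sqrt_mul (sq_nonneg _), Real.sqrt_sq_eq_abs, triangleArea]
  ring

/-- The Gram determinant times ‖e₁‖² is the squared norm of ‖e₁‖² e₂ - ⟨e₁, e₂⟩ e₁, and `f₂` does
not vanish on this vector. -/
theorem triangleArea_pos {e₁ e₂ : E3} (f₁ f₂ : E3 →ₗ[ℝ] ℝ) (h₁ : f₁ e₁ = 1) (h₂₁ : f₂ e₁ = 0)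
    (h₂ : f₂ e₂ = 1) : 0 < triangleArea 0 e₁ e₂ := by
  have hne : e₁ ≠ 0 := by
    rintro rfl
    simp at h₁
  have hpos : 0 < ‖e₁‖ ^ 2 := by positivity
  have hv : ‖e₁‖ ^ 2 • e₂ - (inner ℝ e₁ e₂ : ℝ) • e₁ ≠ 0 := by
    intro h0
    have h1 := congrArg f₂ h0
    rw [map_sub, map_smul, map_smul, h₂₁, h₂, map_zero, smul_eq_mul, smul_eq_mul] at h1
    linarith
  have h1 : 0 < ‖‖e₁‖ ^ 2 • e₂ - (inner ℝ e₁ e₂ : ℝ) • e₁‖ ^ 2 := by positivity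
  have h2 : ‖‖e₁‖ ^ 2 • e₂ - (inner ℝ e₁ e₂ : ℝ) • e₁‖ ^ 2 =
      ‖e₁‖ ^ 2 * (‖e₁‖ ^ 2 * ‖e₂‖ ^ 2 - (inner ℝ e₁ e₂) ^ 2) := by
    simp only [← real_inner_self_eq_norm_sq, inner_sub_left, inner_sub_right,
      real_inner_smul_left, real_inner_smul_right, real_inner_comm e₁ e₂]
    ring
  rw [h2] at h1
  have h3 := pos_of_mul_pos_right h1 hpos.le
  rw [triangleArea]
  simp only [sub_zero]
  have := Real.sqrt_pos.2 h3
  positivity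

theorem affineIndependent_of_dual {P e₁ e₂ : E3} (f₁ f₂ : E3 →ₗ[ℝ] ℝ) (h₁ : f₁ e₁ = 1)
    (h₁₂ : f₁ e₂ = 0) (h₂₁ : f₂ e₁ = 0) (h₂ : f₂ e₂ = 1) :
    AffineIndependent ℝ ![P, P + e₁, P + e₂] := by
  rw [affineIndependent_iff]
  intro s w hw hwp
  let w' : Fin 3 → ℝ := fun i => if i ∈ s then w i else 0
  have e1 : ∑ i, w' i = 0 := by
    rw [← hw]
    simp [w', Finset.sum_ite_mem]
  have e2 : ∑ i, w' i • (![P, P + e₁, P + e₂] : Fin 3 → E3) i = 0 := by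
    rw [← hwp]
    simp only [w', ite_smul, zero_smul, Finset.sum_ite_mem, Finset.univ_inter]
  rw [Fin.sum_univ_three] at e1 e2
  simp only [Matrix.cons_val] at e2
  have e3 : w' 1 • e₁ + w' 2 • e₂ = 0 := by
    have h0 : w' 0 = -w' 1 - w' 2 := by linarith
    rw [h0] at e2
    rw [← e2]
    module
  have g1 : w' 1 = 0 := by
    have := congrArg f₁ e3
    simpa [h₁, h₁₂] using this
  have g2 : w' 2 = 0 := by
    have := congrArg f₂ e3
    simpa [h₂, h₂₁] using this
  have g0 : w' 0 = 0 := by linarith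
  intro i hi
  have g : w' i = 0 := by
    fin_cases i
    · exact g0
    · exact g1
    · exact g2
  simpa [w', hi] using g

theorem det_ne_zero_of_affineIndependent {U V W e₁ e₂ : E3} {s₁ s₂ t₁ t₂ : ℝ}
    (hV : V - U = s₁ • e₁ + s₂ • e₂) (hW : W - U = t₁ • e₁ + t₂ • e₂)
    (h : AffineIndependent ℝ ![U, V, W]) : s₁ * t₂ - s₂ * t₁ ≠ 0 := by
  intro h0
  rw [affineIndependent_iff] at h
  have key : ∀ x y : ℝ, x • (V - U) + y • (W - U) = 0 → x = 0 ∧ y = 0 := by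
    intro x y hxy
    have h1 := h Finset.univ ![-x - y, x, y] (by simp [Fin.sum_univ_three]; ring) (by
      rw [← hxy]
      simp only [Fin.sum_univ_three, Matrix.cons_val]
      module)
    exact ⟨by simpa using h1 1 (Finset.mem_univ _), by simpa using h1 2 (Finset.mem_univ _)⟩
  have k1 := key t₂ (-s₂) (by
    rw [hV, hW]
    have : t₂ • (s₁ • e₁ + s₂ • e₂) + -s₂ • (t₁ • e₁ + t₂ • e₂) = (s₁ * t₂ - s₂ * t₁) • e₁ := by
      module
    rw [this, h0, zero_smul])
  have k2 := key t₁ (-s₁) (by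
    rw [hV, hW]
    have : t₁ • (s₁ • e₁ + s₂ • e₂) + -s₁ • (t₁ • e₁ + t₂ • e₂) = -(s₁ * t₂ - s₂ * t₁) • e₂ := by
      module
    rw [this, h0, neg_zero, zero_smul])
  have k3 := key 1 0 (by
    rw [hV, neg_eq_zero.1 k1.2, neg_eq_zero.1 k2.2]
    simp)
  exact one_ne_zero k3.1

/-- The integer area of a triangle whose sides have the determinant `±k` in a basis of the integer
vectors of its plane. -/
theorem integerArea_eq {P Q R e₁ e₂ : E3} (hP : P ∈ integerPoints) (he₁ : e₁ ∈ integerPoints)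
    (he₂ : e₂ ∈ integerPoints) (c₁ c₂ : Fin 3 → ℤ) (h₁ : intForm c₁ e₁ = 1)
    (h₁₂ : intForm c₁ e₂ = 0) (h₂₁ : intForm c₂ e₁ = 0) (h₂ : intForm c₂ e₂ = 1)
    {s₁ s₂ t₁ t₂ : ℝ} (hQ : Q - P = s₁ • e₁ + s₂ • e₂) (hR : R - P = t₁ • e₁ + t₂ • e₂)
    (hdet : s₁ * t₂ - s₂ * t₁ ≠ 0) : integerArea P Q R = |s₁ * t₂ - s₂ * t₁| := by
  have hpos := triangleArea_pos (intForm c₁) (intForm c₂) h₁ h₂₁ h₂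
  have hmem : ∀ x y : ℝ, P + x • e₁ + y • e₂ ∈ plane P Q R := by
    intro x y
    refine mem_plane_iff.2 ⟨(x * t₂ - y * t₁) / (s₁ * t₂ - s₂ * t₁),
      (y * s₁ - x * s₂) / (s₁ * t₂ - s₂ * t₁), ?_⟩
    rw [hQ, hR]
    have g1 : (x * t₂ - y * t₁) / (s₁ * t₂ - s₂ * t₁) * s₁ +
        (y * s₁ - x * s₂) / (s₁ * t₂ - s₂ * t₁) * t₁ = x := by
      rw [div_mul_eq_mul_div, div_mul_eq_mul_div, ← add_div, div_eq_iff hdet]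
      ring
    have g2 : (x * t₂ - y * t₁) / (s₁ * t₂ - s₂ * t₁) * s₂ +
        (y * s₁ - x * s₂) / (s₁ * t₂ - s₂ * t₁) * t₂ = y := by
      rw [div_mul_eq_mul_div, div_mul_eq_mul_div, ← add_div, div_eq_iff hdet]
      ring
    conv_lhs => rw [← g1, ← g2]
    module
  -- The dual covectors read off the coefficients of a difference of points of the plane. For
  -- integer points these are integers, so a nondegenerate integer triangle has a nonzero integer
  -- determinant.
  have hexp : ∀ U V, U ∈ plane P Q R → V ∈ plane P Q R →
      V - U = intForm c₁ (V - U) • e₁ + intForm c₂ (V - U) • e₂ := by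
    intro U V hU hV
    obtain ⟨x, y, rfl⟩ := mem_plane_iff.1 hU
    obtain ⟨x', y', rfl⟩ := mem_plane_iff.1 hV
    rw [hQ, hR]
    have : ∀ z w : ℝ, z • e₁ + w • e₂ =
        intForm c₁ (z • e₁ + w • e₂) • e₁ + intForm c₂ (z • e₁ + w • e₂) • e₂ := by
      intro z w
      simp [h₁, h₁₂, h₂₁, h₂]
    have h2 : P + x' • (s₁ • e₁ + s₂ • e₂) + y' • (t₁ • e₁ + t₂ • e₂) -
        (P + x • (s₁ • e₁ + s₂ • e₂) + y • (t₁ • e₁ + t₂ • e₂)) =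
        ((x' - x) * s₁ + (y' - y) * t₁) • e₁ + ((x' - x) * s₂ + (y' - y) * t₂) • e₂ := by
      module
    rw [h2]
    exact this _ _
  have hleast : IsLeast {s | ∃ U ∈ integerPoints, ∃ V ∈ integerPoints, ∃ W ∈ integerPoints,
      U ∈ plane P Q R ∧ V ∈ plane P Q R ∧ W ∈ plane P Q R ∧
      AffineIndependent ℝ ![U, V, W] ∧ s = triangleArea U V W} (triangleArea 0 e₁ e₂) := by
    refine ⟨⟨P, hP, P + e₁, add_mem_integerPoints hP he₁, P + e₂, add_mem_integerPoints hP he₂,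
      ?_, ?_, ?_, affineIndependent_of_dual (intForm c₁) (intForm c₂) h₁ h₁₂ h₂₁ h₂, ?_⟩, ?_⟩
    · simpa using hmem 0 0
    · simpa using hmem 1 0
    · simpa using hmem 0 1
    · rw [triangleArea_eq (U := P) (e₁ := e₁) (e₂ := e₂) (s₁ := 1) (s₂ := 0) (t₁ := 0) (t₂ := 1)
        (by simp) (by simp)]
      simp
    · rintro _ ⟨U, hU, V, hV, W, hW, hU', hV', hW', hind, rfl⟩
      have e1 := hexp U V hU' hV'
      have e2 := hexp U W hU' hW'
      rw [triangleArea_eq e1 e2]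
      refine le_mul_of_one_le_left hpos.le (one_le_abs_of_ne_zero ?_
        (det_ne_zero_of_affineIndependent e1 e2 hind))
      obtain ⟨k1, hk1⟩ := exists_intForm_eq c₁ (sub_mem_integerPoints hV hU)
      obtain ⟨k2, hk2⟩ := exists_intForm_eq c₂ (sub_mem_integerPoints hV hU)
      obtain ⟨k3, hk3⟩ := exists_intForm_eq c₁ (sub_mem_integerPoints hW hU)
      obtain ⟨k4, hk4⟩ := exists_intForm_eq c₂ (sub_mem_integerPoints hW hU)
      exact ⟨k1 * k4 - k2 * k3, by rw [hk1, hk2, hk3, hk4]; push_cast; ring⟩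
  rw [integerArea, hleast.csInf_eq, triangleArea_eq hQ hR]
  exact mul_div_cancel_right₀ _ hpos.ne'

theorem infDist_hyperplane {n : E3} (hn : n ≠ 0) (d : ℝ) (p : E3) :
    Metric.infDist p {q : E3 | inner ℝ n q = d} = |inner ℝ n p - d| / ‖n‖ := by
  have hn' : 0 < ‖n‖ := norm_pos_iff.2 hn
  -- The foot of the perpendicular from `p`.
  have hmem : p - ((inner ℝ n p - d) / ‖n‖ ^ 2) • n ∈ {q : E3 | inner ℝ n q = d} := by
    rw [Set.mem_ofPred_eq, inner_sub_right, real_inner_smul_right, real_inner_self_eq_norm_sq]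
    field_simp
    ring
  refine le_antisymm ?_ ?_
  · refine (Metric.infDist_le_dist_of_mem hmem).trans_eq ?_
    rw [dist_eq_norm, sub_sub_cancel, norm_smul, Real.norm_eq_abs, abs_div,
      abs_of_pos (by positivity : 0 < ‖n‖ ^ 2)]
    field_simp
  · refine (Metric.le_infDist ⟨_, hmem⟩).2 (fun {q} hq => ?_)
    rw [Set.mem_ofPred_eq] at hq
    rw [div_le_iff₀ hn', ← hq, ← inner_sub_right, dist_eq_norm, mul_comm]
    exact abs_real_inner_le_norm _ _

theorem coe_plane {p : Fin 3 → E3} (hp : LinearIndependent ℝ p) {f : E3 →ₗ[ℝ] ℝ} {d : ℝ}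
    (hd : d ≠ 0) (hf : ∀ k, f (p k) = d) :
    (plane (p 0) (p 1) (p 2) : Set E3) = {q | f q = d} := by
  ext q
  rw [SetLike.mem_coe, mem_plane_iff, Set.mem_ofPred_eq]
  constructor
  · rintro ⟨s, t, rfl⟩
    simp [hf]
  · intro hq
    obtain ⟨x, y, z, rfl⟩ : ∃ x y z : ℝ, q = x • p 0 + y • p 1 + z • p 2 := by
      let b := basisOfLinearIndependentOfCardEqFinrank hp (by simp)
      have h1 := b.sum_repr q
      simp only [Fin.sum_univ_three, b, coe_basisOfLinearIndependentOfCardEqFinrank] at h1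
      exact ⟨_, _, _, h1.symm⟩
    simp only [map_add, map_smul, hf, smul_eq_mul] at hq
    have h3 : x = 1 - y - z := by
      apply mul_right_cancel₀ hd
      linear_combination hq
    refine ⟨y, z, ?_⟩
    rw [h3]
    module

/-- The integer distance from the origin to the plane `f = d` of a primitive integer form `f`. -/
theorem integerDistance_zero {p : Fin 3 → E3} (hp : LinearIndependent ℝ p)
    (hpi : p 0 ∈ integerPoints) {c : Fin 3 → ℤ} {d : ℤ} (hd : 0 < d)
    (hc : ∀ k, intForm c (p k) = d) {u : E3} (hu : u ∈ integerPoints) (hcu : intForm c u = 1) :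
    integerDistance (plane (p 0) (p 1) (p 2)) 0 = d := by
  have hd' : (0 : ℝ) < d := by exact_mod_cast hd
  let n : E3 := pt (c 0) (c 1) (c 2)
  have hn : ∀ q, intForm c q = inner ℝ n q := by
    intro q
    rw [intForm_apply, PiLp.inner_apply, Fin.sum_univ_three]
    simp [n, pt_apply_zero, pt_apply_one, pt_apply_two, mul_comm]
  have hn0 : n ≠ 0 := by
    intro h0
    rw [hn, h0] at hcu
    simp at hcu
  have hn' : 0 < ‖n‖ := norm_pos_iff.2 hn0
  have hpl : (plane (p 0) (p 1) (p 2) : Set E3) = {q | inner ℝ n q = (d : ℝ)} := by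
    rw [coe_plane hp hd'.ne' hc]
    ext q
    rw [Set.mem_ofPred_eq, Set.mem_ofPred_eq, hn]
  have hmem : ∀ q, q ∈ plane (p 0) (p 1) (p 2) ↔ intForm c q = d := by
    intro q
    rw [← SetLike.mem_coe, hpl, Set.mem_ofPred_eq, hn]
  -- The distance from an integer point `q` to the plane is |c·q - d| / ‖n‖. The numerator is a
  -- nonzero integer off the plane, and it is 1 at `p 0 + u`.
  have hleast : IsLeast {e | ∃ q ∈ integerPoints, q ∉ plane (p 0) (p 1) (p 2) ∧
      e = Metric.infDist q (plane (p 0) (p 1) (p 2))} (1 / ‖n‖) := by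
    constructor
    · refine ⟨p 0 + u, add_mem_integerPoints hpi hu, ?_, ?_⟩
      · rw [hmem, map_add, hc, hcu]
        simp
      · rw [hpl, infDist_hyperplane hn0, ← hn, map_add, hc, hcu]
        simp
    · rintro _ ⟨q, hq, hq', rfl⟩
      rw [hpl, infDist_hyperplane hn0, ← hn]
      refine div_le_div_of_nonneg_right ?_ hn'.le
      rw [hmem] at hq'
      refine one_le_abs_of_ne_zero ?_ (sub_ne_zero.2 hq')
      obtain ⟨k, hk⟩ := exists_intForm_eq c hq
      exact ⟨k - d, by rw [hk]; push_cast; ring⟩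
  rw [integerDistance, hleast.csInf_eq, hpl, infDist_hyperplane hn0]
  rw [inner_zero_right, zero_sub, abs_neg, abs_of_pos hd']
  field_simp

/-! ### Eigenplanes, orthants and irreducibility -/

namespace IsSpectrum

variable {a : ℤ} {r : Fin 3 → ℝ} (h : IsSpectrum a r)
include h

theorem eigv_ne_zero (ha : 0 ≤ a) (i : Fin 3) : eigv r i ≠ 0 := fun h0 =>
  h.ell_eigv_self_ne_zero ha i (by rw [h0, map_zero])

theorem hasEigenvector (ha : 0 ≤ a) (i : Fin 3) :
    Module.End.HasEigenvector (act (opA a)) (r i) (eigv r i) := by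
  refine ⟨Module.End.mem_eigenspace_iff.2 (h.ext_ell ha (fun j => ?_)), h.eigv_ne_zero ha i⟩
  rw [h.eigenform_opA, map_smul, smul_eq_mul]
  by_cases hij : i = j
  · rw [hij]
  · rw [ell_eigv_of_ne hij, mul_zero, mul_zero]

theorem exists_of_hasEigenvector (ha : 0 ≤ a) {μ : ℝ} {v : E3}
    (hv : Module.End.HasEigenvector (act (opA a)) μ v) :
    ∃ i, ell r i v ≠ 0 ∧ ∀ j, j ≠ i → ell r j v = 0 := by
  have h1 : ∀ j, r j * ell r j v = μ * ell r j v := fun j => by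
    rw [← h.eigenform_opA, hv.apply_eq_smul, map_smul, smul_eq_mul]
  have hex : ∃ i, ell r i v ≠ 0 := by
    by_contra! hz
    exact hv.2 (h.ext_ell ha (fun i => by rw [hz i, map_zero]))
  obtain ⟨i, hi⟩ := hex
  refine ⟨i, hi, fun j hj => ?_⟩
  by_contra h2
  exact hj (h.injective ha ((mul_right_cancel₀ h2 (h1 j)).trans (mul_right_cancel₀ hi (h1 i)).symm))

theorem linearIndependent_eigv (ha : 0 ≤ a) {i j : Fin 3} (hij : i ≠ j) :
    LinearIndependent ℝ ![eigv r i, eigv r j] := by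
  rw [LinearIndependent.pair_iff]
  intro s t hst
  have h1 := congrArg (ell r i) hst
  have h2 := congrArg (ell r j) hst
  simp only [map_add, map_smul, ell_eigv_of_ne hij, ell_eigv_of_ne hij.symm, map_zero,
    smul_eq_mul, mul_zero, add_zero, zero_add] at h1 h2
  exact ⟨(mul_eq_zero.1 h1).resolve_right (h.ell_eigv_self_ne_zero ha i),
    (mul_eq_zero.1 h2).resolve_right (h.ell_eigv_self_ne_zero ha j)⟩

theorem mem_span_eigv (ha : 0 ≤ a) {k : Fin 3} {p : E3} (hp : ell r k p = 0) :
    p ∈ Submodule.span ℝ {eigv r (k + 1), eigv r (k + 2)} := by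
  refine Submodule.mem_span_pair.2 ⟨ell r (k + 1) p / ell r (k + 1) (eigv r (k + 1)),
    ell r (k + 2) p / ell r (k + 2) (eigv r (k + 2)), h.ext_ell ha (fun i => ?_)⟩
  have n1 := h.ell_eigv_self_ne_zero ha (k + 1)
  have n2 := h.ell_eigv_self_ne_zero ha (k + 2)
  have d1 : k + 1 ≠ k := (by decide : ∀ k : Fin 3, k + 1 ≠ k) k
  have d2 : k + 2 ≠ k := (by decide : ∀ k : Fin 3, k + 2 ≠ k) k
  have d3 : k + 1 ≠ k + 2 := (by decide : ∀ k : Fin 3, k + 1 ≠ k + 2) k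
  have hi : i = k ∨ i = k + 1 ∨ i = k + 2 :=
    (by decide : ∀ i k : Fin 3, i = k ∨ i = k + 1 ∨ i = k + 2) i k
  rw [map_add, map_smul, map_smul, smul_eq_mul, smul_eq_mul]
  rcases hi with rfl | rfl | rfl
  · rw [ell_eigv_of_ne d1, ell_eigv_of_ne d2, hp]
    ring
  · rw [ell_eigv_of_ne d3.symm, div_mul_cancel₀ _ n1]
    ring
  · rw [ell_eigv_of_ne d3, div_mul_cancel₀ _ n2]
    ring

/-- The eigenvalues are distinct, so every eigenvector lies on one of three lines and the
eigenplanes are the kernels of the three eigenforms. -/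
theorem mem_eigenplanesCompl_iff (ha : 0 ≤ a) {p : E3} :
    p ∈ eigenplanesCompl (opA a) ↔ ∀ i, ell r i p ≠ 0 := by
  rw [eigenplanesCompl, Set.mem_compl_iff, ← not_exists, not_iff_not]
  simp only [Set.mem_iUnion, exists_prop]
  constructor
  · rintro ⟨H, ⟨μ, ν, v, w, hv, hw, hvw, rfl⟩, hp⟩
    obtain ⟨i, hi, hi'⟩ := h.exists_of_hasEigenvector ha hv
    obtain ⟨j, hj, hj'⟩ := h.exists_of_hasEigenvector ha hw
    have hij : i ≠ j := by
      rintro rfl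
      have h1 : ell r i w • v + (-ell r i v) • w = 0 := by
        refine h.ext_ell ha (fun k => ?_)
        rw [map_add, map_smul, map_smul, map_zero, smul_eq_mul, smul_eq_mul]
        by_cases hk : k = i
        · rw [hk]; ring
        · rw [hi' k hk, hj' k hk]; ring
      exact hj (LinearIndependent.pair_iff.1 hvw _ _ h1).1
    obtain ⟨k, hki, hkj⟩ := (by decide : ∀ i j : Fin 3, ∃ k, k ≠ i ∧ k ≠ j) i j
    obtain ⟨s, t, rfl⟩ := Submodule.mem_span_pair.1 hp
    exact ⟨k, by rw [map_add, map_smul, map_smul, hi' k hki, hj' k hkj]; simp⟩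
  · rintro ⟨k, hk⟩
    refine ⟨_, ⟨r (k + 1), r (k + 2), eigv r (k + 1), eigv r (k + 2), h.hasEigenvector ha _,
      h.hasEigenvector ha _, h.linearIndependent_eigv ha ?_, rfl⟩, h.mem_span_eigv ha hk⟩
    exact (by decide : ∀ k : Fin 3, k + 1 ≠ k + 2) k

/-- The orthant of a point is given by the signs of the eigenforms. -/
theorem connectedComponentIn_eq (ha : 0 ≤ a) {p : E3} (hp : p ∈ eigenplanesCompl (opA a)) :
    connectedComponentIn (eigenplanesCompl (opA a)) p = {q | ∀ i, 0 < ell r i p * ell r i q} := by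
  have hp' := (h.mem_eigenplanesCompl_iff ha).1 hp
  refine Set.Subset.antisymm (fun q hq i => ?_) ?_
  · have himg : IsPreconnected (ell r i '' connectedComponentIn (eigenplanesCompl (opA a)) p) :=
      isPreconnected_connectedComponentIn.image _
        (LinearMap.continuous_of_finiteDimensional (ell r i)).continuousOn
    have hpi : ell r i p ∈ ell r i '' connectedComponentIn (eigenplanesCompl (opA a)) p :=
      Set.mem_image_of_mem _ (mem_connectedComponentIn hp)
    have hqi : ell r i q ∈ ell r i '' connectedComponentIn (eigenplanesCompl (opA a)) p :=
      Set.mem_image_of_mem _ hq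
    have h0 : (0 : ℝ) ∉ ell r i '' connectedComponentIn (eigenplanesCompl (opA a)) p := by
      rintro ⟨x, hx, hx0⟩
      exact (h.mem_eigenplanesCompl_iff ha).1 (connectedComponentIn_subset _ _ hx) i hx0
    by_contra! hneg
    rcases mul_nonpos_iff.1 hneg with ⟨h1, h2⟩ | ⟨h1, h2⟩
    · exact h0 (himg.ordConnected.out hqi hpi ⟨h2, h1⟩)
    · exact h0 (himg.ordConnected.out hpi hqi ⟨h1, h2⟩)
  -- Conversely, the set of points with the prescribed signs is convex, hence connected.
  · have hconv : Convex ℝ {q | ∀ i, 0 < ell r i p * ell r i q} := by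
      have : {q | ∀ i, 0 < ell r i p * ell r i q} = ⋂ i, {q | 0 < (ell r i p • ell r i) q} := by
        ext q
        simp
      rw [this]
      exact convex_iInter (fun i => convex_halfSpace_gt (ell r i p • ell r i).isLinear 0)
    refine hconv.isPreconnected.subset_connectedComponentIn
      (fun i => mul_self_pos.2 (hp' i)) (fun q hq => ?_)
    exact (h.mem_eigenplanesCompl_iff ha).2 (fun i => right_ne_zero_of_mul (hq i).ne')

theorem isOrthant_orthant (ha : 0 ≤ a) : IsOrthant (opA a) (orthant r) := by
  have hA : ptA ∈ eigenplanesCompl (opA a) :=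
    (h.mem_eigenplanesCompl_iff ha).2 (fun i => by rw [ell_ptA]; exact one_ne_zero)
  refine ⟨ptA, hA, ?_⟩
  rw [h.connectedComponentIn_eq ha hA]
  ext q
  simp [ell_ptA, orthant]

/-- The sail lies in the closed half-spaces given by the signs of the orthant, and every eigenform
equals 1 at A, so all the signs are positive. -/
theorem eq_orthant (ha : 0 ≤ a) {O : Set E3} (hO : IsOrthant (opA a) O) (hA : ptA ∈ sail O) :
    O = orthant r := by
  obtain ⟨p, hp, rfl⟩ := hO
  have hp' := (h.mem_eigenplanesCompl_iff ha).1 hp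
  rw [h.connectedComponentIn_eq ha hp] at hA ⊢
  have hpos : ∀ i, 0 < ell r i p := by
    intro i
    have hcl : IsClosed {q | 0 ≤ (ell r i p • ell r i) q} :=
      isClosed_le continuous_const (LinearMap.continuous_of_finiteDimensional _)
    have hconv : Convex ℝ {q | 0 ≤ (ell r i p • ell r i) q} :=
      convex_halfSpace_ge (ell r i p • ell r i).isLinear 0
    have h1 : closure {q | ∀ i, 0 < ell r i p * ell r i q} ⊆ {q | 0 ≤ (ell r i p • ell r i) q} :=
      closure_minimal (fun q hq => (hq i).le) hcl
    have h2 : sailHull {q | ∀ i, 0 < ell r i p * ell r i q} ⊆ {q | 0 ≤ (ell r i p • ell r i) q} :=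
      convexHull_min (fun q hq => h1 hq.1.1) hconv
    have h3 := closure_minimal h2 hcl (frontier_subset_closure hA)
    have h4 : 0 ≤ ell r i p * ell r i ptA := h3
    rw [ell_ptA, mul_one] at h4
    exact lt_of_le_of_ne h4 (hp' i).symm
  ext q
  exact forall_congr' (fun i => mul_pos_iff_of_pos_left (hpos i))

end IsSpectrum

-- A reducible cubic would have a rational root. Such a root is an integer dividing 1, but the
-- values at 1 and -1 are `a + 3` and `3 * a + 1`.
open Polynomial in
theorem irreducible_charpoly_opA {a : ℤ} (ha : 0 ≤ a) :
    Irreducible ((opA a : Matrix (Fin 3) (Fin 3) ℤ).map (Int.cast : ℤ → ℚ)).charpoly := by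
  have hchar : ((opA a : Matrix (Fin 3) (Fin 3) ℤ).map (Int.cast : ℤ → ℚ)).charpoly =
      ((X ^ 3 + C (2 * a + 3) * X ^ 2 + C (-a) * X + C (-1) : ℤ[X])).map (Int.castRingHom ℚ) := by
    rw [Matrix.charpoly, Matrix.det_fin_three, opA_coe]
    simp [map_ofNat C]
    ring
  have hmonic : (X ^ 3 + C (2 * a + 3) * X ^ 2 + C (-a) * X + C (-1) : ℤ[X]).Monic := by
    monicity!
  have hdeg : (X ^ 3 + C (2 * a + 3) * X ^ 2 + C (-a) * X + C (-1) : ℤ[X]).natDegree = 3 := by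
    compute_degree!
  rw [hchar, (hmonic.map _).irreducible_iff_roots_eq_zero_of_degree_le_three]
  · rw [Multiset.eq_zero_iff_forall_notMem]
    intro q hq
    have hroot := (mem_roots'.1 hq).2
    rw [IsRoot, eval_map, ← algebraMap_int_eq, ← aeval_def] at hroot
    obtain ⟨n, rfl⟩ := isInteger_of_is_root_of_monic hmonic hroot
    rw [aeval_algebraMap_apply] at hroot
    simp at hroot
    have h1 : n ^ 3 + (2 * a + 3) * n ^ 2 - a * n - 1 = 0 := by
      have : (n : ℚ) ^ 3 + (2 * a + 3) * n ^ 2 - a * n - 1 = 0 := by linarith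
      exact_mod_cast this
    have h2 : n * (n ^ 2 + (2 * a + 3) * n - a) = 1 := by linarith
    rcases Int.isUnit_iff.1 (IsUnit.of_mul_eq_one _ h2) with rfl | rfl
    · linarith
    · linarith
  · rw [hmonic.natDegree_map, hdeg]
    norm_num
  · rw [hmonic.natDegree_map, hdeg]

/-! ### The fundamental region and its numerical invariants -/

theorem cell_image_univ {Λ V : Type} [DecidableEq Λ] [AddCommGroup V] [Module ℝ V] (P : Λ → V)
    (v : Fin 3 → Λ) : cell P (Finset.univ.image v) = tri (P (v 0)) (P (v 1)) (P (v 2)) := by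
  rw [← cell_triple]
  congr 1
  ext x
  simp [Fin.exists_fin_succ, eq_comm]

theorem IsScheme.iUnion_schemeCells {T V : Type} [AddCommGroup V] [Module ℝ V]
    {lab : T → Fin 3 → Label} {Sch : ℕ → Finset (Finset Label)} (hS : IsScheme lab Sch)
    (htop : ∀ t, Finset.univ.image (lab t) ∈ Sch 2) (P : Label → V) :
    (⋃ k, ⋃ F ∈ schemeCells P Sch k, F) = ⋃ t, cell P (Finset.univ.image (lab t)) := by
  refine Set.Subset.antisymm (Set.iUnion_subset fun k => Set.iUnion₂_subset ?_)
    (Set.iUnion_subset fun t => ?_)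
  · rintro _ ⟨σ, hσ, rfl⟩
    obtain ⟨t, s, -, rfl⟩ := hS.simplex k σ hσ
    refine Set.subset_iUnion_of_subset t (convexHull_mono (Set.image_mono ?_))
    exact_mod_cast Finset.image_subset_image (Finset.subset_univ s)
  · exact Set.subset_iUnion_of_subset 2
      (Set.subset_biUnion_of_mem (u := fun F => F) ⟨_, htop t, rfl⟩)

section Faces

variable {T : Type} [Finite T] [Nonempty T] {a : ℤ} (ha : 0 ≤ a) {r : Fin 3 → ℝ}
  (h : IsSpectrum a r) {lab : T → Fin 3 → Label} {f : T → Fin 3 → ℤ} {d : T → ℤ}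
  (hF : IsFundamentalData a r lab f d)
include ha h hF

theorem sum_smul_vert_mem_sail (t : T) {b : Fin 3 → ℝ} (hb : ∀ k, 0 ≤ b k) (hb1 : ∑ k, b k = 1) :
    ∑ k, b k • vert a (lab t k) ∈ sail (orthant r) := by
  have := (develop_apply ha h hF t 0 hb hb1).1
  rwa [latOp_zero, act_one_apply] at this

theorem vert_mem_sail (t : T) (k : Fin 3) : vert a (lab t k) ∈ sail (orthant r) := by
  have := sum_smul_vert_mem_sail ha h hF t (b := Pi.single k 1)
    (fun l => by by_cases hl : l = k <;> simp [hl]) (by simp)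
  simpa [Pi.single_apply] using this

/-- A face consisting of one point is extreme, hence a vertex of some translate; a vertex lying in a
base triangle is one of its own. -/
theorem setOf_isFace_zero :
    {p | p ∈ ⋃ t, cell (vert a) (Finset.univ.image (lab t)) ∧ IsFace (orthant r) 0 {p}} =
      Set.range (fun x : T × Fin 3 => vert a (lab x.1 x.2)) := by
  have hC := hF.isConvexTriangulation ha h
  have h0 (t : T) : shiftVtx lab (t, 0) = lab t := funext (fun k => shift_zero (lab t k))
  ext p
  constructor
  · rintro ⟨hp, hface⟩
    obtain ⟨t, ht⟩ := Set.mem_iUnion.1 hp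
    obtain ⟨τ, k, rfl⟩ := hC.mem_extremePoints_iff.1
      ⟨isExtreme_singleton.1 hface.2.2.1.isExtreme, hface.2.1 rfl⟩
    rw [← h0 t] at ht
    obtain ⟨l, -, hl⟩ := Finset.mem_image.1 (hC.mem_of_vertex_mem_cell ht)
    rw [h0] at hl
    exact ⟨(t, l), congrArg (vert a) hl⟩
  · rintro ⟨⟨t, k⟩, rfl⟩
    refine ⟨Set.mem_iUnion.2 ⟨t, subset_convexHull ℝ _ ⟨lab t k, by simp, rfl⟩⟩, ?_⟩
    have := isFace_cell ha h hF (t := t) (q := 0) (s := {k}) (k := 0) rfl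
    simpa [shift_zero, cell_singleton] using this

/-- The coefficient -1 makes the covector primitive: it takes the value 1 at (-1, 0, 0). -/
theorem integerDistance_face (t : T) (ht : f t 0 = -1) :
    integerDistance (plane (vert a (lab t 0)) (vert a (lab t 1)) (vert a (lab t 2))) 0 = d t := by
  have hC := hF.isConvexTriangulation ha h
  have hi : vert a (lab t 0) ∈ integerPoints := by
    have := (hC.mem (t, 0) 0).1.2
    rwa [shiftVtx, shift_zero] at this
  refine integerDistance_zero (hF.indep t) hi (hF.pos t) (hF.height t) (pt_mem (-1) 0 0) ?_
  rw [intForm_pt, ht]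
  norm_num

end Faces

theorem IsSpectrum.eq_zero_of_zpow_mul_zpow_eq_one {a : ℤ} {r : Fin 3 → ℝ} (h : IsSpectrum a r)
    (ha : 0 ≤ a) {i j : ℤ} (hij : opX a ^ i * opY a ^ j = 1) : i = 0 ∧ j = 0 := by
  have h1 : act (latOp a (i, j)) ptA = ptA := by
    rw [latOp, hij, act_one_apply]
  exact Prod.mk_eq_zero.1 (h.eq_zero_of_act_latOp_eq ha (ptA_mem_orthant r) h1)

theorem integerLength_pt {x y z x' y' z' : ℤ} (c : Fin 3 → ℤ)
    (hc : c 0 * (x' - x) + c 1 * (y' - y) + c 2 * (z' - z) = 1) :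
    integerLength (pt x y z) (pt x' y' z') = 1 := by
  refine integerLength_eq_one (pt_mem x y z) (pt_mem x' y' z') c ?_
  rw [map_sub, intForm_pt, intForm_pt]
  have : (c 0 * (x' - x) + c 1 * (y' - y) + c 2 * (z' - z) : ℝ) = 1 := by exact_mod_cast hc
  push_cast
  linarith

theorem pt_sub_pt (x y z x' y' z' : ℤ) :
    pt x y z - pt x' y' z' = pt (x - x') (y - y') (z - z') :=
  ext_three (by simp [pt_apply_zero]) (by simp [pt_apply_one]) (by simp [pt_apply_two])

theorem integerArea_pt_eq_one {x y z x' y' z' x'' y'' z'' : ℤ} (c₁ c₂ : Fin 3 → ℤ)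
    (h₁ : c₁ 0 * (x' - x) + c₁ 1 * (y' - y) + c₁ 2 * (z' - z) = 1)
    (h₁₂ : c₁ 0 * (x'' - x) + c₁ 1 * (y'' - y) + c₁ 2 * (z'' - z) = 0)
    (h₂₁ : c₂ 0 * (x' - x) + c₂ 1 * (y' - y) + c₂ 2 * (z' - z) = 0)
    (h₂ : c₂ 0 * (x'' - x) + c₂ 1 * (y'' - y) + c₂ 2 * (z'' - z) = 1) :
    integerArea (pt x y z) (pt x' y' z') (pt x'' y'' z'') = 1 := by
  have key := integerArea_eq (P := pt x y z) (Q := pt x' y' z') (R := pt x'' y'' z'')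
    (pt_mem x y z) (pt_mem (x' - x) (y' - y) (z' - z)) (pt_mem (x'' - x) (y'' - y) (z'' - z)) c₁ c₂
    (by rw [intForm_pt]; exact_mod_cast h₁) (by rw [intForm_pt]; exact_mod_cast h₁₂)
    (by rw [intForm_pt]; exact_mod_cast h₂₁) (by rw [intForm_pt]; exact_mod_cast h₂)
    (s₁ := 1) (s₂ := 0) (t₁ := 0) (t₂ := 1) (by rw [pt_sub_pt]; module)
    (by rw [pt_sub_pt]; module) (by norm_num)
  rw [key]
  norm_num

theorem iUnion_fin_two {α : Type} (s : Fin 2 → Set α) : ⋃ t, s t = s 0 ∪ s 1 := by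
  ext x
  simp [Fin.exists_fin_two]

theorem iUnion_fin_four {α : Type} (s : Fin 4 → Set α) : ⋃ t, s t = s 0 ∪ s 1 ∪ s 2 ∪ s 3 := by
  ext x
  simp [Fin.exists_fin_succ, or_assoc]

theorem iUnion_cell_labTwo :
    ⋃ t, cell (vert 0) (Finset.univ.image (labTwo t)) = tri ptA ptB (ptD 0) ∪ tri ptB ptC (ptD 0) := by
  rw [iUnion_fin_two, cell_image_univ, cell_image_univ, ← vert_A 0, ← vert_B 0, ← vert_C 0,
    ← vert_D 0]
  rfl

theorem iUnion_cell_labFour (a : ℤ) :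
    ⋃ t, cell (vert a) (Finset.univ.image (labFour t)) =
      tri ptA ptB (ptD a) ∪ tri ptB (ptD a) ptE ∪ tri ptB ptC ptE ∪ tri ptC ptE (ptD a) := by
  rw [iUnion_fin_four, cell_image_univ, cell_image_univ, cell_image_univ, cell_image_univ,
    ← vert_A a, ← vert_B a, ← vert_C a, ← vert_D a, ← vert_E a]
  rfl

theorem range_vert_labTwo (a : ℤ) :
    Set.range (fun x : Fin 2 × Fin 3 => vert a (labTwo x.1 x.2)) = {ptA, ptB, ptC, ptD a} := by
  have h1 : Finset.univ.image (fun x : Fin 2 × Fin 3 => labTwo x.1 x.2) =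
      {(false, 0, 0), (false, 0, 1), (false, 1, 1), (false, 1, 0)} := by decide
  have h2 := congrArg (fun s : Finset Label => vert a '' (s : Set Label)) h1
  rw [← vert_A a, ← vert_B a, ← vert_C a, ← vert_D a]
  simpa [Set.image_insert_eq, ← Set.range_comp, Function.comp_def] using h2

theorem range_vert_labFour (a : ℤ) :
    Set.range (fun x : Fin 4 × Fin 3 => vert a (labFour x.1 x.2)) =
      {ptA, ptB, ptC, ptD a, ptE} := by
  have h1 : Finset.univ.image (fun x : Fin 4 × Fin 3 => labFour x.1 x.2) =
      {(false, 0, 0), (false, 0, 1), (false, 1, 1), (false, 1, 0), (true, 0, 0)} := by decide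
  have h2 := congrArg (fun s : Finset Label => vert a '' (s : Set Label)) h1
  rw [← vert_A a, ← vert_B a, ← vert_C a, ← vert_D a, ← vert_E a]
  simpa [Set.image_insert_eq, ← Set.range_comp, Function.comp_def] using h2

theorem schemeCells_vert_schTwo (a : ℤ) :
    schemeCells (vert a) schTwo = schemeTwo ptA ptB ptC (ptD a) := by
  funext k
  rw [schemeCells_schTwo, vert_A, vert_B, vert_C, vert_D]

theorem schemeCells_vert_schFour (a : ℤ) :
    schemeCells (vert a) schFour = schemeFour ptA ptB ptC (ptD a) ptE := by
  funext k
  rw [schemeCells_schFour, vert_A, vert_B, vert_C, vert_D, vert_E]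

theorem modelTwo_eq :
    modelTwo = fun k => (fun c => toTorus '' c) '' schemeCells modelVert schTwo k := by
  funext k
  rw [schemeCells_schTwo, modelVert_A, modelVert_B, modelVert_C, modelVert_D, modelTwo]

theorem modelFour_eq :
    modelFour = fun k => (fun c => toTorus '' c) '' schemeCells modelVert schFour k := by
  funext k
  rw [schemeCells_schFour, modelVert_A, modelVert_B, modelVert_C, modelVert_D, modelVert_E,
    modelFour]

theorem three_smul_ptE : (3 : ℝ) • ptE = ptB + ptC + ptD 0 := by
  refine ext_three ?_ ?_ ?_ <;>
    simp [ptE, ptB, ptC, ptD, pt_apply_zero, pt_apply_one, pt_apply_two] <;> norm_num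

theorem integerArea_BCD : integerArea ptB ptC (ptD 0) = 3 := by
  -- The vectors (1, 1, 0) and (2, 0, 1) form a basis of the integer vectors with -x + y + 2z = 0,
  -- on which the last two coordinates are the dual covectors.
  have key := integerArea_eq (P := ptB) (Q := ptC) (R := ptD 0) (e₁ := pt 1 1 0) (e₂ := pt 2 0 1)
    (pt_mem 2 1 1) (pt_mem 1 1 0) (pt_mem 2 0 1) ![0, 1, 0] ![0, 0, 1]
    (by simp [intForm_pt]) (by simp [intForm_pt]) (by simp [intForm_pt]) (by simp [intForm_pt])
    (s₁ := 3) (s₂ := 1) (t₁ := 0) (t₂ := -1)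
    (by
      refine ext_three ?_ ?_ ?_ <;>
        simp [ptB, ptC, pt_apply_zero, pt_apply_one, pt_apply_two] <;> norm_num)
    (by
      refine ext_three ?_ ?_ ?_ <;>
        simp [ptB, ptD, pt_apply_zero, pt_apply_one, pt_apply_two])
    (by norm_num)
  rw [key]
  norm_num

theorem integerLength_AB : integerLength ptA ptB = 1 := integerLength_pt ![0, 1, 0] (by simp)

theorem integerLength_BC : integerLength ptB ptC = 1 := integerLength_pt ![0, 0, 1] (by simp)

theorem integerLength_CD (a : ℤ) : integerLength ptC (ptD a) = 1 :=
  integerLength_pt ![0, 1, -2] (by simp)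

theorem integerLength_DA (a : ℤ) : integerLength (ptD a) ptA = 1 :=
  integerLength_pt ![0, 0, 1] (by simp)

theorem integerLength_BD (a : ℤ) : integerLength ptB (ptD a) = 1 :=
  integerLength_pt ![0, 0, -1] (by simp)

theorem integerLength_BE : integerLength ptB ptE = 1 := integerLength_pt ![1, 0, 0] (by simp)

theorem integerLength_CE : integerLength ptC ptE = 1 := integerLength_pt ![0, 0, -1] (by simp)

theorem integerLength_DE (a : ℤ) : integerLength (ptD a) ptE = 1 :=
  integerLength_pt ![0, 0, 1] (by simp)

theorem integerArea_ABD (a : ℤ) : integerArea ptA ptB (ptD a) = 1 :=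
  integerArea_pt_eq_one ![0, 1, 1] ![0, 0, -1] (by simp) (by simp) (by simp) (by simp)

theorem integerArea_BDE (a : ℤ) : integerArea ptB (ptD a) ptE = 1 :=
  integerArea_pt_eq_one ![0, 0, -1] ![0, 1, 0] (by simp) (by simp) (by simp) (by simp)

theorem integerArea_BCE : integerArea ptB ptC ptE = 1 :=
  integerArea_pt_eq_one ![0, 0, 1] ![0, 1, -3] (by simp) (by simp) (by simp) (by simp)

theorem integerArea_CED (a : ℤ) : integerArea ptC ptE (ptD a) = 1 :=
  integerArea_pt_eq_one ![0, -2, 3] ![0, 1, -2] (by simp) (by simp) (by simp) (by simp)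

section Sail

variable {a : ℤ} {r : Fin 3 → ℝ} (h : IsSpectrum a r)
include h

theorem IsSpectrum.ptA_mem_sail (ha : 0 ≤ a) : ptA ∈ sail (orthant r) := by
  rw [← vert_A a]
  rcases ha.eq_or_lt with h0 | h0
  · exact vert_mem_sail ha h (h.isFundamentalData_two h0.symm) 0 0
  · exact vert_mem_sail ha h (h.isFundamentalData_four h0) 0 0

/-- For `a = 0` the point E is not a vertex but the centroid of the face BCD. -/
theorem IsSpectrum.ptE_mem_sail (ha : 0 ≤ a) : ptE ∈ sail (orthant r) := by
  rcases ha.eq_or_lt with h0 | h0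
  · have h1 := sum_smul_vert_mem_sail ha h (h.isFundamentalData_two h0.symm) 1
      (b := fun _ => 1 / 3) (fun _ => by norm_num) (by simp)
    have h2 : ∑ k, (1 / 3 : ℝ) • vert a (labTwo 1 k) = (1 / 3 : ℝ) • (ptB + ptC + ptD a) := by
      rw [← Finset.smul_sum, Fin.sum_univ_three, ← vert_B a, ← vert_C a, ← vert_D a]
      rfl
    rw [h2, ← h0, ← three_smul_ptE, smul_smul] at h1
    simpa using h1
  · rw [← vert_E a]
    exact vert_mem_sail ha h (h.isFundamentalData_four h0) 1 2

theorem IsSpectrum.periodGroup_orthant (ha : 0 ≤ a) :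
    periodGroup (opA a) (orthant r) = Subgroup.closure {opX a, opY a} := by
  rcases ha.eq_or_lt with h0 | h0
  · exact periodGroup_eq_closure ha h (h.isFundamentalData_two h0.symm) isScheme_two
  · exact periodGroup_eq_closure ha h (h.isFundamentalData_four h0) isScheme_four

end Sail

end TorusSail

theorem proposition3p2 (a : ℤ) (ha : 0 ≤ a) :
    -- the operator defines a continued fraction of a cubic irrationality
    Irreducible ((opA a : Matrix (Fin 3) (Fin 3) ℤ).map (Int.cast : ℤ → ℚ)).charpoly ∧
    (∃ l : Fin 3 → ℝ, StrictMono l ∧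
      ∀ i, Module.End.HasEigenvalue (act (opA a)) (l i)) ∧
    -- there is exactly one sail containing the point `(0, 0, 1)`
    (∃! O : Set E3, IsOrthant (opA a) O ∧ ptA ∈ sail O) ∧
    ∀ O : Set E3, IsOrthant (opA a) O → ptA ∈ sail O →
      -- the period group is free abelian with the basis `X`, `Y`
      periodGroup (opA a) O = Subgroup.closure {opX a, opY a} ∧
      opX a * opY a = opY a * opX a ∧
      (∀ i j : ℤ, opX a ^ i * opY a ^ j = 1 → i = 0 ∧ j = 0) ∧
      -- the gluing of the sides
      act (opX a) ptA = ptD a ∧ act (opX a) ptB = ptC ∧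
      act (opX a) '' segment ℝ ptA ptB = segment ℝ (ptD a) ptC ∧
      act (opY a) ptA = ptB ∧ act (opY a) (ptD a) = ptC ∧
      act (opY a) '' segment ℝ ptA (ptD a) = segment ℝ ptB ptC ∧
      -- the point `E` belongs to the sail
      ptE ∈ sail O ∧
      -- the case `a = 0`
      (a = 0 →
        HomeomorphicDecompositions (sailTriangulation (opA a) O) modelTwo ∧
        IsFundamentalFamily (opA a) O (schemeTwo ptA ptB ptC (ptD a)) ∧
        (⋃ k, ⋃ F ∈ schemeTwo ptA ptB ptC (ptD a) k, F) =
          tri ptA ptB (ptD a) ∪ tri ptB ptC (ptD a) ∧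
        {p | p ∈ tri ptA ptB (ptD a) ∪ tri ptB ptC (ptD a) ∧ IsFace O 0 {p}} =
          {ptA, ptB, ptC, ptD a} ∧
        (3 : ℝ) • ptE = ptB + ptC + ptD a ∧
        integerLength ptA ptB = 1 ∧ integerLength ptB ptC = 1 ∧
        integerLength ptC (ptD a) = 1 ∧ integerLength (ptD a) ptA = 1 ∧
        integerArea ptA ptB (ptD a) = 1 ∧ integerArea ptB ptC (ptD a) = 3 ∧
        integerDistance (plane ptA ptB (ptD a)) 0 = 2 ∧
        integerDistance (plane ptB ptC (ptD a)) 0 = 1) ∧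
      -- the case `a > 0`
      (0 < a →
        HomeomorphicDecompositions (sailTriangulation (opA a) O) modelFour ∧
        IsFundamentalFamily (opA a) O (schemeFour ptA ptB ptC (ptD a) ptE) ∧
        (⋃ k, ⋃ F ∈ schemeFour ptA ptB ptC (ptD a) ptE k, F) =
          tri ptA ptB (ptD a) ∪ tri ptB (ptD a) ptE ∪ tri ptB ptC ptE ∪ tri ptC ptE (ptD a) ∧
        {p | p ∈ tri ptA ptB (ptD a) ∪ tri ptB (ptD a) ptE ∪ tri ptB ptC ptE ∪
            tri ptC ptE (ptD a) ∧ IsFace O 0 {p}} =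
          {ptA, ptB, ptC, ptD a, ptE} ∧
        integerLength ptA ptB = 1 ∧ integerLength ptB ptC = 1 ∧
        integerLength ptC (ptD a) = 1 ∧ integerLength (ptD a) ptA = 1 ∧
        integerLength ptB (ptD a) = 1 ∧ integerLength ptB ptE = 1 ∧
        integerLength ptC ptE = 1 ∧ integerLength (ptD a) ptE = 1 ∧
        integerArea ptA ptB (ptD a) = 1 ∧ integerArea ptB (ptD a) ptE = 1 ∧
        integerArea ptB ptC ptE = 1 ∧ integerArea ptC ptE (ptD a) = 1 ∧
        integerDistance (plane ptA ptB (ptD a)) 0 = a + 2 ∧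
        integerDistance (plane ptB (ptD a) ptE) 0 = a + 1 ∧
        integerDistance (plane ptB ptC ptE) 0 = 1 ∧
        integerDistance (plane ptC ptE (ptD a)) 0 = 1) := by
  obtain ⟨r, h⟩ := exists_isSpectrum ha
  refine ⟨irreducible_charpoly_opA ha,
    ⟨r, h.strictMono ha, fun i => Module.End.hasEigenvalue_of_hasEigenvector (h.hasEigenvector ha i)⟩,
    ⟨orthant r, ⟨h.isOrthant_orthant ha, h.ptA_mem_sail ha⟩,
      fun O hO => h.eq_orthant ha hO.1 hO.2⟩, fun O hO hA => ?_⟩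
  obtain rfl := h.eq_orthant ha hO hA
  refine ⟨h.periodGroup_orthant ha, (commute_opX_opY a).eq,
    fun i j hij => h.eq_zero_of_zpow_mul_zpow_eq_one ha hij, act_opX_ptA a, act_opX_ptB a, ?_,
    act_opY_ptA a, act_opY_ptD a, ?_, h.ptE_mem_sail ha, ?_, ?_⟩
  · rw [← act_opX_ptA, ← act_opX_ptB a]
    exact image_segment ℝ (act (opX a)).toAffineMap ptA ptB
  · rw [← act_opY_ptA a, ← act_opY_ptD a]
    exact image_segment ℝ (act (opY a)).toAffineMap ptA (ptD a)
  · rintro rfl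
    have hF := h.isFundamentalData_two rfl
    have hS := isScheme_two
    have hd0 := integerDistance_face ha h hF 0 rfl
    have hd1 := integerDistance_face ha h hF 1 rfl
    rw [modelTwo_eq, ← schemeCells_vert_schTwo, hS.iUnion_schemeCells (by decide),
      ← iUnion_cell_labTwo, ← range_vert_labTwo, setOf_isFace_zero ha h hF]
    refine ⟨homeomorphicDecompositions ha h hF hS isSquareTiling_two,
      isFundamentalFamily ha h hF hS, rfl, rfl, three_smul_ptE, integerLength_AB,
      integerLength_BC, integerLength_CD 0, integerLength_DA 0, integerArea_ABD 0, integerArea_BCD,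
      ?_, ?_⟩
    · rw [← vert_A 0, ← vert_B 0, ← vert_D 0]
      simpa [labTwo, heightTwo] using hd0
    · rw [← vert_B 0, ← vert_C 0, ← vert_D 0]
      simpa [labTwo, heightTwo] using hd1
  · intro h0
    have hF := h.isFundamentalData_four h0
    have hS := isScheme_four
    have hd0 := integerDistance_face ha h hF 0 rfl
    have hd1 := integerDistance_face ha h hF 1 rfl
    have hd2 := integerDistance_face ha h hF 2 rfl
    have hd3 := integerDistance_face ha h hF 3 rfl
    rw [modelFour_eq, ← schemeCells_vert_schFour, hS.iUnion_schemeCells (by decide),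
      ← iUnion_cell_labFour, ← range_vert_labFour, setOf_isFace_zero ha h hF]
    refine ⟨homeomorphicDecompositions ha h hF hS (isSquareTiling_four a),
      isFundamentalFamily ha h hF hS, rfl, rfl, integerLength_AB,
      integerLength_BC, integerLength_CD a, integerLength_DA a, integerLength_BD a,
      integerLength_BE, integerLength_CE, integerLength_DE a, integerArea_ABD a, integerArea_BDE a,
      integerArea_BCE, integerArea_CED a, ?_, ?_, ?_, ?_⟩
    · rw [← vert_A a, ← vert_B a, ← vert_D a]
      simpa [labFour, heightFour] using hd0
    · rw [← vert_B a, ← vert_D a, ← vert_E a]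
      simpa [labFour, heightFour] using hd1
    · rw [← vert_B a, ← vert_C a, ← vert_E a]
      simpa [labFour, heightFour] using hd2
    · rw [← vert_C a, ← vert_E a, ← vert_D a]
      simpa [labFour, heightFour] using hd3
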